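/- Let $R\subset\mathbb R^n$ be an irreducible reduced crystallographic root system, with simple roots $\alpha_1,\dots,\alpha_n$, Weyl group $W$, $\alpha^\vee=2\alpha/(\alpha,\alpha)$, and invariant form normalized by $(\alpha,\alpha)=2$ for short roots. Let $\omega_i$ be the fundamental weights, $P=\bigoplus_i\mathbb Z\omega_i$, $\vartheta$ the highest coroot (it is a short root), $\alpha_0=\alpha_0^\vee=[-\vartheta,1]\in\mathbb R^n\times\mathbb R$, and let $m$ be the least positive integer with $m(P,P)\subset\mathbb Z$. On $\mathbb R^n\times\mathbb R\ni[z,\zeta]$ put $s_i([z,\zeta])=[z,\zeta]-(z,\alpha_i^\vee)\alpha_i$ ($0\le i\le n$), where $(z,\alpha_0^\vee)=-(z,\vartheta)$, and $b([z,\zeta])=[z,\zeta-(z,b)]$ for $b\in P$. Let $m_{ij}$ be the order of $s_is_j$. Let $O\subset\{0,\dots,n\}$ be the orbit of $0$ under the automorphisms of the completed Dynkin diagram (with vertices $\alpha_0,\dots,\alpha_n$), and $O'=O\setminus\{0\}$. For $r\in O'$ put $u_r=w_0w_0^{(r)}$, where $w_0$ is the longest element of $W$ and $w_0^{(r)}$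 is the longest element of the stabilizer of $\omega_r$ in $W$; let $\pi_r=\omega_ru_r^{-1}$, $\pi_0=1$, $\Pi=\{\pi_r : r\in O\}$ (a group), and $\pi_{r^*}=\pi_r^{-1}$. Write $X_{[b,j]}=X_bq^j$, $Y_{[b,j]}=Y_bq^{-j}$. The double affine braid group $\mathfrak B$ is generated by a central element $q^{1/(2m)}$, pairwise commuting $X_b$ ($b\in P$, $X_{a+b}=X_aX_b$), $T_i$ ($0\le i\le n$) and the group $\Pi$, with the relations: $T_iT_jT_i\cdots=T_jT_iT_j\cdots$ ($m_{ij}$ factors on each side; no relation if $m_{ij}=\infty$); $\pi_rT_i\pi_r^{-1}=T_j$ if $\pi_r(\alpha_i)=\alpha_j$; $T_iX_bT_i=X_bX_{\alpha_i}^{-1}$ if $(b,\alpha_i^\vee)=1$; $T_iX_b=X_bT_i$ if $(b,\alpha_i^\vee)=0$; $\pi_rX_b\pi_r^{-1}=X_{\pi_r(b)}$. For a reduced decomposition $w=\pi_rs_{i_1}\cdots s_{i_l}$ put $T_w=\pi_rT_{i_1}\cdots T_{i_l}$, and let $Y_b=\prod_iT_{\omega_i}^{l_i}$ for $b=\sum_il_i\omega_i$,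 $Y_r=Y_{\omega_r}$, $X_r=X_{\omega_r}$. The universal double affine braid group $\widehat{\mathfrak B}$ is generated by a central element $q^{1/(2m)}$, pairwise commuting $X_b$ and pairwise commuting $Y_b$ ($b\in P$, with $X_{a+b}=X_aX_b$, $Y_{a+b}=Y_aY_b$), $\widehat T_i$ ($0\le i\le n$) and a group $\widehat\Pi=\{\widehat\pi_r : r\in O\}$ with the multiplication table of $\Pi$ ($\widehat\pi_r\leftrightarrow\pi_r$), subject to the above relations with $\widehat T_i,\widehat\pi_r$ in place of $T_i,\pi_r$, and to $\widehat T_i^{-1}Y_b\widehat T_i^{-1}=Y_bY_{\alpha_i}^{-1}$ if $(b,\alpha_i^\vee)=1$, $\widehat T_iY_b=Y_b\widehat T_i$ if $(b,\alpha_i^\vee)=0$ ($0\le i\le n$), $\widehat\pi_rY_b\widehat\pi_r^{-1}=Y_{\pi_r(b)}$. No relations between $X$ and $Y$ are imposed. Theorem. (1) There is a homomorphism $\mathfrak{pr}:\widehat{\mathfrak B}\to\mathfrak B$ with $X_b\mapsto X_b$, $Y_b\mapsto Y_b$, $\widehat T_i\mapsto T_i$ ($i>0$), $\widehat T_0\mapsto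 q^{-1}X_\vartheta T_{s_\vartheta}Y_\vartheta^{-1}$, $\widehat\pi_r\mapsto q^{(\omega_r,\omega_r)/2}Y_rT_{u_r}^{-1}X_{r^*}^{-1}$ ($r\in O'$), $q^{1/(2m)}\mapsto q^{1/(2m)}$. It induces an isomorphism from the quotient of $\widehat{\mathfrak B}$ by the relations $$\widehat T_0=q^{-1}X_\vartheta\widehat T_{s_\vartheta}Y_\vartheta^{-1},\qquad \widehat\pi_r=q^{(\omega_r,\omega_r)/2}\,Y_r\widehat T_{u_r}^{-1}X_{r^*}^{-1}\quad(r\in O')\qquad(*)$$ onto $\mathfrak B$. (2) $\mathfrak B$ has an automorphism $\tau_+$ with $X_b\mapsto X_b$, $Y_r\mapsto X_rY_rq^{-(\omega_r,\omega_r)/2}$ ($r\in O'$), $T_i\mapsto T_i$ ($i\ge1$), $Y_\vartheta\mapsto q^{-1}X_\vartheta T_0^{-1}T_{s_\vartheta}$, $T_0\mapsto q^{-1}X_\vartheta T_0^{-1}$, $q^{1/(2m)}\mapsto q^{1/(2m)}$, and $\mathfrak{pr}(\widehat T_i)=\tau_+(T_i)$ for $0\le i\le n$, $\mathfrak{pr}(\widehat\pi_r)=\tau_+(\pi_r)$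 for $r\in O$. (3) $\widehat{\mathfrak B}$ has an involutive automorphism $\widehat\varepsilon$ with $X_b\leftrightarrow Y_b$, $\widehat T_i\mapsto\widehat T_i^{-1}$ ($0\le i\le n$), $\widehat\pi_r\mapsto\widehat\pi_r$, $q^{1/(2m)}\mapsto q^{-1/(2m)}$. It maps the normal subgroup of $\widehat{\mathfrak B}$ generated by the relations $(*)$ onto itself, and $\mathfrak{pr}\circ\widehat\varepsilon=\varepsilon\circ\mathfrak{pr}$ for an involutive automorphism $\varepsilon$ of $\mathfrak B$ with $X_b\mapsto Y_b$, $Y_b\mapsto X_b$, $T_i\mapsto T_i^{-1}$ ($i\ge1$), $q^{1/(2m)}\mapsto q^{-1/(2m)}$. -/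

import Mathlib

noncomputable section

/-- A shortest word in the letters `κ` whose product under `s` is `g`, that is, a reduced
decomposition of `g` (one of them is selected; only used when `g` is a product of values of
`s`). -/
def redWord {κ G : Type*} [Group G] (s : κ → G) (g : G) : List κ :=
  Classical.epsilon fun w => (w.map s).prod = g ∧
    ∀ w' : List κ, (w'.map s).prod = g → w.length ≤ w'.length

/-- The choices that are fixed along with a root system `R ⊂ V` (the coroots live in the dual
space `N`): simple roots, the invariant form with `(α, α) = 2` for short roots `α`, and the root
`ϑ` whose coroot is the highest one (`ϑ` is the maximal short root, and under the identification
`α^∨ = 2 α / (α, α)` it is equal to its coroot). -/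
structure AffineData {ι V N : Type*} [AddCommGroup V] [Module ℝ V] [AddCommGroup N] [Module ℝ N]
    (R : RootPairing ι ℝ V N) where
  /-- simple roots -/
  base : R.Base
  /-- the form -/
  form : R.InvariantForm
  two_le_form : ∀ i, 2 ≤ form.form (R.root i) (R.root i)
  form_eq_two : ∃ i, form.form (R.root i) (R.root i) = 2
  /-- the index of `ϑ` -/
  theta : ι
  theta_highest : ∀ i, R.coroot theta - R.coroot i ∈
    AddSubmonoid.closure (R.coroot '' (base.support : Set ι))

namespace AffineData

section Weyl

variable {ι V N : Type*} [AddCommGroup V] [Module ℝ V] [AddCommGroup N] [Module ℝ N]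
  {R : RootPairing ι ℝ V N} (D : AffineData R)

/-- The indices `1, …, n` of the simple roots. -/
abbrev Simple : Type _ := {i : ι // i ∈ D.base.support}

/-- The indices `0, 1, …, n` of the simple affine roots; `0` is `none`. -/
abbrev Node : Type _ := Option D.Simple

/-- `α₀ = [-ϑ, 1]` and `α_i = [α_i, 0]` for `i > 0`. -/
def simpleRoot : D.Node → V × ℝ
  | none => (-R.root D.theta, 1)
  | some i => (R.root i, 0)

/-- The functional `z ↦ (z, α_i^∨)` on `V`; it is `z ↦ -(z, ϑ)` for `i = 0`. -/
def corootForm : D.Node → (V →ₗ[ℝ] ℝ)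
  | none => -R.coroot' D.theta
  | some i => R.coroot' i

theorem corootForm_simpleRoot (i : D.Node) :
    ((D.corootForm i).comp (LinearMap.fst ℝ V ℝ)) (D.simpleRoot i) = 2 := by
  cases i <;> simp [corootForm, simpleRoot]

/-- The reflection `s_i [z, ζ] = [z, ζ] - (z, α_i^∨) α_i`. -/
def simpleReflection (i : D.Node) : (V × ℝ) ≃ₗ[ℝ] (V × ℝ) :=
  Module.reflection (D.corootForm_simpleRoot i)

/-- The reflection `s_ϑ`, as an operator on `V × ℝ`. -/
def thetaReflection : (V × ℝ) ≃ₗ[ℝ] (V × ℝ) :=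
  Module.reflection (x := (R.root D.theta, (0 : ℝ)))
    (f := (R.coroot' D.theta).comp (LinearMap.fst ℝ V ℝ)) (by simp)

/-- The translation `b [z, ζ] = [z, ζ - (z, b)]`. -/
def translation (b : V) : (V × ℝ) ≃ₗ[ℝ] (V × ℝ) where
  toFun z := (z.1, z.2 - D.form.form z.1 b)
  invFun z := (z.1, z.2 + D.form.form z.1 b)
  map_add' x y := by ext <;> simp; ring
  map_smul' c x := by ext <;> simp; ring
  left_inv x := by simp
  right_inv x := by simp

/-- The affine Weyl group, acting on `V × ℝ`. -/
def affineWeyl : Subgroup ((V × ℝ) ≃ₗ[ℝ] (V × ℝ)) :=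
  Subgroup.closure (Set.range D.simpleReflection)

/-- The Weyl group `W`, acting on `V × ℝ`. -/
def weyl : Subgroup ((V × ℝ) ≃ₗ[ℝ] (V × ℝ)) :=
  Subgroup.closure (Set.range fun i : D.Simple => D.simpleReflection (some i))

/-- A reduced decomposition of `w ∈ W`. -/
def weylWord (w : (V × ℝ) ≃ₗ[ℝ] (V × ℝ)) : List D.Simple :=
  redWord (fun i : D.Simple => D.simpleReflection (some i)) w

/-- The element of maximal length of a subset of `W`. -/
def longest (S : Set ((V × ℝ) ≃ₗ[ℝ] (V × ℝ))) : (V × ℝ) ≃ₗ[ℝ] (V × ℝ) :=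
  Classical.epsilon fun w => w ∈ S ∧ ∀ v ∈ S, (D.weylWord v).length ≤ (D.weylWord w).length

/-- The set `O` of the images of `0` under the automorphisms of the completed Dynkin diagram,
i.e. the permutations of the nodes that preserve all `(α_i, α_j^∨)`. -/
def orbitO : Set D.Node :=
  {r | ∃ g : Equiv.Perm D.Node,
    (∀ i j, D.corootForm (g j) (D.simpleRoot (g i)).1 = D.corootForm j (D.simpleRoot i).1) ∧
    g none = r}

/-- The node `0 ∈ O`. -/
def zeroO : D.orbitO := ⟨none, 1, by simp, rfl⟩

instance : Nonempty D.orbitO := ⟨D.zeroO⟩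

end Weyl

section Weights

variable {ι V N : Type*} [AddCommGroup V] [Module ℝ V] [AddCommGroup N] [Module ℝ N]
  {R : RootPairing ι ℝ V N} [R.IsRootSystem] (D : AffineData R)

/-- The fundamental weights: `(ω_i, α_j^∨) = δ_ij`; moreover `ω_0 = 0`. -/
def omega : D.Node → V
  | none => 0
  | some i => R.toPerfPair.symm (D.base.toCoweightBasis.coord i)

theorem coroot_omega [DecidableEq D.Simple] (i j : D.Simple) :
    R.toLinearMap (D.omega (some i)) (R.coroot j) = if i = j then 1 else 0 := by
  have h : R.toLinearMap (D.omega (some i)) = D.base.toCoweightBasis.coord i :=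
    R.toPerfPair.apply_symm_apply _
  rw [h, Module.Basis.coord_apply, ← D.base.toCoweightBasis_apply, Module.Basis.repr_self,
    Finsupp.single_apply]
  simp [eq_comm]

/-- The weight lattice `P = ⊕ ℤ ω_i`. -/
def weights : AddSubgroup V := AddSubgroup.closure (Set.range D.omega)

/-- The fundamental weight `ω_i` (or `ω_0 = 0`) as an element of `P`. -/
def fundWeight (i : D.Node) : D.weights :=
  ⟨D.omega i, AddSubgroup.subset_closure ⟨i, rfl⟩⟩

theorem root_mem_weights [R.IsCrystallographic] (k : ι) : R.root k ∈ D.weights := by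
  classical
  have h : R.root k = ∑ i : D.Simple, R.pairing k i • D.omega (some i) := by
    apply R.toPerfPair.injective
    apply D.base.toCoweightBasis.ext
    intro j
    have h1 : ∀ v n, R.toPerfPair v n = R.toLinearMap v n := fun _ _ => rfl
    rw [h1, h1, D.base.toCoweightBasis_apply, map_sum, LinearMap.sum_apply]
    simp_rw [map_smul, LinearMap.smul_apply]
    rw [Finset.sum_congr rfl fun i _ => by rw [D.coroot_omega i j]]
    simp
  rw [h]
  refine AddSubgroup.sum_mem _ fun i _ => ?_
  obtain ⟨z, hz⟩ := R.exists_value (S := ℤ) k i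
  rw [← hz, algebraMap_int_eq, eq_intCast, Int.cast_smul_eq_zsmul]
  exact AddSubgroup.zsmul_mem _ (D.fundWeight (some i)).2 z

/-- The finite part of `α_i` as an element of `P`: it is `-ϑ` for `i = 0`. -/
def simpleWeight [R.IsCrystallographic] : (i : D.Node) → D.weights
  | none => -(⟨R.root D.theta, D.root_mem_weights D.theta⟩ : D.weights)
  | some i => ⟨R.root i, D.root_mem_weights i⟩

/-- The root `ϑ` as an element of `P`. -/
def thetaWeight [R.IsCrystallographic] : D.weights :=
  ⟨R.root D.theta, D.root_mem_weights D.theta⟩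

/-- The least natural number `m > 0` such that `m (P, P) ⊂ ℤ`. -/
def denom : ℕ :=
  sInf {k : ℕ | 0 < k ∧ ∀ b ∈ D.weights, ∀ c ∈ D.weights, ∃ z : ℤ, k * D.form.form b c = z}

/-- `u_r = w_0 w_0^b` for `b = ω_r`, where `w_0` is the longest element of `W` and `w_0^b` is the
longest element of the stabilizer of `b` in `W`; moreover `u_0 = 1`. -/
def u : D.Node → (V × ℝ) ≃ₗ[ℝ] (V × ℝ)
  | none => 1
  | some i => D.longest D.weyl *
      D.longest {w | w ∈ D.weyl ∧ w (D.omega (some i), 0) = (D.omega (some i), 0)}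

/-- `π_r = ω_r u_r⁻¹`, for `r ∈ O`. -/
def piElt (r : D.orbitO) : (V × ℝ) ≃ₗ[ℝ] (V × ℝ) :=
  D.translation (D.omega r) * (D.u r)⁻¹

/-- The index `r* ∈ O` such that `π_{r*} = π_r⁻¹`. -/
def star (r : D.orbitO) : D.orbitO :=
  Classical.epsilon fun s => D.piElt s = (D.piElt r)⁻¹

/-- For `w` in the extended Weyl group, the `r ∈ O` such that `w ∈ π_r W̃`. -/
def piPart (w : (V × ℝ) ≃ₗ[ℝ] (V × ℝ)) : D.orbitO :=
  Classical.epsilon fun r => (D.piElt r)⁻¹ * w ∈ D.affineWeyl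

section InGroup

variable {G : Type*} [Group G]

/-- `q^j` for `j ∈ (1/2m) ℤ`, where `c` plays the role of `q^{1/2m}`; the exponent of `c` is the
integer `2 m j`. -/
def qpow (c : G) (j : ℝ) : G := c ^ ⌊2 * D.denom * j⌋

/-- `T_w = T_{i_1} ⋯ T_{i_l}` for a reduced decomposition `w = s_{i_1} ⋯ s_{i_l}` of `w ∈ W`. -/
def weylT (T : D.Node → G) (w : (V × ℝ) ≃ₗ[ℝ] (V × ℝ)) : G :=
  ((D.weylWord w).map fun i => T (some i)).prod

/-- `T_w = π_r T_{i_1} ⋯ T_{i_l}` for `w = π_r s_{i_1} ⋯ s_{i_l}` in the extended Weyl group,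
where `s_{i_1} ⋯ s_{i_l}` is a reduced decomposition in the affine Weyl group. -/
def extT (T : D.Node → G) (p : D.orbitO → G) (w : (V × ℝ) ≃ₗ[ℝ] (V × ℝ)) : G :=
  p (D.piPart w) *
    ((redWord D.simpleReflection ((D.piElt (D.piPart w))⁻¹ * w)).map T).prod

/-- `Y_b = ∏ Y_i^{l_i}` for `b = ∑ l_i ω_i`, `l_i = (b, α_i^∨)`, where `Y_i = T_{ω_i}`. (The product
is taken in some fixed order of the indices.) -/
def prodY (T : D.Node → G) (p : D.orbitO → G) (b : D.weights) : G :=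
  ((Finset.univ : Finset D.Simple).toList.map fun i =>
    D.extT T p (D.translation (D.omega (some i))) ^ ⌊R.coroot' i (b : V)⌋).prod

/-- The product `T_i T_j T_i ⋯` or `T_j T_i T_j ⋯` with `m_ij` factors, where `m_ij` is the order
of `s_i s_j`. It is empty if `s_i s_j` is of infinite order. -/
def braidWord (T : D.Node → G) (i j : D.Node) : G :=
  ((CoxeterSystem.alternatingWord i j
    (orderOf (D.simpleReflection i * D.simpleReflection j))).map T).prod

end InGroup

/-! ### The double affine braid group -/

/-- Generators `X_b`, `T_i`, `π_r`, `q^{1/2m}`. -/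
inductive BGen
  | X (b : D.weights)
  | T (i : D.Node)
  | pi (r : D.orbitO)
  | q

/-- Generators `X_b`, `Y_b`, `hat T_i`, `hat π_r`, `q^{1/2m}`. -/
inductive UGen
  | X (b : D.weights)
  | Y (b : D.weights)
  | T (i : D.Node)
  | pi (r : D.orbitO)
  | q

section Relations

variable {G : Type*} [Group G]

/-- `LatticeRel X T p c a b` says that `a = b` is one of the following relations, where
`c = q^{1/2m}` and `X_{[b,j]} = X_b q^j`:
`X_{a+b} = X_a X_b` (so the `X_b` commute, and `X_b = ∏ X_i^{l_i}` for `b = ∑ l_i ω_i`);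
`c X_b = X_b c`;
`T_i X_b T_i = X_b X_{α_i}⁻¹` if `(b, α_i^∨) = 1`; `T_i X_b = X_b T_i` if `(b, α_i^∨) = 0`;
`π_r X_b π_r⁻¹ = X_{π_r(b)}`.
The relations for `Y` are those with `Y`, `T⁻¹`, `c⁻¹` in place of `X`, `T`, `c`, namely
`T_i⁻¹ Y_b T_i⁻¹ = Y_b Y_{α_i}⁻¹`, `T_i⁻¹ Y_b = Y_b T_i⁻¹`, `π_r Y_b π_r⁻¹ = Y_{π_r(b)}` for
`Y_{[b,j]} = Y_b q^{-j}`. -/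
inductive LatticeRel [R.IsCrystallographic] (X : D.weights → G) (T : D.Node → G)
    (p : D.orbitO → G) (c : G) : G → G → Prop
  | add (a b : D.weights) : LatticeRel X T p c (X (a + b)) (X a * X b)
  | central (b : D.weights) : LatticeRel X T p c (c * X b) (X b * c)
  | cross (i : D.Node) (b : D.weights) (h : D.corootForm i b = 1) :
      LatticeRel X T p c (T i * X b * T i)
        (X b * (X (D.simpleWeight i) * D.qpow c (D.simpleRoot i).2)⁻¹)
  | comm (i : D.Node) (b : D.weights) (h : D.corootForm i b = 0) :
      LatticeRel X T p c (T i * X b) (X b * T i)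
  | pi (r : D.orbitO) (b b' : D.weights) (j : ℝ) (h : D.piElt r ((b : V), 0) = ((b' : V), j)) :
      LatticeRel X T p c (p r * X b * (p r)⁻¹) (X b' * D.qpow c j)

/-- The relations between the `T_i` and the group `Π`: the braid relations, the multiplication
table of `Π`, the action of `Π` on the `T_i`; and `c` commutes with them. -/
inductive AffineRel (T : D.Node → G) (p : D.orbitO → G) (c : G) : G → G → Prop
  | braid (i j : D.Node) : AffineRel T p c (D.braidWord T i j) (D.braidWord T j i)
  | mul (r s t : D.orbitO) (h : D.piElt r * D.piElt s = D.piElt t) :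
      AffineRel T p c (p r * p s) (p t)
  | conj (r : D.orbitO) (i j : D.Node) (h : D.piElt r (D.simpleRoot i) = D.simpleRoot j) :
      AffineRel T p c (p r * T i * (p r)⁻¹) (T j)
  | centralT (i : D.Node) : AffineRel T p c (c * T i) (T i * c)
  | centralPi (r : D.orbitO) : AffineRel T p c (c * p r) (p r * c)

end Relations

variable [R.IsCrystallographic]

/-- The defining relations of the double affine braid group. -/
def bRels : Set (FreeGroup D.BGen) :=
  let X := fun b => FreeGroup.of (BGen.X (D := D) b)
  let T := fun i => FreeGroup.of (BGen.T (D := D) i)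
  let p := fun r => FreeGroup.of (BGen.pi (D := D) r)
  let c := FreeGroup.of (BGen.q (D := D))
  {x | ∃ a b, x = a * b⁻¹ ∧ (D.AffineRel T p c a b ∨ D.LatticeRel X T p c a b)}

/-- The double affine braid group `𝔅`. -/
abbrev BGroup : Type _ := PresentedGroup D.bRels

/-- The defining relations of the universal double affine braid group: there are none that
involve both `X` and `Y`. -/
def uRels : Set (FreeGroup D.UGen) :=
  let X := fun b => FreeGroup.of (UGen.X (D := D) b)
  let Y := fun b => FreeGroup.of (UGen.Y (D := D) b)
  let T := fun i => FreeGroup.of (UGen.T (D := D) i)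
  let p := fun r => FreeGroup.of (UGen.pi (D := D) r)
  let c := FreeGroup.of (UGen.q (D := D))
  {x | ∃ a b, x = a * b⁻¹ ∧ (D.AffineRel T p c a b ∨ D.LatticeRel X T p c a b ∨
    D.LatticeRel Y (fun i => (T i)⁻¹) p c⁻¹ a b)}

/-- The universal double affine braid group. -/
abbrev UGroup : Type _ := PresentedGroup D.uRels

/-- `X_b ∈ 𝔅`. -/
def bX (b : D.weights) : D.BGroup := PresentedGroup.of (BGen.X b)
/-- `T_i ∈ 𝔅`. -/
def bT (i : D.Node) : D.BGroup := PresentedGroup.of (BGen.T i)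
/-- `π_r ∈ 𝔅`. -/
def bPi (r : D.orbitO) : D.BGroup := PresentedGroup.of (BGen.pi r)
/-- `q^{1/2m} ∈ 𝔅`. -/
def bq : D.BGroup := PresentedGroup.of BGen.q
/-- `Y_b ∈ 𝔅`. -/
def bY (b : D.weights) : D.BGroup := D.prodY D.bT D.bPi b

/-- `X_b` in the universal group. -/
def uX (b : D.weights) : D.UGroup := PresentedGroup.of (UGen.X b)
/-- `Y_b` in the universal group. -/
def uY (b : D.weights) : D.UGroup := PresentedGroup.of (UGen.Y b)
/-- `hat T_i` in the universal group. -/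
def uT (i : D.Node) : D.UGroup := PresentedGroup.of (UGen.T i)
/-- `hat π_r` in the universal group. -/
def uPi (r : D.orbitO) : D.UGroup := PresentedGroup.of (UGen.pi r)
/-- `q^{1/2m}` in the universal group. -/
def uq : D.UGroup := PresentedGroup.of UGen.q

section Formulas

variable {G : Type*} [Group G]

/-- The expression `q^{-1} X_ϑ T_{s_ϑ} Y_ϑ^{-1}`. -/
def hatT0 (X Y : D.weights → G) (T : D.Node → G) (c : G) : G :=
  D.qpow c (-1) * X D.thetaWeight * D.weylT T D.thetaReflection * (Y D.thetaWeight)⁻¹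

/-- The expression `q^{(ω_r, ω_r)/2} Y_r T_{u_r}^{-1} X_{r*}^{-1}`. -/
def hatPi (X Y : D.weights → G) (T : D.Node → G) (c : G) (r : D.orbitO) : G :=
  D.qpow c (D.form.form (D.omega r) (D.omega r) / 2) * Y (D.fundWeight r) *
    (D.weylT T (D.u r))⁻¹ * (X (D.fundWeight (D.star r)))⁻¹

end Formulas

/-- The normal subgroup of the universal group generated by the relations
`hat T_0 = q^{-1} X_ϑ hat T_{s_ϑ} Y_ϑ^{-1}` and
`hat π_r = q^{(ω_r, ω_r)/2} Y_r hat T_{u_r}^{-1} X_{r*}^{-1}`, `0 ≠ r ∈ O`. -/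
def extraRels : Subgroup D.UGroup :=
  Subgroup.normalClosure
    (insert (D.uT none * (D.hatT0 D.uX D.uY D.uT D.uq)⁻¹)
      {x | ∃ r : D.orbitO, (r : D.Node) ≠ none ∧
        x = D.uPi r * (D.hatPi D.uX D.uY D.uT D.uq r)⁻¹})

instance : D.extraRels.Normal := Subgroup.normalClosure_normal

/-- The formulas for the map `𝔭𝔯` on the generators. -/
structure IsPr (pr : D.UGroup →* D.BGroup) : Prop where
  map_X : ∀ b, pr (D.uX b) = D.bX b
  map_Y : ∀ b, pr (D.uY b) = D.bY b
  map_T : ∀ i : D.Simple, pr (D.uT (some i)) = D.bT (some i)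
  map_T0 : pr (D.uT none) = D.hatT0 D.bX D.bY D.bT D.bq
  map_pi : ∀ r : D.orbitO, (r : D.Node) ≠ none → pr (D.uPi r) = D.hatPi D.bX D.bY D.bT D.bq r
  map_q : pr D.uq = D.bq

/-- The formulas for the automorphism `τ_+` of `𝔅`. -/
structure IsTauPlus (τ : D.BGroup ≃* D.BGroup) : Prop where
  map_X : ∀ b, τ (D.bX b) = D.bX b
  map_Y : ∀ r : D.orbitO, (r : D.Node) ≠ none → τ (D.bY (D.fundWeight r)) =
    D.bX (D.fundWeight r) * D.bY (D.fundWeight r) *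
      D.qpow D.bq (-(D.form.form (D.omega r) (D.omega r) / 2))
  map_T : ∀ i : D.Simple, τ (D.bT (some i)) = D.bT (some i)
  map_Ytheta : τ (D.bY D.thetaWeight) = D.qpow D.bq (-1) * D.bX D.thetaWeight *
    (D.bT none)⁻¹ * D.weylT D.bT D.thetaReflection
  map_T0 : τ (D.bT none) = D.qpow D.bq (-1) * D.bX D.thetaWeight * (D.bT none)⁻¹
  map_q : τ D.bq = D.bq

/-- The formulas for the duality involution `ε` of `𝔅`. -/
structure IsEpsilon (ε : D.BGroup ≃* D.BGroup) : Prop where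
  map_X : ∀ b, ε (D.bX b) = D.bY b
  map_Y : ∀ b, ε (D.bY b) = D.bX b
  map_T : ∀ i : D.Simple, ε (D.bT (some i)) = (D.bT (some i))⁻¹
  map_q : ε D.bq = D.bq⁻¹
  involutive : Function.Involutive ε

/-- The formulas for the involution `hat ε` of the universal group. -/
structure IsEpsilonHat (ε : D.UGroup ≃* D.UGroup) : Prop where
  map_X : ∀ b, ε (D.uX b) = D.uY b
  map_Y : ∀ b, ε (D.uY b) = D.uX b
  map_T : ∀ i : D.Node, ε (D.uT i) = (D.uT i)⁻¹
  map_pi : ∀ r : D.orbitO, ε (D.uPi r) = D.uPi r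
  map_q : ε D.uq = D.uq⁻¹
  involutive : Function.Involutive ε

end Weights

end AffineData

end

/-! ### Matsumoto's theorem for groups generated by reflections -/

/-! The obstacle is that relations between the `Y_b` and the remaining generators of `𝔅` are not
given but have to be derived. Everything rests on a semi-infinite form of `T_w`. Write `ρ` for the
sum of the fundamental weights. By Matsumoto's theorem `T_y` is well defined on the extended affine
Weyl group, and `T_{nρ}⁻¹ T_{nρ x}` is constant for large `n`; this constant is `semiT x`. Passing
from `x` to `x s_i` multiplies it by `T_i⁻¹` or `T_i`, according as the finite part of `x(α_i)` is
positive or negative. Translations do not change finite parts, so `semiT` is multiplicative on them,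
and it gives `Y_b` at `b ∈ P`. At `w ∈ W` it gives `T_{w⁻¹}⁻¹`.

One identity, `affX_mul_semiT`, produces all relations needed: `X_z T_{v⁻¹} semiT(v x) = semiT(x)
X_{x⁻¹(z)}` for `v ∈ W`, `z ∈ P`, provided that for the finite parts `β` of the inversions of `x⁻¹`
the number `(z, β^∨)` is `1`, `-1` or `0` according as `v` makes `β` negative, makes it positive or
keeps its sign. The case `v = s_i`, `z = 0` gives the relations between `T_i` and `Y_b` for `i > 0`.
The case `v = s_ϑ`, `z = ϑ` gives those of `X_ϑ T_{s_ϑ}` with `Y_b`, because `(ϑ, β^∨) ∈ {0, ±1}`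
for `β ≠ ±ϑ`. The case `v = u_r`, `z = ω_r` works because `ω_r` is minuscule for `r ∈ O'`.

On the other side, `T_0 ↦ X_{α_0}⁻¹ T_0⁻¹`, `π_r ↦ q^{-(ω_r, ω_r)/2} X_r π_r`, with `X_b` and the
other `T_i` fixed, respects the relations of `𝔅` by direct verification. This is `τ_+`. It is
invertible since its composite with the involution inverting `X_b`, `T_i`, `q` is again an
involution. From `Y_ϑ = T_0 T_{s_ϑ}` and `Y_r = π_r T_{u_r}`, the images of `T_0` and `π_r` are
exactly the right-hand sides of `(*)`. The relations derived from `affX_mul_semiT` say that these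
images together with the `Y_b` satisfy the `Y`-half of the presentation of the universal group, so
`𝔭𝔯` exists.

The map `𝔅 → hat 𝔅` that is the identity on common generators becomes `τ_+` after `𝔭𝔯`. Hence `𝔭𝔯`
is onto, and composing the map with `τ_+⁻¹` gives a candidate inverse modulo `(*)`. Only its value
on `Y_b` is in question: `(*)` settles `Y_ϑ` and `Y_r`, and the relations with `T_i`, `i > 0`,
propagate this to all weights (`weights_le_of_stable`). Finally the presentation of the universal
group is symmetric under `hat ε`, and so is `(*)`, so `hat ε` descends to `𝔅`. -/

section Matsumoto

/-- A family of generators `s` of order two, acting on an abelian group with distinguished elements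
`a i` ("simple roots") and a notion of positive elements, such that `s i` changes the sign of no
positive element but `a i`. -/
structure SignSystem {κ G E : Type*} [Group G] [AddCommGroup E] [DistribMulAction G E]
    (s : κ → G) (a : κ → E) (pos : E → Prop) : Prop where
  sq : ∀ i, s i * s i = 1
  pos_simple : ∀ i, pos (a i)
  smul_simple : ∀ i, s i • a i = -a i
  pos_or : ∀ i e, pos e → e = a i ∨ pos (s i • e)
  not_both : ∀ e, pos e → ¬ pos (-e)
  conj : ∀ g i j, g ∈ Subgroup.closure (Set.range s) → g • a i = a j → g * s i = s j * g

/-- A word is reduced if no shorter word has the same product. -/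
def IsRedWord {κ G : Type*} [Group G] (s : κ → G) (w : List κ) : Prop :=
  ∀ w' : List κ, (w'.map s).prod = (w.map s).prod → w.length ≤ w'.length

theorem redWord_spec {κ G : Type*} [Group G] {s : κ → G} {g : G}
    (h : ∃ w : List κ, (w.map s).prod = g) :
    ((redWord s g).map s).prod = g ∧ IsRedWord s (redWord s g) := by
  classical
  have h' : ∃ w : List κ, (w.map s).prod = g ∧
      ∀ w' : List κ, (w'.map s).prod = g → w.length ≤ w'.length := by
    have hne : ∃ n, ∃ w : List κ, (w.map s).prod = g ∧ w.length = n :=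
      let ⟨w, hw⟩ := h; ⟨_, w, hw, rfl⟩
    obtain ⟨w, hw, hn⟩ := Nat.find_spec hne
    exact ⟨w, hw, fun w' hw' => hn ▸ Nat.find_min' hne ⟨w', hw', rfl⟩⟩
  have := Classical.epsilon_spec h'
  refine ⟨this.1, fun w' hw' => this.2 w' (hw'.trans this.1)⟩

namespace CoxeterSystem

/-- Turns a coincidence between two alternating words into a power of `s i * s j`, which can be
compared with the order that enters the braid relation. -/
theorem inv_prod_alternatingWord_mul {κ G : Type*} [Group G] {s : κ → G}
    (hs : ∀ i, s i * s i = 1) (i j : κ) (n : ℕ) :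
    ((alternatingWord j i n).map s).prod⁻¹ * ((alternatingWord i j n).map s).prod =
      (s i * s j) ^ n := by
  have hinv : ∀ i, (s i)⁻¹ = s i := fun i => inv_eq_of_mul_eq_one_left (hs i)
  induction n generalizing i j with
  | zero => simp [alternatingWord]
  | succ n ih =>
    have h := ih j i
    simp only [alternatingWord, List.concat_eq_append, List.map_append, List.prod_append,
      List.map_singleton, List.prod_singleton, mul_inv_rev, hinv]
    rw [show s i * ((alternatingWord i j n).map s).prod⁻¹ * (((alternatingWord j i n).map s).prod
      * s j) = s i * (((alternatingWord i j n).map s).prod⁻¹ * ((alternatingWord j i n).map s).prod)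
      * s j by group, h]
    clear h ih
    induction n with
    | zero => simp
    | succ n ih =>
      rw [pow_succ (s j * s i), pow_succ' (s i * s j), ← ih]
      rw [(Commute.refl (s j * s i)).pow_left n]
      simp only [mul_assoc]

end CoxeterSystem

namespace SignSystem

open CoxeterSystem

variable {κ G E : Type*} [Group G] [AddCommGroup E] [DistribMulAction G E] {s : κ → G} {a : κ → E}
  {pos : E → Prop} (S : SignSystem s a pos)
include S

theorem inv_eq (i : κ) : (s i)⁻¹ = s i := inv_eq_of_mul_eq_one_left (S.sq i)

omit S in
theorem prod_mem_closure (w : List κ) : (w.map s).prod ∈ Subgroup.closure (Set.range s) :=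
  Subgroup.list_prod_mem _ fun x hx => by
    obtain ⟨i, -, rfl⟩ := List.mem_map.1 hx
    exact Subgroup.subset_closure ⟨i, rfl⟩

theorem exists_word {g : G} (hg : g ∈ Subgroup.closure (Set.range s)) :
    ∃ w : List κ, (w.map s).prod = g := by
  induction hg using Subgroup.closure_induction'' with
  | one => exact ⟨[], rfl⟩
  | mem x hx => obtain ⟨i, rfl⟩ := hx; exact ⟨[i], by simp⟩
  | inv_mem x hx => obtain ⟨i, rfl⟩ := hx; exact ⟨[i], by simp [S.inv_eq]⟩
  | mul x y _ _ hx hy =>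
    obtain ⟨u, rfl⟩ := hx
    obtain ⟨v, rfl⟩ := hy
    exact ⟨u ++ v, by simp⟩

theorem exists_isRedWord {g : G} (hg : g ∈ Subgroup.closure (Set.range s)) :
    ∃ w : List κ, IsRedWord s w ∧ (w.map s).prod = g :=
  ⟨_, (redWord_spec (S.exists_word hg)).symm⟩

theorem neg_or (i : κ) (e : E) (h : pos (-e)) : e = -a i ∨ pos (-(s i • e)) := by
  rcases S.pos_or i _ h with h | h
  · exact Or.inl (by rw [← h, neg_neg])
  · exact Or.inr (by rwa [smul_neg] at h)

theorem sign_prod {e : E} (he : pos e ∨ pos (-e)) (w : List κ) :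
    pos ((w.map s).prod • e) ∨ pos (-((w.map s).prod • e)) := by
  induction w with
  | nil => simpa using he
  | cons i w ih =>
    rw [List.map_cons, List.prod_cons, mul_smul]
    rcases ih with h | h
    · rcases S.pos_or i _ h with h | h
      · rw [h, S.smul_simple, neg_neg]; exact Or.inr (S.pos_simple i)
      · exact Or.inl h
    · rcases S.neg_or i _ h with h | h
      · rw [h, smul_neg, S.smul_simple, neg_neg]; exact Or.inl (S.pos_simple i)
      · exact Or.inr h

/-- Read the word from the right. The root is positive at the start and negative at the end, so some
letter `j` reverses its sign. Only `a j` changes sign under `s j`, so the suffix `v` after that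
letter sends `a i` to `a j`; hence it conjugates `s i` to `s j`, which cancels the letter. -/
theorem exchange (w : List κ) (i : κ) (h : pos (-((w.map s).prod • a i))) :
    ∃ u j v, w = u ++ j :: v ∧ (w.map s).prod * s i = ((u ++ v).map s).prod := by
  induction w with
  | nil => exact absurd (by simpa using h) (S.not_both _ (S.pos_simple i))
  | cons k w ih =>
    rw [List.map_cons, List.prod_cons, mul_smul] at h
    rcases S.sign_prod (Or.inl (S.pos_simple i)) w with h' | h'
    · rcases S.pos_or k _ h' with h'' | h''
      · refine ⟨[], k, w, rfl, ?_⟩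
        rw [List.map_cons, List.prod_cons, mul_assoc, S.conj _ _ _ (prod_mem_closure w) h'',
          ← mul_assoc, S.sq, one_mul, List.nil_append]
      · exact absurd h (S.not_both _ h'')
    · obtain ⟨u, j, v, rfl, hp⟩ := ih h'
      exact ⟨k :: u, j, v, rfl, by rw [List.map_cons, List.prod_cons, mul_assoc, hp]; simp⟩

omit S in
theorem _root_.IsRedWord.of_append_right {u v : List κ} (h : IsRedWord s (u ++ v)) :
    IsRedWord s v := fun w' hw' => by
  have := h (u ++ w') (by simp [hw'])
  simpa using this

omit S in
theorem _root_.IsRedWord.of_append_left {u v : List κ} (h : IsRedWord s (u ++ v)) :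
    IsRedWord s u := fun w' hw' => by
  have := h (w' ++ v) (by simp [hw'])
  simpa using this

omit S in
theorem _root_.IsRedWord.congr {u v : List κ} (h : IsRedWord s u)
    (hp : (v.map s).prod = (u.map s).prod) (hl : v.length ≤ u.length) : IsRedWord s v :=
  fun w' hw' => hl.trans (h w' (hw'.trans hp))

/-- If `g a_i` is negative, `g` has a reduced word that ends in `i`. -/
theorem exists_isRedWord_concat {g : G} (hg : g ∈ Subgroup.closure (Set.range s)) {i : κ}
    (h : pos (-(g • a i))) : ∃ w : List κ, IsRedWord s (w ++ [i]) ∧ ((w ++ [i]).map s).prod = g := by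
  obtain ⟨w, hw, rfl⟩ := S.exists_isRedWord hg
  obtain ⟨u, j, v, rfl, hp⟩ := S.exchange w i h
  have hp' : (((u ++ v) ++ [i]).map s).prod = ((u ++ j :: v).map s).prod := by
    rw [List.map_append, List.prod_append, ← hp]
    simp [mul_assoc, S.sq]
  exact ⟨u ++ v, hw.congr hp' (by simp), hp'⟩

theorem prod_concat_smul (w : List κ) (i : κ) :
    ((w ++ [i]).map s).prod • a i = -((w.map s).prod • a i) := by
  simp [mul_smul, S.smul_simple]

theorem isRedWord_concat {w : List κ} (hw : IsRedWord s w) {i : κ}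
    (h : pos ((w.map s).prod • a i)) : IsRedWord s (w ++ [i]) := by
  obtain ⟨v, hv, hp⟩ := S.exists_isRedWord_concat (i := i) (prod_mem_closure (s := s) (w ++ [i]))
    (by rwa [S.prod_concat_smul, neg_neg])
  refine hv.congr hp.symm ?_
  have hvw : (v.map s).prod = (w.map s).prod := by simpa using hp
  have := hw v hvw
  simpa using this

theorem pos_of_isRedWord_concat {w : List κ} {i : κ} (hw : IsRedWord s (w ++ [i])) :
    pos ((w.map s).prod • a i) := by
  refine (S.sign_prod (Or.inl (S.pos_simple i)) w).resolve_right fun h => ?_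
  obtain ⟨v, hv, hp⟩ := S.exists_isRedWord_concat (prod_mem_closure w) h
  have h1 : (v.map s).prod = ((w ++ [i]).map s).prod := by
    rw [List.map_append, List.prod_append, ← hp]
    simp [mul_assoc, S.sq]
  have h2 := hw v h1
  have h3 := hv w hp.symm
  simp at h2 h3
  omega

/-- An element of the group that makes no simple root negative is trivial. -/
theorem eq_one_of_pos {g : G} (hg : g ∈ Subgroup.closure (Set.range s))
    (h : ∀ i, pos (g • a i)) : g = 1 := by
  obtain ⟨w, hw, rfl⟩ := S.exists_isRedWord hg
  rcases List.eq_nil_or_concat w with rfl | ⟨v, i, rfl⟩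
  · simp
  · rw [List.concat_eq_append] at *
    refine absurd (h i) ?_
    rw [S.prod_concat_smul]
    exact S.not_both _ (S.pos_of_isRedWord_concat hw)

/-- The two alternating words of length `m` have the same product. Substituting one for the other
behind the first letter doubles that letter, and the word shrinks to length `m - 1`. -/
theorem alternatingWord_not_isRedWord {i j : κ} {m : ℕ} (hm : m ≠ 0) (h : (s i * s j) ^ m = 1) :
    ¬ IsRedWord s (alternatingWord i j (m + 1)) := by
  intro hr
  have h1 : ((alternatingWord i j m).map s).prod = ((alternatingWord j i m).map s).prod := by
    rw [← inv_mul_eq_one, inv_prod_alternatingWord_mul S.sq, ← inv_eq_one, ← h, ← inv_pow,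
      mul_inv_rev, S.inv_eq, S.inv_eq]
  obtain ⟨n, rfl⟩ := Nat.exists_eq_succ_of_ne_zero hm
  have := hr (alternatingWord j i n) (by
    rw [alternatingWord_succ', List.map_cons, List.prod_cons, h1, Nat.succ_eq_add_one,
      alternatingWord_succ', List.map_cons, List.prod_cons, ← mul_assoc]
    by_cases hn : Even n <;> simp [hn, Nat.even_add_one, S.sq])
  simp at this

/-- **Matsumoto's theorem**: the product of elements `T i` of a monoid that satisfy the braid
relations, along a reduced word, depends only on the product of the word. -/
theorem matsumoto {H : Type*} [Monoid H] (T : κ → H)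
    (hT : ∀ i j, ((alternatingWord i j (orderOf (s i * s j))).map T).prod =
      ((alternatingWord j i (orderOf (s i * s j))).map T).prod)
    {w w' : List κ} (hw : IsRedWord s w) (hw' : IsRedWord s w')
    (h : (w.map s).prod = (w'.map s).prod) : (w.map T).prod = (w'.map T).prod := by
  generalize hn : w.length = n
  induction n generalizing w w' with
  | zero =>
    have h1 := hw' w h
    have h2 : w = [] := List.length_eq_zero_iff.1 hn
    subst h2
    have h3 := hw' [] h
    have : w' = [] := List.length_eq_zero_iff.1 (by simpa using h3)
    rw [this]
  | succ n ih =>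
    have hlen : ∀ {u v : List κ}, IsRedWord s u → IsRedWord s v →
        (u.map s).prod = (v.map s).prod → u.length = v.length :=
      fun hu hv huv => le_antisymm (hu _ huv.symm) (hv _ huv)
    have same_last : ∀ (u v : List κ) (i : κ), u.length = n → IsRedWord s (u ++ [i]) →
        IsRedWord s (v ++ [i]) → ((u ++ [i]).map s).prod = ((v ++ [i]).map s).prod →
        ((u ++ [i]).map T).prod = ((v ++ [i]).map T).prod := fun u v i hul hu hv huv => by
      have h1 : (u.map s).prod = (v.map s).prod := by simpa using huv
      simp [ih hu.of_append_left hv.of_append_left h1 hul]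
    have same_head : ∀ (u v : List κ) (i : κ), u.length = n → IsRedWord s (i :: u) →
        IsRedWord s (i :: v) → ((i :: u).map s).prod = ((i :: v).map s).prod →
        ((i :: u).map T).prod = ((i :: v).map T).prod := fun u v i hul hu hv huv => by
      have h1 : (u.map s).prod = (v.map s).prod := by simpa using huv
      have hu' : IsRedWord s ([i] ++ u) := hu
      have hv' : IsRedWord s ([i] ++ v) := hv
      simp [ih hu'.of_append_right hv'.of_append_right h1 hul]
    -- replacing the first letter of a word by a new last letter
    have rotate : ∀ (k : κ) (u v : List κ) (j : κ), u.length = n → IsRedWord s (k :: u) →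
        IsRedWord s (v ++ [j]) → ((k :: u).map s).prod = ((v ++ [j]).map s).prod →
        ((k :: u).map T).prod ≠ ((v ++ [j]).map T).prod →
        IsRedWord s (u ++ [j]) ∧ ((u ++ [j]).map s).prod = ((v ++ [j]).map s).prod ∧
          ((u ++ [j]).map T).prod = ((v ++ [j]).map T).prod := fun k u v j hul hu hv huv hne => by
      have hneg : pos (-(((k :: u).map s).prod • a j)) := by
        rw [huv, S.prod_concat_smul, neg_neg]
        exact S.pos_of_isRedWord_concat hv
      obtain ⟨u₁, l, u₂, hul', hp⟩ := S.exchange _ _ hneg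
      have hp' : (((u₁ ++ u₂) ++ [j]).map s).prod = ((v ++ [j]).map s).prod := by
        rw [List.map_append, List.prod_append, ← hp, huv]
        simp [mul_assoc, S.sq]
      have hl' : ((u₁ ++ u₂) ++ [j]).length ≤ (k :: u).length := by rw [hul']; simp
      have hl2 := hlen hu hv huv
      have hred : IsRedWord s ((u₁ ++ u₂) ++ [j]) := hv.congr hp' (hl2 ▸ hl')
      have hF := same_last (u₁ ++ u₂) v j (by
        have := congrArg List.length hul'
        simp at this ⊢; omega) hred hv hp'
      cases u₁ with
      | nil =>
        simp only [List.nil_append, List.cons.injEq] at hul'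
        obtain ⟨-, rfl⟩ := hul'
        exact ⟨hred, hp', hF⟩
      | cons k' u₁ =>
        simp only [List.cons_append, List.cons.injEq] at hul'
        obtain ⟨rfl, rfl⟩ := hul'
        -- If the deleted letter is not the first, the new word shares its first letter with `k ::
        -- u` and its last with `v ++ [j]`, so the induction hypothesis makes all the values under
        -- `T` equal.
        refine absurd ?_ hne
        rw [← hF]
        exact same_head _ _ _ hul hu hred (huv.trans hp'.symm)
    by_contra hne
    rcases List.eq_nil_or_concat w with rfl | ⟨w₁, i, rfl⟩
    · simp at hn
    rcases List.eq_nil_or_concat w' with rfl | ⟨w₂, j, rfl⟩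
    · have := hw [] (by rw [h])
      simp at this
    simp only [List.concat_eq_append] at *
    have hlw := hlen hw hw' h
    -- Rotating both words of a counterexample yields another one whose alternating tails are longer
    -- by one letter. After `n` rotations both words are alternating.
    have key : ∀ k, k ≤ n → ∃ u v : List κ,
        IsRedWord s (u ++ alternatingWord j i (k + 1)) ∧
        IsRedWord s (v ++ alternatingWord i j (k + 1)) ∧
        ((u ++ alternatingWord j i (k + 1)).map s).prod =
          ((v ++ alternatingWord i j (k + 1)).map s).prod ∧
        (u ++ alternatingWord j i (k + 1)).length = n + 1 ∧
        (v ++ alternatingWord i j (k + 1)).length = n + 1 ∧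
        ((u ++ alternatingWord j i (k + 1)).map T).prod ≠
          ((v ++ alternatingWord i j (k + 1)).map T).prod := by
      intro k
      induction k with
      | zero =>
        intro _
        exact ⟨w₁, w₂, hw, hw', h, hn, hlw ▸ hn, hne⟩
      | succ k ihk =>
        intro hk
        obtain ⟨u, v, hu, hv, huv, hul, hvl, hne⟩ := ihk (by omega)
        obtain ⟨c, u, rfl⟩ : ∃ c u', u = c :: u' := by
          cases u with
          | nil => simp at hul; omega
          | cons c u => exact ⟨c, u, rfl⟩
        obtain ⟨d, v, rfl⟩ : ∃ c u', v = c :: u' := by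
          cases v with
          | nil => simp at hvl; omega
          | cons c u => exact ⟨c, u, rfl⟩
        simp only [List.cons_append] at hu hv huv hul hvl hne
        have e1 : ∀ (c : κ) (u : List κ) (i j : κ), c :: (u ++ alternatingWord j i (k + 1)) =
            (c :: (u ++ alternatingWord i j k)) ++ [i] := fun c u i j => by simp [alternatingWord]
        have e2 : ∀ (u : List κ) (i j : κ), u ++ alternatingWord j i (k + 1 + 1) =
            (u ++ alternatingWord i j (k + 1)) ++ [i] := fun u i j => by
          rw [alternatingWord]; simp
        have r1 := rotate c (u ++ alternatingWord j i (k + 1)) (d :: (v ++ alternatingWord j i k)) j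
          (by simpa using hul) hu (by rwa [← e1]) (by rw [← e1]; exact huv)
          (by rw [← e1]; exact hne)
        have r2 := rotate d (v ++ alternatingWord i j (k + 1)) (c :: (u ++ alternatingWord i j k)) i
          (by simpa using hvl) hv (by rwa [← e1]) (by rw [← e1]; exact huv.symm)
          (by rw [← e1]; exact hne.symm)
        rw [← e1, ← e2] at r1 r2
        refine ⟨v, u, r2.1, r1.1, ?_, ?_, ?_, ?_⟩
        · rw [r2.2.1, r1.2.1]; exact huv
        · simp at hvl ⊢; omega
        · simp at hul ⊢; omega
        · rw [r2.2.2, r1.2.2]; exact hne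
    obtain ⟨u, v, hu, hv, huv, hul, hvl, hne'⟩ := key n le_rfl
    obtain rfl : u = [] := by simpa using hul
    obtain rfl : v = [] := by simpa using hvl
    simp only [List.nil_append] at hu hv huv hne'
    -- The order of `s i * s j` thus divides `n + 1` and is not the default value `0`. If it is
    -- smaller, the alternating word cannot be reduced; if it is equal, the braid relation refutes
    -- the counterexample.
    have hpow : (s i * s j) ^ (n + 1) = 1 := by
      rw [← inv_prod_alternatingWord_mul S.sq, huv, inv_mul_cancel]
    have hdvd := orderOf_dvd_of_pow_eq_one hpow
    have hle := Nat.le_of_dvd n.succ_pos hdvd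
    rcases hle.lt_or_eq with hlt | heq
    · have hm0 : orderOf (s i * s j) ≠ 0 := by
        rintro h0
        rw [h0, zero_dvd_iff] at hdvd
        omega
      refine S.alternatingWord_not_isRedWord hm0 (pow_orderOf_eq_one (s i * s j)) ?_
      have hsuf : ∀ p q : ℕ, ∀ i j : κ, ∃ u, alternatingWord i j (p + q) = u ++ alternatingWord i j p := by
        intro p q
        induction q with
        | zero => exact fun i j => ⟨[], rfl⟩
        | succ q ihq =>
          intro i j
          obtain ⟨u, hu⟩ := ihq i j
          exact ⟨_ :: u, by rw [← add_assoc, alternatingWord_succ', hu]; rfl⟩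
      obtain ⟨q, hq⟩ := Nat.exists_eq_add_of_le (Nat.succ_le_of_lt hlt)
      obtain ⟨u, hu'⟩ := hsuf (orderOf (s i * s j) + 1) q i j
      rw [show n + 1 = orderOf (s i * s j) + 1 + q from hq, hu'] at hv
      exact hv.of_append_right
    · apply hne'
      have := hT i j
      rw [heq] at this
      exact this.symm

end SignSystem

end Matsumoto

/-! ### The finite root system: invariant form, positive roots and the short root `ϑ`. -/

set_option linter.unusedSectionVars false

noncomputable section

namespace AffineData

variable {ι V N : Type*} [AddCommGroup V] [Module ℝ V] [AddCommGroup N] [Module ℝ N]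
  {R : RootPairing ι ℝ V N} (D : AffineData R)

/-! ### Half the square length of a root -/

/-- Half the square length of the root `β`. -/
def halfNorm (β : ι) : ℝ := D.form.form (R.root β) (R.root β) / 2

theorem one_le_halfNorm (β : ι) : 1 ≤ D.halfNorm β := by
  have := D.two_le_form β
  unfold halfNorm
  linarith

theorem halfNorm_pos (β : ι) : 0 < D.halfNorm β := one_pos.trans_le (D.one_le_halfNorm β)

theorem form_comm (x y : V) : D.form.form x y = D.form.form y x := by
  simpa using D.form.symm.eq x y

/-- Invariance of the form under the reflection in `β`, applied to `z` and `β`. It trades pairings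
with coroots for the form, which isometries preserve. -/
theorem form_root (z : V) (β : ι) :
    D.form.form z (R.root β) = D.halfNorm β * R.coroot' β z := by
  have h := D.form.isOrthogonal_reflection β z (R.root β)
  rw [RootPairing.reflection_apply_self, RootPairing.reflection_apply] at h
  simp only [map_sub, map_neg, map_smul, LinearMap.sub_apply, LinearMap.smul_apply,
    smul_eq_mul] at h
  unfold halfNorm
  linarith

theorem pairing_mul_halfNorm (β γ : ι) :
    R.pairing β γ * D.halfNorm γ = R.pairing γ β * D.halfNorm β := by
  have := D.form.pairing_mul_eq_pairing_mul_swap γ β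
  unfold halfNorm
  linarith

theorem halfNorm_reflectionPerm (β γ : ι) : D.halfNorm (R.reflectionPerm β γ) = D.halfNorm γ := by
  unfold halfNorm
  rw [RootPairing.root_reflectionPerm, D.form.apply_reflection_reflection]

theorem halfNorm_eq_of_form_eq {β γ : ι} {g : V → V}
    (hg : ∀ x y, D.form.form (g x) (g y) = D.form.form x y) (h : g (R.root β) = R.root γ) :
    D.halfNorm γ = D.halfNorm β := by
  unfold halfNorm
  rw [← h, hg]

/-! ### Positive roots -/

theorem isPos_iff_mem_closure (β : ι) : D.base.IsPos β ↔
    R.root β ∈ AddSubmonoid.closure (R.root '' (D.base.support : Set ι)) := by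
  have key : ∀ γ, R.root γ ∈ AddSubmonoid.closure (R.root '' (D.base.support : Set ι)) →
      D.base.IsPos γ := by
    intro γ h
    classical
    rw [← Submodule.span_nat_eq_addSubmonoidClosure, Submodule.mem_toAddSubmonoid,
      Fintype.mem_span_image_iff_exists_fun] at h
    obtain ⟨c, hc⟩ := h
    have : R.root γ = ∑ j ∈ D.base.support,
        (fun j => if h : j ∈ D.base.support then (c ⟨j, h⟩ : ℤ) else 0) j • R.root j := by
      rw [← hc, ← Finset.sum_coe_sort D.base.support]
      exact Finset.sum_congr rfl fun j _ => by simp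
    rw [RootPairing.Base.isPos_iff', RootPairing.Base.height_eq_sum this]
    refine Finset.sum_nonneg fun j hj => ?_
    simp [hj]
  refine ⟨fun h => (D.base.root_mem_or_neg_mem β).resolve_right fun h' => ?_, key β⟩
  let := R.indexNeg
  have h1 : D.base.IsPos (-β) := key _ (by simpa using h')
  exact ((RootPairing.Base.IsPos.neg_iff_not D.base β).1 h1) h

theorem isPos_reflectionPerm_self (β : ι) :
    D.base.IsPos (R.reflectionPerm β β) ↔ ¬ D.base.IsPos β :=
  RootPairing.Base.IsPos.neg_iff_not D.base β

theorem nonneg_of_isPos (l : V →ₗ[ℝ] ℝ) (hl : ∀ i ∈ D.base.support, 0 ≤ l (R.root i)) {β : ι}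
    (hβ : D.base.IsPos β) : 0 ≤ l (R.root β) := by
  rw [D.isPos_iff_mem_closure] at hβ
  generalize R.root β = x at hβ
  induction hβ using AddSubmonoid.closure_induction with
  | mem x hx => obtain ⟨i, hi, rfl⟩ := hx; exact hl i hi
  | zero => simp
  | add x y _ _ hx hy => rw [map_add]; exact add_nonneg hx hy

section RootSystem

variable [R.IsRootSystem]

theorem coroot'_omega [DecidableEq D.Simple] (i j : D.Simple) :
    R.coroot' j (D.omega (some i)) = if i = j then 1 else 0 :=
  D.coroot_omega i j

/-- Positivity refers to roots and not to coroots, hence the detour through the form: `(ω_i, ·)` is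
non-negative on simple roots, so on `β`, and differs from the coroot pairing by the factor `halfNorm
β > 0`. -/
theorem coroot'_omega_nonneg (i : D.Node) {β : ι} (hβ : D.base.IsPos β) :
    0 ≤ R.coroot' β (D.omega i) := by
  classical
  cases i with
  | none => simp [omega]
  | some i =>
    have h := D.nonneg_of_isPos (D.form.form (D.omega (some i))) (fun j hj => by
      rw [D.form_root, D.coroot'_omega i ⟨j, hj⟩]
      have := D.halfNorm_pos j
      split_ifs <;> simp [this.le]) hβ
    rw [D.form_root] at h
    exact nonneg_of_mul_nonneg_right h (D.halfNorm_pos β)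

/-- Evaluation on coroots of an element that is non-negative on the simple coroots, for the
difference of the highest coroot and another one. -/
theorem coroot'_le_coroot'_theta {z : V} (hz : ∀ i : D.Simple, 0 ≤ R.coroot' i z) (β : ι) :
    R.coroot' β z ≤ R.coroot' D.theta z := by
  have key : ∀ x ∈ AddSubmonoid.closure (R.coroot '' (D.base.support : Set ι)),
      0 ≤ R.toLinearMap z x := by
    intro x hx
    induction hx using AddSubmonoid.closure_induction with
    | mem x hx => obtain ⟨i, hi, rfl⟩ := hx; exact hz ⟨i, hi⟩
    | zero => simp
    | add x y _ _ hx hy => rw [map_add]; exact add_nonneg hx hy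
  have := key _ (D.theta_highest β)
  rw [map_sub] at this
  exact sub_nonneg.1 this

theorem coroot'_omega_some_nonneg (i : D.Node) (j : D.Simple) : 0 ≤ R.coroot' j (D.omega i) :=
  D.coroot'_omega_nonneg i (RootPairing.Base.isPos_of_mem_support j.2)

/-- The coroot `s_i(ϑ^∨) = ϑ^∨ - (α_i, ϑ^∨) α_i^∨` cannot exceed the highest one; evaluate both at
`ω_i`. -/
theorem pairing_theta_nonneg_of_simple (i : D.Simple) : 0 ≤ R.pairing i D.theta := by
  classical
  have h := D.coroot'_le_coroot'_theta (z := D.omega (some i))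
    (D.coroot'_omega_some_nonneg (some i)) (R.reflectionPerm i D.theta)
  rw [RootPairing.coroot'_reflectionPerm] at h
  have h2 : R.coreflection i (R.coroot D.theta) =
      R.coroot D.theta - R.pairing i D.theta • R.coroot i := R.coreflection_apply_coroot i D.theta
  have h3 : R.coroot' (R.reflectionPerm i D.theta) (D.omega (some i)) =
      R.coroot' D.theta (D.omega (some i)) - R.pairing i D.theta * R.coroot' i (D.omega (some i)) := by
    have : R.coroot' (R.reflectionPerm i D.theta) (D.omega (some i)) =
      R.toLinearMap (D.omega (some i)) (R.coroot (R.reflectionPerm i D.theta)) := rfl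
    rw [this, RootPairing.coroot_reflectionPerm, h2, map_sub, map_smul]
    rfl
  rw [← RootPairing.coroot'_reflectionPerm, h3, D.coroot'_omega i i] at h
  simp at h
  linarith

theorem coroot'_theta_nonneg {β : ι} (hβ : D.base.IsPos β) : 0 ≤ R.pairing β D.theta :=
  D.nonneg_of_isPos (R.coroot' D.theta) (fun i hi => D.pairing_theta_nonneg_of_simple ⟨i, hi⟩) hβ

theorem pairing_theta_left_nonneg {β : ι} (hβ : D.base.IsPos β) : 0 ≤ R.pairing D.theta β := by
  have h := D.pairing_mul_halfNorm D.theta β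
  have h1 := D.coroot'_theta_nonneg hβ
  have h2 := D.halfNorm_pos β
  have h3 := D.halfNorm_pos D.theta
  exact nonneg_of_mul_nonneg_left (h ▸ mul_nonneg h1 h3.le) h2

variable [Finite ι] [R.IsCrystallographic]

/-- Among the roots of minimal length take `β` of maximal height. It is dominant, since otherwise a
simple reflection would raise it without changing its length. Maximality of `ϑ^∨`, tested on the
dominant vectors `β` and `ϑ`, gives `2 ≤ (β, ϑ^∨)` and `(ϑ, β^∨) ≤ 2`. These two numbers have ratio
`halfNorm ϑ`, which is therefore at most `1`. -/
theorem halfNorm_theta : D.halfNorm D.theta = 1 := by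
  obtain ⟨i₀, hi₀⟩ := D.form_eq_two
  have hfin : {β : ι | D.halfNorm β = 1}.Finite := Set.toFinite _
  obtain ⟨β, hβ, hmax⟩ := hfin.exists_maximalFor (fun β => D.base.height β) _
    ⟨i₀, by simp [halfNorm, hi₀]⟩
  have hβ' : D.halfNorm β = 1 := hβ
  have hdom : ∀ i : D.Simple, 0 ≤ R.coroot' i (R.root β) := by
    intro i
    by_contra! hneg
    have h1 : R.root (R.reflectionPerm i β) = R.root β + (-R.pairingIn ℤ β i) • R.root i := by
      rw [RootPairing.root_reflectionPerm, RootPairing.reflection_apply_root' ℤ]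
      simp [sub_eq_add_neg]
    have h2 := D.base.height_add_zsmul h1
    rw [RootPairing.Base.height_one_of_mem_support i.2] at h2
    have h3 := hmax (show D.halfNorm (R.reflectionPerm i β) = 1 by
      rw [D.halfNorm_reflectionPerm, hβ'])
    have h4 : R.pairingIn ℤ β i < 0 := by
      have : ((R.pairingIn ℤ β i : ℤ) : ℝ) = R.coroot' i (R.root β) :=
        R.algebraMap_pairingIn ℤ β i
      exact_mod_cast this ▸ hneg
    have h5 : D.base.height β ≤ D.base.height (R.reflectionPerm i β) := by
      rw [h2]; simp; omega
    have : D.base.height (R.reflectionPerm i β) ≤ D.base.height β := h3 h5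
    rw [h2] at this
    simp at this
    omega
  have h1 := D.coroot'_le_coroot'_theta hdom β
  have h2 := D.coroot'_le_coroot'_theta (z := R.root D.theta)
    (fun i => D.pairing_theta_left_nonneg (RootPairing.Base.isPos_of_mem_support i.2)) β
  simp only [RootPairing.root_coroot'_eq_pairing, RootPairing.pairing_same] at h1 h2
  have h3 := D.pairing_mul_halfNorm D.theta β
  rw [hβ', mul_one] at h3
  have h4 := D.one_le_halfNorm D.theta
  nlinarith

theorem pairing_theta_eq (β : ι) :
    R.pairing β D.theta = D.halfNorm β * R.pairing D.theta β := by
  have h := D.pairing_mul_halfNorm D.theta β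
  rw [D.halfNorm_theta] at h
  linarith

theorem form_theta (z : V) : D.form.form z (R.root D.theta) = R.coroot' D.theta z := by
  rw [D.form_root, D.halfNorm_theta, one_mul]

theorem isPos_theta : D.base.IsPos D.theta := by
  by_contra h
  rw [← D.isPos_reflectionPerm_self] at h
  have := D.pairing_theta_left_nonneg h
  simp at this
  linarith

variable [R.IsReduced]

/-- As `ϑ` is short, `(β, ϑ^∨) = halfNorm β * (ϑ, β^∨)` with a factor at least `1`. In the list of
pairs of Cartan integers of two non-proportional roots, this excludes `|(ϑ, β^∨)| > 1`. -/
theorem pairing_theta_cases (β : ι) : R.pairing D.theta β = 0 ∨ R.pairing D.theta β = 1 ∨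
    R.pairing D.theta β = -1 ∨ β = D.theta ∨ R.root β = -R.root D.theta := by
  by_cases h1 : R.root D.theta = R.root β
  · exact Or.inr (Or.inr (Or.inr (Or.inl (R.root.injective h1).symm)))
  by_cases h2 : R.root D.theta = -R.root β
  · exact Or.inr (Or.inr (Or.inr (Or.inr (by rw [h2, neg_neg]))))
  have h := R.pairingIn_pairingIn_mem_set_of_isCrystal_of_isRed' (i := D.theta) (j := β)
    (fun h => h1 h) h2
  have e1 : R.pairing D.theta β = R.pairingIn ℤ D.theta β := (R.algebraMap_pairingIn ℤ _ _).symm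
  have e2 : R.pairing β D.theta = R.pairingIn ℤ β D.theta := (R.algebraMap_pairingIn ℤ _ _).symm
  have h3 := D.pairing_theta_eq β
  have h4 := D.one_le_halfNorm β
  rw [e1, e2] at h3
  rw [e1]
  simp only [Set.mem_insert_iff, Set.mem_singleton_iff, Prod.mk.injEq] at h
  rcases h with h | h | h | h | h | h | h | h | h | h | h <;> rw [h.1, h.2] at h3 <;> rw [h.1] <;>
    norm_num at h3 ⊢ <;> linarith

end RootSystem

end AffineData

end

/-! ### Affine roots and the extended affine Weyl group. -/

set_option linter.unusedSectionVars false

noncomputable section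

namespace AffineData

variable {ι V N : Type*} [AddCommGroup V] [Module ℝ V] [AddCommGroup N] [Module ℝ N]
  {R : RootPairing ι ℝ V N} (D : AffineData R)

theorem _root_.SignSystem.comp {κ κ' G E : Type*} [Group G] [AddCommGroup E]
    [DistribMulAction G E] {s : κ → G} {a : κ → E} {pos : E → Prop} (S : SignSystem s a pos)
    (f : κ' → κ) : SignSystem (fun i => s (f i)) (fun i => a (f i)) pos where
  sq i := S.sq _
  pos_simple i := S.pos_simple _
  smul_simple i := S.smul_simple _
  pos_or i := S.pos_or _
  not_both := S.not_both
  conj g i j hg := S.conj g _ _ (Subgroup.closure_mono (by rintro _ ⟨k, rfl⟩; exact ⟨f k, rfl⟩) hg)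

/-- Reducedness is detected by signs of roots, and these do not depend on whether further generators
are present. -/
theorem _root_.SignSystem.isRedWord_map {κ κ' G E : Type*} [Group G] [AddCommGroup E]
    [DistribMulAction G E] {s : κ → G} {a : κ → E} {pos : E → Prop} (S : SignSystem s a pos)
    (f : κ' → κ) {w : List κ'} (hw : IsRedWord (fun i => s (f i)) w) :
    IsRedWord s (w.map f) := by
  induction w using List.reverseRecOn with
  | nil => intro w' _; simp
  | append_singleton w i ih =>
    have h := (S.comp f).pos_of_isRedWord_concat hw
    rw [List.map_append, List.map_singleton]
    refine S.isRedWord_concat (ih hw.of_append_left) ?_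
    simpa [Function.comp_def] using h

variable [R.IsRootSystem] [Finite ι] [R.IsCrystallographic] [R.IsReduced]

/-! ### Weights -/

theorem exists_int_coroot' {b : V} (hb : b ∈ D.weights) (β : ι) : ∃ n : ℤ, R.coroot' β b = n := by
  classical
  have h1 : ∀ x ∈ Submodule.span ℤ (R.coroot '' (D.base.support : Set ι)), ∀ i : D.Node,
      ∃ n : ℤ, R.toLinearMap (D.omega i) x = n := by
    intro x hx i
    induction hx using Submodule.span_induction with
    | mem x hx =>
      obtain ⟨j, hj, rfl⟩ := hx
      cases i with
      | none => exact ⟨0, by simp [omega]⟩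
      | some i => exact ⟨if i = ⟨j, hj⟩ then 1 else 0, by
          rw [D.coroot_omega i ⟨j, hj⟩]; split_ifs <;> simp⟩
    | zero => exact ⟨0, by simp⟩
    | add x y _ _ hx hy =>
      obtain ⟨n, hn⟩ := hx
      obtain ⟨m, hm⟩ := hy
      exact ⟨n + m, by rw [map_add, hn, hm]; push_cast; rfl⟩
    | smul a x _ hx =>
      obtain ⟨n, hn⟩ := hx
      exact ⟨a * n, by rw [map_zsmul, hn]; simp⟩
  unfold weights at hb
  induction hb using AddSubgroup.closure_induction with
  | mem x hx => obtain ⟨i, rfl⟩ := hx; exact h1 _ (D.base.coroot_mem_span_int β) i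
  | zero => exact ⟨0, by simp⟩
  | add x y _ _ hx hy =>
    obtain ⟨n, hn⟩ := hx
    obtain ⟨m, hm⟩ := hy
    exact ⟨n + m, by rw [map_add, hn, hm]; push_cast; rfl⟩
  | neg x _ hx =>
    obtain ⟨n, hn⟩ := hx
    exact ⟨-n, by rw [map_neg, hn]; simp⟩

theorem eq_sum_omega (b : V) : b = ∑ i : D.Simple, R.coroot' i b • D.omega (some i) := by
  classical
  apply R.toPerfPair.injective
  apply D.base.toCoweightBasis.ext
  intro j
  have h1 : ∀ v n, R.toPerfPair v n = R.toLinearMap v n := fun _ _ => rfl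
  rw [h1, h1, D.base.toCoweightBasis_apply, map_sum, LinearMap.sum_apply]
  simp_rw [map_smul, LinearMap.smul_apply]
  rw [Finset.sum_congr rfl fun i _ => by rw [D.coroot_omega i j]]
  simp only [smul_eq_mul, mul_ite, mul_one, mul_zero, Finset.sum_ite_eq', Finset.mem_univ, if_true]
  rfl

theorem ext_coroot' {b c : V} (h : ∀ i : D.Simple, R.coroot' i b = R.coroot' i c) : b = c := by
  rw [D.eq_sum_omega b, D.eq_sum_omega c]
  simp_rw [h]

theorem reflection_mem_weights (β : ι) {b : V} (hb : b ∈ D.weights) :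
    R.reflection β b ∈ D.weights := by
  obtain ⟨n, hn⟩ := D.exists_int_coroot' hb β
  rw [RootPairing.reflection_apply, hn, Int.cast_smul_eq_zsmul]
  exact sub_mem hb (zsmul_mem (D.root_mem_weights β) n)

/-! ### Affine roots -/

/-- The affine roots `[β, ν_β k]`. -/
def IsAffineRoot (e : V × ℝ) : Prop := ∃ (β : ι) (k : ℤ), e = (R.root β, D.halfNorm β * k)

/-- The positive affine roots. -/
def AffPos (e : V × ℝ) : Prop :=
  ∃ (β : ι) (k : ℤ), e = (R.root β, D.halfNorm β * k) ∧ (0 < k ∨ k = 0 ∧ D.base.IsPos β)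

variable {D} in
theorem AffPos.isAffineRoot {e : V × ℝ} (h : D.AffPos e) : D.IsAffineRoot e :=
  let ⟨β, k, h, _⟩ := h; ⟨β, k, h⟩

theorem affPos_mk {β : ι} {k : ℤ} :
    D.AffPos (R.root β, D.halfNorm β * k) ↔ 0 < k ∨ k = 0 ∧ D.base.IsPos β := by
  refine ⟨?_, fun h => ⟨β, k, rfl, h⟩⟩
  rintro ⟨γ, l, he, h⟩
  rw [Prod.mk.injEq] at he
  obtain rfl := R.root.injective he.1
  have : k = l := by exact_mod_cast mul_left_cancel₀ (D.halfNorm_pos β).ne' he.2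
  rwa [this]

theorem neg_affineRoot (β : ι) (k : ℤ) : -(R.root β, D.halfNorm β * k) =
    (R.root (R.reflectionPerm β β), D.halfNorm (R.reflectionPerm β β) * ((-k : ℤ) : ℝ)) := by
  rw [D.halfNorm_reflectionPerm]
  simp

theorem affPos_neg_mk {β : ι} {k : ℤ} :
    D.AffPos (-(R.root β, D.halfNorm β * k)) ↔ k < 0 ∨ k = 0 ∧ ¬ D.base.IsPos β := by
  rw [neg_affineRoot, affPos_mk, isPos_reflectionPerm_self]
  simp

variable {D} in
theorem IsAffineRoot.pos_or_neg {e : V × ℝ} (h : D.IsAffineRoot e) :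
    D.AffPos e ∨ D.AffPos (-e) := by
  obtain ⟨β, k, rfl⟩ := h
  rw [affPos_mk, affPos_neg_mk]
  rcases lt_trichotomy k 0 with h | h | h <;> by_cases hp : D.base.IsPos β <;> simp [h, hp]

theorem not_affPos_neg {e : V × ℝ} (h : D.AffPos e) : ¬ D.AffPos (-e) := by
  obtain ⟨β, k, rfl, h⟩ := h
  rw [affPos_neg_mk]
  rcases h with h | ⟨h, h'⟩
  · omega
  · rintro (h2 | h2)
    · omega
    · exact h2.2 h'

variable {D} in
theorem IsAffineRoot.not_affPos_iff {e : V × ℝ} (h : D.IsAffineRoot e) :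
    ¬ D.AffPos e ↔ D.AffPos (-e) :=
  ⟨h.pos_or_neg.resolve_left, fun h1 h2 => D.not_affPos_neg h2 h1⟩

variable {D} in
theorem IsAffineRoot.neg {e : V × ℝ} (h : D.IsAffineRoot e) : D.IsAffineRoot (-e) := by
  obtain ⟨β, k, rfl⟩ := h
  exact ⟨_, _, D.neg_affineRoot β k⟩

theorem affPos_simpleRoot (i : D.Node) : D.AffPos (D.simpleRoot i) := by
  cases i with
  | none =>
    refine ⟨R.reflectionPerm D.theta D.theta, 1, ?_, Or.inl one_pos⟩
    rw [D.halfNorm_reflectionPerm, D.halfNorm_theta]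
    simp [simpleRoot]
  | some i =>
    exact ⟨i, 0, by simp [simpleRoot], Or.inr ⟨rfl, RootPairing.Base.isPos_of_mem_support i.2⟩⟩

theorem simpleReflection_apply (i : D.Node) (z : V × ℝ) :
    D.simpleReflection i z = z - D.corootForm i z.1 • D.simpleRoot i := rfl

theorem simpleReflection_mul_self (i : D.Node) :
    D.simpleReflection i * D.simpleReflection i = 1 := by
  apply LinearEquiv.ext
  intro z
  exact Module.involutive_reflection _ z

theorem simpleReflection_simpleRoot (i : D.Node) :
    D.simpleReflection i (D.simpleRoot i) = -D.simpleRoot i :=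
  Module.reflection_apply_self _

theorem form_simpleRoot (z : V) (i : D.Node) :
    2 * D.form.form z (D.simpleRoot i).1 =
      D.form.form (D.simpleRoot i).1 (D.simpleRoot i).1 * D.corootForm i z := by
  cases i with
  | none =>
    have h := D.form_theta (R.root D.theta)
    have h' := D.form_theta z
    simp only [simpleRoot, corootForm, map_neg, LinearMap.neg_apply, neg_neg, h, h']
    simp
  | some i =>
    simp only [simpleRoot, corootForm]
    rw [D.form_root z, D.form_root]
    simp
    ring

theorem two_le_form_simpleRoot (i : D.Node) :
    2 ≤ D.form.form (D.simpleRoot i).1 (D.simpleRoot i).1 := by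
  cases i with
  | none => simpa [simpleRoot] using D.two_le_form D.theta
  | some i => exact D.two_le_form i

/-- The integer `n` records the change of level. It vanishes for `i > 0`; for `i = 0` the level
changes by `(β, ϑ^∨) = halfNorm β * (ϑ, β^∨)`, so `n = (ϑ, β^∨)`. -/
theorem simpleReflection_affineRoot (i : D.Node) (e : V × ℝ) (he : D.IsAffineRoot e) :
    ∃ (β γ : ι) (k n : ℤ), e = (R.root β, D.halfNorm β * k) ∧
      D.simpleReflection i e = (R.root γ, D.halfNorm γ * ((k + n : ℤ) : ℝ)) ∧
      (∀ j : D.Simple, i = some j → n = 0 ∧ γ = R.reflectionPerm j β) ∧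
      (i = none → R.pairing D.theta β = n ∧ γ = R.reflectionPerm D.theta β) := by
  obtain ⟨β, k, rfl⟩ := he
  cases i with
  | none =>
    refine ⟨β, R.reflectionPerm D.theta β, k, R.pairingIn ℤ D.theta β, rfl, ?_, by simp, ?_⟩
    · rw [D.halfNorm_reflectionPerm, simpleReflection_apply]
      have e1 : (R.pairingIn ℤ D.theta β : ℝ) = R.pairing D.theta β := R.algebraMap_pairingIn ℤ _ _
      push_cast
      rw [e1]
      ext
      · simp [corootForm, simpleRoot, RootPairing.reflection_apply, sub_eq_add_neg]
      · simp [corootForm, simpleRoot, D.pairing_theta_eq]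
        ring
    · intro _
      exact ⟨(R.algebraMap_pairingIn ℤ _ _).symm, rfl⟩
  | some i =>
    refine ⟨β, R.reflectionPerm i β, k, 0, rfl, ?_, ?_, by simp⟩
    · rw [D.halfNorm_reflectionPerm, simpleReflection_apply]
      ext
      · simp [corootForm, simpleRoot, RootPairing.reflection_apply]
      · simp [simpleRoot]
    · intro j hj
      cases hj
      exact ⟨rfl, rfl⟩

/-- For `i = 0` the level is shifted by `n = (ϑ, β^∨)`, which lies in `{0, ±1, ±2}` and, when
nonzero, has the sign of `β`. If `n < 0`, then `β` is negative, so `k ≥ 1`, and the reflected finite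
part is positive, so level zero is harmless. The level becomes negative only for `n = -2`, `k = 1`,
where the root is `α₀`. -/
theorem affPos_simpleReflection (i : D.Node) (e : V × ℝ) (he : D.AffPos e) :
    e = D.simpleRoot i ∨ D.AffPos (D.simpleReflection i e) := by
  obtain ⟨β, γ, k, n, rfl, h2, h3, h4⟩ := D.simpleReflection_affineRoot i e he.isAffineRoot
  rw [h2, affPos_mk]
  rw [affPos_mk] at he
  cases i with
  | some i =>
    obtain ⟨rfl, rfl⟩ := h3 i rfl
    rcases he with h | ⟨rfl, h⟩
    · right; left; omega
    · by_cases hi : β = i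
      · left; simp [hi, simpleRoot]
      · right; right
        exact ⟨by simp, h.reflectionPerm i.2 hi⟩
  | none =>
    obtain ⟨h5, rfl⟩ := h4 rfl
    have hposneg : 0 ≤ n ∨ n < 0 ∧ ¬ D.base.IsPos β := by
      by_cases hβ : D.base.IsPos β
      · have := D.pairing_theta_left_nonneg hβ
        rw [h5] at this
        left; exact_mod_cast this
      · rcases lt_or_ge n 0 with h | h
        · exact Or.inr ⟨h, hβ⟩
        · exact Or.inl h
    have hrefl : n ≠ 0 → (0 < n ↔ D.base.IsPos β) := by
      intro hn
      constructor
      · intro h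
        by_contra hβ
        rw [← D.isPos_reflectionPerm_self] at hβ
        have := D.pairing_theta_left_nonneg hβ
        rw [RootPairing.pairing_reflectionPerm_self_right, h5] at this
        have : (0 : ℤ) ≤ -n := by exact_mod_cast this
        omega
      · intro h
        rcases hposneg with h' | h'
        · omega
        · exact absurd h h'.2
    have hs : R.pairing D.theta (R.reflectionPerm D.theta β) = -(n : ℝ) := by
      rw [← h5]
      have h1 := D.pairing_mul_halfNorm D.theta (R.reflectionPerm D.theta β)
      rw [D.halfNorm_reflectionPerm, D.halfNorm_theta, mul_one] at h1
      have h2 : R.pairing (R.reflectionPerm D.theta β) D.theta = -R.pairing β D.theta := by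
        rw [← RootPairing.root_coroot'_eq_pairing, RootPairing.root_reflectionPerm,
          RootPairing.reflection_apply]
        simp
        ring
      rw [h2, D.pairing_theta_eq] at h1
      exact mul_right_cancel₀ (D.halfNorm_pos β).ne' (by linarith)
    have hrefl2 : n ≠ 0 → (n < 0 ↔ D.base.IsPos (R.reflectionPerm D.theta β)) := by
      intro hn
      constructor
      · intro h
        by_contra hβ
        rw [← D.isPos_reflectionPerm_self] at hβ
        have := D.pairing_theta_left_nonneg hβ
        rw [RootPairing.pairing_reflectionPerm_self_right, hs, neg_neg] at this
        have : (0 : ℤ) ≤ n := by exact_mod_cast this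
        omega
      · intro h
        have := D.pairing_theta_left_nonneg h
        rw [hs] at this
        have : (0 : ℤ) ≤ -n := by exact_mod_cast this
        omega
    rcases D.pairing_theta_cases β with h | h | h | h | h
    · have hn : n = 0 := by rw [h] at h5; exact_mod_cast h5.symm
      right
      rw [hn, add_zero]
      refine he.imp id (And.imp id ?_)
      have : R.reflectionPerm D.theta β = β :=
        R.reflectionPerm_eq_of_pairing_eq_zero (by rw [D.pairing_theta_eq, h, mul_zero])
      rw [this]
      exact id
    · have hn : n = 1 := by rw [h] at h5; exact_mod_cast h5.symm
      right; left; omega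
    · have hn : n = -1 := by rw [h] at h5; exact_mod_cast h5.symm
      right
      have h6 := (hrefl2 (by omega)).1 (by omega)
      have h7 : ¬ D.base.IsPos β := fun h' => by
        have := (hrefl (by omega)).2 h'
        omega
      rcases he with he | he
      · by_cases hk : k = 1
        · right; exact ⟨by omega, h6⟩
        · left; omega
      · exact absurd he.2 h7
    · subst h
      have hn : n = 2 := by rw [RootPairing.pairing_same] at h5; exact_mod_cast h5.symm
      right; left; omega
    · obtain rfl : R.reflectionPerm D.theta D.theta = β := R.root.injective (by simp [h])
      have hn : n = -2 := by simp at h5; exact_mod_cast h5.symm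
      have h6 := (hrefl2 (by omega)).1 (by omega)
      have h7 : ¬ D.base.IsPos (R.reflectionPerm D.theta D.theta) := fun h' => by
        have := (hrefl (by omega)).2 h'
        omega
      rcases he with he | he
      -- Finite part `-ϑ` at level one is `α₀` itself; at level two the image is `[ϑ, 0]`.
      · by_cases hk : k = 1
        · left
          rw [D.halfNorm_reflectionPerm, D.halfNorm_theta, hk]
          simp [simpleRoot]
        · right
          by_cases hk : k = 2
          · right; exact ⟨by omega, h6⟩
          · left; omega
      · exact absurd he.2 h7

/-! ### The extended affine Weyl group -/

/-- A linear map of `V`, as a linear map of `V × ℝ`. -/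
def prodOne (g : V ≃ₗ[ℝ] V) : (V × ℝ) ≃ₗ[ℝ] (V × ℝ) := g.prodCongr (LinearEquiv.refl ℝ ℝ)

omit D [R.IsRootSystem] [Finite ι] [R.IsCrystallographic] [R.IsReduced] in
theorem prodOne_apply (g : V ≃ₗ[ℝ] V) (z : V × ℝ) : prodOne g z = (g z.1, z.2) := rfl

/-- Isometries that preserve roots and weights. -/
structure IsLatticeIsometry (g : V ≃ₗ[ℝ] V) : Prop where
  form : ∀ x y, D.form.form (g x) (g y) = D.form.form x y
  root : ∀ β, ∃ γ, g (R.root β) = R.root γ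
  weights : ∀ b ∈ D.weights, g b ∈ D.weights

theorem isLatticeIsometry_reflection (β : ι) : D.IsLatticeIsometry (R.reflection β) where
  form := D.form.apply_reflection_reflection β
  root γ := ⟨R.reflectionPerm β γ, by simp⟩
  weights _ := D.reflection_mem_weights β

variable {D} in
theorem IsLatticeIsometry.mul {g h : V ≃ₗ[ℝ] V} (hg : D.IsLatticeIsometry g)
    (hh : D.IsLatticeIsometry h) : D.IsLatticeIsometry (g * h) where
  form x y := by simp [hg.form, hh.form]
  root β := by
    obtain ⟨γ, hγ⟩ := hh.root β
    obtain ⟨δ, hδ⟩ := hg.root γ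
    exact ⟨δ, by simp [hγ, hδ]⟩
  weights b hb := hg.weights _ (hh.weights b hb)

theorem simpleReflection_some (i : D.Simple) :
    D.simpleReflection (some i) = prodOne (R.reflection i) := by
  apply LinearEquiv.ext
  intro z
  rw [simpleReflection_apply, prodOne_apply, RootPairing.reflection_apply]
  ext <;> simp [simpleRoot, corootForm]

theorem thetaReflection_eq : D.thetaReflection = prodOne (R.reflection D.theta) := by
  apply LinearEquiv.ext
  intro z
  rw [prodOne_apply, RootPairing.reflection_apply, thetaReflection, Module.reflection_apply]
  ext <;> simp

theorem prodOne_reflection_mem (β : ι) : prodOne (R.reflection β) ∈ D.weyl := by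
  have hsimple : ∀ i ∈ D.base.support, prodOne (R.reflection i) ∈ D.weyl := fun i hi =>
    D.simpleReflection_some ⟨i, hi⟩ ▸ Subgroup.subset_closure ⟨⟨i, hi⟩, rfl⟩
  have hmul : ∀ g h : V ≃ₗ[ℝ] V, prodOne (g * h) = prodOne g * prodOne h := fun g h => rfl
  have hconj : ∀ i j, prodOne (R.reflection i) ∈ D.weyl → prodOne (R.reflection j) ∈ D.weyl →
      prodOne (R.reflection (R.reflectionPerm j i)) ∈ D.weyl := fun i j hi hj => by
    rw [RootPairing.reflection_reflectionPerm]
    exact mul_mem (mul_mem hj hi) hj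
  exact D.base.induction_reflect β (fun i hi => hconj i i hi hi) hsimple
    fun i j hi hj => hconj i j hi (hsimple j hj)

theorem thetaReflection_mem : D.thetaReflection ∈ D.weyl :=
  D.thetaReflection_eq ▸ D.prodOne_reflection_mem D.theta

theorem exists_of_mem_weyl {w : (V × ℝ) ≃ₗ[ℝ] (V × ℝ)} (hw : w ∈ D.weyl) :
    ∃ g, D.IsLatticeIsometry g ∧ w = prodOne g := by
  unfold weyl at hw
  induction hw using Subgroup.closure_induction'' with
  | one => exact ⟨1, ⟨by simp, fun β => ⟨β, rfl⟩, fun _ => id⟩, rfl⟩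
  | mem x hx =>
    obtain ⟨i, rfl⟩ := hx
    exact ⟨_, D.isLatticeIsometry_reflection i, D.simpleReflection_some i⟩
  | inv_mem x hx =>
    obtain ⟨i, rfl⟩ := hx
    refine ⟨_, D.isLatticeIsometry_reflection i, ?_⟩
    dsimp only
    rw [← D.simpleReflection_some i]
    exact inv_eq_of_mul_eq_one_left (D.simpleReflection_mul_self _)
  | mul x y _ _ hx hy =>
    obtain ⟨g, hg, rfl⟩ := hx
    obtain ⟨h, hh, rfl⟩ := hy
    exact ⟨g * h, hg.mul hh, rfl⟩

theorem translation_apply (b : V) (z : V × ℝ) :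
    D.translation b z = (z.1, z.2 - D.form.form z.1 b) := rfl

theorem translation_add (b c : V) :
    D.translation (b + c) = D.translation b * D.translation c := by
  apply LinearEquiv.ext
  intro z
  simp only [translation_apply, LinearEquiv.mul_apply, map_add]
  ext <;> simp
  ring

theorem translation_zero : D.translation 0 = 1 := by
  apply LinearEquiv.ext
  intro z
  simp [translation_apply]

theorem translation_neg (b : V) : D.translation (-b) = (D.translation b)⁻¹ := by
  rw [eq_inv_iff_mul_eq_one, ← translation_add, neg_add_cancel, translation_zero]

theorem weyl_mul_translation {w : (V × ℝ) ≃ₗ[ℝ] (V × ℝ)} (hw : w ∈ D.weyl) (b : V) :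
    w * D.translation b = D.translation (w (b, 0)).1 * w := by
  obtain ⟨g, hg, rfl⟩ := D.exists_of_mem_weyl hw
  apply LinearEquiv.ext
  intro z
  simp [translation_apply, prodOne_apply, hg.form]

theorem weyl_apply_mem_weights {w : (V × ℝ) ≃ₗ[ℝ] (V × ℝ)} (hw : w ∈ D.weyl) {b : V}
    (hb : b ∈ D.weights) (x : ℝ) : (w (b, x)).1 ∈ D.weights := by
  obtain ⟨g, hg, rfl⟩ := D.exists_of_mem_weyl hw
  exact hg.weights b hb

/-- The extended affine Weyl group `W ⋉ P`. -/
def extWeyl : Subgroup ((V × ℝ) ≃ₗ[ℝ] (V × ℝ)) where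
  carrier := {y | ∃ b ∈ D.weights, ∃ w ∈ D.weyl, y = D.translation b * w}
  one_mem' := ⟨0, zero_mem _, 1, one_mem _, by rw [translation_zero, one_mul]⟩
  mul_mem' := by
    rintro _ _ ⟨b, hb, w, hw, rfl⟩ ⟨c, hc, v, hv, rfl⟩
    refine ⟨b + (w (c, 0)).1, add_mem hb (D.weyl_apply_mem_weights hw hc 0), w * v,
      mul_mem hw hv, ?_⟩
    rw [translation_add, mul_assoc, ← mul_assoc w, D.weyl_mul_translation hw]
    simp only [mul_assoc]
  inv_mem' := by
    rintro _ ⟨b, hb, w, hw, rfl⟩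
    refine ⟨-(w⁻¹ (b, 0)).1, neg_mem (D.weyl_apply_mem_weights (inv_mem hw) hb 0), w⁻¹,
      inv_mem hw, ?_⟩
    rw [mul_inv_rev, ← translation_neg, D.weyl_mul_translation (inv_mem hw)]
    congr 2
    obtain ⟨g, hg, h⟩ := D.exists_of_mem_weyl (inv_mem hw)
    rw [h]
    simp [prodOne_apply]

theorem translation_mem {b : V} (hb : b ∈ D.weights) : D.translation b ∈ D.extWeyl :=
  ⟨b, hb, 1, one_mem _, by rw [mul_one]⟩

theorem weyl_le_extWeyl : D.weyl ≤ D.extWeyl :=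
  fun w hw => ⟨0, zero_mem _, w, hw, by rw [translation_zero, one_mul]⟩

theorem thetaReflection_mul_self : D.thetaReflection * D.thetaReflection = 1 := by
  apply LinearEquiv.ext
  intro z
  exact Module.involutive_reflection _ z

theorem translation_theta :
    D.translation (R.root D.theta) = D.simpleReflection none * D.thetaReflection := by
  apply LinearEquiv.ext
  intro z
  rw [translation_apply, D.form_theta, LinearEquiv.mul_apply, thetaReflection_eq, prodOne_apply,
    RootPairing.reflection_apply, simpleReflection_apply]
  ext
  · simp [corootForm, simpleRoot]
    module
  · simp [corootForm, simpleRoot]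
    ring

theorem simpleReflection_none :
    D.simpleReflection none = D.translation (R.root D.theta) * D.thetaReflection := by
  rw [translation_theta, mul_assoc, thetaReflection_mul_self, mul_one]

theorem simpleReflection_mem_extWeyl (i : D.Node) : D.simpleReflection i ∈ D.extWeyl := by
  cases i with
  | none =>
    rw [simpleReflection_none]
    exact mul_mem (D.translation_mem (D.root_mem_weights _)) (D.weyl_le_extWeyl D.thetaReflection_mem)
  | some i => exact D.weyl_le_extWeyl (Subgroup.subset_closure ⟨i, rfl⟩)

theorem affineWeyl_le_extWeyl : D.affineWeyl ≤ D.extWeyl := by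
  unfold affineWeyl
  rw [Subgroup.closure_le]
  rintro _ ⟨i, rfl⟩
  exact D.simpleReflection_mem_extWeyl i

theorem exists_of_mem_extWeyl {y : (V × ℝ) ≃ₗ[ℝ] (V × ℝ)} (hy : y ∈ D.extWeyl) :
    ∃ g, D.IsLatticeIsometry g ∧ ∃ b ∈ D.weights, ∀ z, y z = (g z.1, z.2 - D.form.form (g z.1) b) := by
  obtain ⟨b, hb, w, hw, rfl⟩ := hy
  obtain ⟨g, hg, rfl⟩ := D.exists_of_mem_weyl hw
  exact ⟨g, hg, b, hb, fun z => rfl⟩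

theorem form_extWeyl {y : (V × ℝ) ≃ₗ[ℝ] (V × ℝ)} (hy : y ∈ D.extWeyl) (z z' : V × ℝ) :
    D.form.form (y z).1 (y z').1 = D.form.form z.1 z'.1 := by
  obtain ⟨g, hg, b, -, h⟩ := D.exists_of_mem_extWeyl hy
  rw [h, h, hg.form]

theorem extWeyl_mem_weights {y : (V × ℝ) ≃ₗ[ℝ] (V × ℝ)} (hy : y ∈ D.extWeyl) {z : V × ℝ}
    (hz : z.1 ∈ D.weights) : (y z).1 ∈ D.weights := by
  obtain ⟨g, hg, b, -, h⟩ := D.exists_of_mem_extWeyl hy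
  rw [h]
  exact hg.weights _ hz

/-- Translation by `b` lowers the level of `γ` by `(γ, b) = halfNorm γ * (b, γ^∨)`, an integral
multiple of `halfNorm γ`. -/
theorem extWeyl_isAffineRoot {y : (V × ℝ) ≃ₗ[ℝ] (V × ℝ)} (hy : y ∈ D.extWeyl) {e : V × ℝ}
    (he : D.IsAffineRoot e) : D.IsAffineRoot (y e) := by
  obtain ⟨g, hg, b, hb, h⟩ := D.exists_of_mem_extWeyl hy
  obtain ⟨β, k, rfl⟩ := he
  obtain ⟨γ, hγ⟩ := hg.root β
  obtain ⟨n, hn⟩ := D.exists_int_coroot' hb γ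
  refine ⟨γ, k - n, ?_⟩
  rw [h, hγ, D.form_comm, D.form_root, hn, D.halfNorm_eq_of_form_eq hg.form hγ]
  push_cast
  rw [mul_sub]

/-- For every node, including `0`, the functional is `2 (z, α_i) / (α_i, α_i)`, and the group acts
on the finite parts by isometries. -/
theorem corootForm_extWeyl {y : (V × ℝ) ≃ₗ[ℝ] (V × ℝ)} (hy : y ∈ D.extWeyl) {i j : D.Node}
    (h : y (D.simpleRoot i) = D.simpleRoot j) (z : V × ℝ) :
    D.corootForm j (y z).1 = D.corootForm i z.1 := by
  have h1 := D.form_simpleRoot (y z).1 j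
  have h2 := D.form_simpleRoot z.1 i
  rw [← h, D.form_extWeyl hy, D.form_extWeyl hy] at h1
  have h3 := D.two_le_form_simpleRoot i
  exact mul_left_cancel₀ (by positivity) (h1.symm.trans h2)

theorem mul_simpleReflection_of_eq {y : (V × ℝ) ≃ₗ[ℝ] (V × ℝ)} (hy : y ∈ D.extWeyl) {i j : D.Node}
    (h : y (D.simpleRoot i) = D.simpleRoot j) :
    y * D.simpleReflection i = D.simpleReflection j * y := by
  apply LinearEquiv.ext
  intro z
  rw [LinearEquiv.mul_apply, LinearEquiv.mul_apply, simpleReflection_apply, simpleReflection_apply,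
    D.corootForm_extWeyl hy h, map_sub, map_smul, h]

theorem signSystem : SignSystem D.simpleReflection D.simpleRoot D.AffPos where
  sq := D.simpleReflection_mul_self
  pos_simple := D.affPos_simpleRoot
  smul_simple := D.simpleReflection_simpleRoot
  pos_or := D.affPos_simpleReflection
  not_both _ := D.not_affPos_neg
  conj _ _ _ hg h := D.mul_simpleReflection_of_eq (D.affineWeyl_le_extWeyl hg) h

theorem isAffineRoot_simpleRoot (i : D.Node) : D.IsAffineRoot (D.simpleRoot i) :=
  (D.affPos_simpleRoot i).isAffineRoot

end AffineData

end

/-! ### Length, the group `Π` and the minuscule weights. -/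

set_option linter.unusedSectionVars false

noncomputable section

namespace AffineData

variable {ι V N : Type*} [AddCommGroup V] [Module ℝ V] [AddCommGroup N] [Module ℝ N]
  {R : RootPairing ι ℝ V N} (D : AffineData R)

variable [R.IsRootSystem] [Finite ι] [R.IsCrystallographic] [R.IsReduced]

/-! ### Coordinates with respect to the simple affine roots -/

/-- The coordinates of an element of `V × ℝ` with respect to the simple affine roots. -/
def affCoord : D.Node → (V × ℝ →ₗ[ℝ] ℝ)
  | none => LinearMap.snd ℝ V ℝ
  | some i => (D.base.toWeightBasis.coord i).comp (LinearMap.fst ℝ V ℝ) +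
      D.base.toWeightBasis.coord i (R.root D.theta) • LinearMap.snd ℝ V ℝ

theorem sum_affCoord (e : V × ℝ) : e = ∑ j, D.affCoord j e • D.simpleRoot j := by
  rw [Fintype.sum_option]
  have h1 := D.base.toWeightBasis.sum_repr e.1
  have h2 := D.base.toWeightBasis.sum_repr (R.root D.theta)
  simp only [RootPairing.Base.toWeightBasis_apply] at h1 h2
  ext
  · simp only [affCoord, simpleRoot, LinearMap.snd_apply, Prod.fst_add, Prod.smul_fst,
      Prod.fst_sum, LinearMap.add_apply, LinearMap.comp_apply, LinearMap.fst_apply,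
      LinearMap.smul_apply, Module.Basis.coord_apply, smul_eq_mul, add_smul, Finset.sum_add_distrib,
      h1, mul_comm _ e.2, mul_smul, ← Finset.smul_sum, h2]
    module
  · simp [affCoord, simpleRoot, Prod.snd_sum]

theorem affCoord_simpleRoot [DecidableEq D.Node] (i j : D.Node) :
    D.affCoord i (D.simpleRoot j) = if i = j then 1 else 0 := by
  classical
  cases i <;> cases j <;> simp [affCoord, simpleRoot, Finsupp.single_apply, eq_comm]

theorem halfNorm_mul_coord (i : D.Simple) (z : V) :
    D.halfNorm i * D.base.toWeightBasis.coord i z = D.form.form (D.omega (some i)) z := by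
  classical
  suffices h : D.halfNorm i • D.base.toWeightBasis.coord i = D.form.form (D.omega (some i)) from
    LinearMap.congr_fun h z
  apply D.base.toWeightBasis.ext
  intro j
  rw [RootPairing.Base.toWeightBasis_apply, D.form_root, D.coroot'_omega i j]
  by_cases h : i = j
  · subst h; simp
  · simp [h]

theorem coroot'_neg (γ : ι) (z : V) :
    R.coroot' (R.reflectionPerm γ γ) z = -R.coroot' γ z := by
  rw [RootPairing.coroot'_reflectionPerm]
  simp [RootPairing.reflection_apply]
  ring

/-- Up to the factor `halfNorm β / halfNorm i` the coordinate at `i > 0` is `(ω_i, β^∨) + k (ω_i,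
ϑ^∨)`. For negative `β` one has `k ≥ 1`, and `ϑ^∨` dominates `-β^∨`. It follows that positivity of
an image can be checked on simple roots. -/
theorem affCoord_nonneg {e : V × ℝ} (he : D.AffPos e) (i : D.Node) : 0 ≤ D.affCoord i e := by
  obtain ⟨β, k, rfl, h⟩ := he
  have hk : 0 ≤ k := by omega
  have hk' : (0 : ℝ) ≤ k := by exact_mod_cast hk
  have hβ0 := D.halfNorm_pos β
  cases i with
  | none => exact mul_nonneg hβ0.le hk'
  | some i =>
    refine nonneg_of_mul_nonneg_right (a := D.halfNorm i) ?_ (D.halfNorm_pos i)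
    have h1 : D.halfNorm i * D.affCoord (some i) (R.root β, D.halfNorm β * k) =
        D.halfNorm β * (R.coroot' β (D.omega (some i)) + k * R.coroot' D.theta (D.omega (some i))) := by
      have h2 := D.halfNorm_mul_coord i (R.root β)
      have h3 := D.halfNorm_mul_coord i (R.root D.theta)
      rw [D.form_root] at h2
      rw [D.form_theta] at h3
      simp only [affCoord, LinearMap.add_apply, LinearMap.comp_apply, LinearMap.fst_apply,
        LinearMap.smul_apply, LinearMap.snd_apply, smul_eq_mul, mul_add, h2, ← h3]
      ring
    rw [h1]
    refine mul_nonneg hβ0.le ?_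
    have hθ := D.coroot'_omega_nonneg (some i) D.isPos_theta
    by_cases hp : D.base.IsPos β
    · exact add_nonneg (D.coroot'_omega_nonneg _ hp) (mul_nonneg hk' hθ)
    · have hk1 : (1 : ℝ) ≤ k := by
        rcases h with h | h
        · exact_mod_cast h
        · exact absurd h.2 hp
      have h4 := D.coroot'_le_coroot'_theta (z := D.omega (some i))
        (D.coroot'_omega_some_nonneg (some i)) (R.reflectionPerm β β)
      have h5 := coroot'_neg (R := R) β (D.omega (some i))
      nlinarith

theorem isAffineRoot_ne_zero {e : V × ℝ} (he : D.IsAffineRoot e) : e ≠ 0 := by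
  obtain ⟨β, k, rfl⟩ := he
  intro h
  exact R.ne_zero β (congrArg Prod.fst h)

theorem affPos_of_affCoord_nonneg {e : V × ℝ} (he : D.IsAffineRoot e)
    (h : ∀ i, 0 ≤ D.affCoord i e) : D.AffPos e := by
  refine he.pos_or_neg.resolve_right fun hn => D.isAffineRoot_ne_zero he ?_
  rw [D.sum_affCoord e]
  refine Finset.sum_eq_zero fun i _ => ?_
  have h1 := D.affCoord_nonneg hn i
  rw [map_neg] at h1
  rw [le_antisymm (by linarith) (h i), zero_smul]

theorem affPos_map_of_coord {y : (V × ℝ) ≃ₗ[ℝ] (V × ℝ)} (hy : y ∈ D.extWeyl) {e : V × ℝ}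
    (he : D.AffPos e) (h : ∀ i, D.affCoord i e ≠ 0 → D.AffPos (y (D.simpleRoot i))) :
    D.AffPos (y e) := by
  refine D.affPos_of_affCoord_nonneg (D.extWeyl_isAffineRoot hy he.isAffineRoot) fun k => ?_
  rw [D.sum_affCoord e, map_sum, map_sum]
  refine Finset.sum_nonneg fun i _ => ?_
  rw [map_smul, map_smul, smul_eq_mul]
  by_cases h0 : D.affCoord i e = 0
  · rw [h0, zero_mul]
  · exact mul_nonneg (D.affCoord_nonneg he i) (D.affCoord_nonneg (h i h0) k)

theorem affPos_neg_map_of_coord {y : (V × ℝ) ≃ₗ[ℝ] (V × ℝ)} (hy : y ∈ D.extWeyl) {e : V × ℝ}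
    (he : D.AffPos e) (h : ∀ i, D.affCoord i e ≠ 0 → D.AffPos (-y (D.simpleRoot i))) :
    D.AffPos (-y e) := by
  refine D.affPos_of_affCoord_nonneg (D.extWeyl_isAffineRoot hy he.isAffineRoot).neg fun k => ?_
  rw [D.sum_affCoord e, map_sum, ← Finset.sum_neg_distrib, map_sum]
  refine Finset.sum_nonneg fun i _ => ?_
  rw [map_smul, ← smul_neg, map_smul, smul_eq_mul]
  by_cases h0 : D.affCoord i e = 0
  · rw [h0, zero_mul]
  · exact mul_nonneg (D.affCoord_nonneg he i) (D.affCoord_nonneg (h i h0) k)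

/-! ### Elements of the extended affine Weyl group of length zero -/

/-- The elements of length zero: they make no simple affine root negative. -/
def IsLengthZero (y : (V × ℝ) ≃ₗ[ℝ] (V × ℝ)) : Prop :=
  y ∈ D.extWeyl ∧ ∀ i, D.AffPos (y (D.simpleRoot i))

variable {D} in
theorem IsLengthZero.affPos {y : (V × ℝ) ≃ₗ[ℝ] (V × ℝ)} (hy : D.IsLengthZero y) {e : V × ℝ}
    (he : D.AffPos e) : D.AffPos (y e) :=
  D.affPos_map_of_coord hy.1 he fun i _ => hy.2 i

variable {D} in
theorem IsLengthZero.affPos_iff {y : (V × ℝ) ≃ₗ[ℝ] (V × ℝ)} (hy : D.IsLengthZero y) {e : V × ℝ}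
    (he : D.IsAffineRoot e) : D.AffPos (y e) ↔ D.AffPos e := by
  refine ⟨fun h => he.pos_or_neg.resolve_right fun h' => ?_, hy.affPos⟩
  have := hy.affPos h'
  rw [map_neg] at this
  exact D.not_affPos_neg h this

variable {D} in
theorem IsLengthZero.inv {y : (V × ℝ) ≃ₗ[ℝ] (V × ℝ)} (hy : D.IsLengthZero y) :
    D.IsLengthZero y⁻¹ := by
  refine ⟨inv_mem hy.1, fun i => ?_⟩
  rw [← hy.affPos_iff (D.extWeyl_isAffineRoot (inv_mem hy.1) (D.isAffineRoot_simpleRoot i)),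
    ← LinearEquiv.mul_apply, mul_inv_cancel]
  exact D.affPos_simpleRoot i

variable {D} in
theorem IsLengthZero.mul {x y : (V × ℝ) ≃ₗ[ℝ] (V × ℝ)} (hx : D.IsLengthZero x)
    (hy : D.IsLengthZero y) : D.IsLengthZero (x * y) :=
  ⟨mul_mem hx.1 hy.1, fun i => hx.affPos (hy.2 i)⟩

theorem simpleRoot_injective : Function.Injective D.simpleRoot := by
  classical
  intro i j h
  have := D.affCoord_simpleRoot i j
  rw [← h, D.affCoord_simpleRoot i i, if_pos rfl] at this
  by_contra hne
  rw [if_neg hne] at this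
  exact one_ne_zero this

theorem smul_eq_imp {e e' : V × ℝ} (he : D.IsAffineRoot e) (he' : D.IsAffineRoot e') {t : ℝ}
    (ht : 0 ≤ t) (h : e = t • e') : e = e' := by
  obtain ⟨β, k, rfl⟩ := he
  obtain ⟨γ, l, rfl⟩ := he'
  have h1 : R.root β = t • R.root γ := congrArg Prod.fst h
  have hdep : ¬ LinearIndependent ℝ ![R.root γ, R.root β] := by
    rw [LinearIndependent.pair_iff]
    push Not
    exact ⟨t, -1, by rw [h1]; simp, fun _ => by norm_num⟩
  have h2 : R.root γ = R.root β ∨ R.root γ = -R.root β := by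
    by_cases hγβ : γ = β
    · exact Or.inl (by rw [hγβ])
    · exact RootPairing.IsReduced.eq_or_eq_neg γ β hdep
  have ht1 : t = 1 := by
    have hne := R.ne_zero γ
    rcases h2 with h2 | h2
    · rw [← h2] at h1
      have : (t - 1) • R.root γ = 0 := by rw [sub_smul, ← h1]; simp
      rcases smul_eq_zero.1 this with h | h
      · linarith
      · exact absurd h hne
    · rw [show R.root β = -R.root γ by rw [h2, neg_neg]] at h1
      have : (t + 1) • R.root γ = 0 := by rw [add_smul, ← h1]; simp
      rcases smul_eq_zero.1 this with h | h
      · linarith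
      · exact absurd h hne
  rw [h, ht1, one_smul]

variable {D} in
-- Both `y` and `y⁻¹` preserve the cone of non-negative coordinates, so they permute its extremal
-- rays. If `α_j` occurs in `y(α_i)`, applying `y⁻¹` allows no cancellation, so `y⁻¹(α_j)` is a
-- multiple of `α_i`; as the system is reduced, they are equal.
theorem IsLengthZero.exists_simpleRoot {y : (V × ℝ) ≃ₗ[ℝ] (V × ℝ)} (hy : D.IsLengthZero y)
    (i : D.Node) : ∃ j, y (D.simpleRoot i) = D.simpleRoot j := by
  classical
  have hroot := D.extWeyl_isAffineRoot hy.1 (D.isAffineRoot_simpleRoot i)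
  obtain ⟨j, hj⟩ : ∃ j, D.affCoord j (y (D.simpleRoot i)) ≠ 0 := by
    by_contra! h
    refine D.isAffineRoot_ne_zero hroot ?_
    rw [D.sum_affCoord (y _)]
    exact Finset.sum_eq_zero fun k _ => by rw [h, zero_smul]
  refine ⟨j, ?_⟩
  have hpos : ∀ k, D.AffPos (y⁻¹ (D.simpleRoot k)) := hy.inv.2
  have hcoord : ∀ l, l ≠ i → D.affCoord l (y⁻¹ (D.simpleRoot j)) = 0 := by
    intro l hl
    have h1 : D.affCoord l (y⁻¹ (y (D.simpleRoot i))) = 0 := by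
      rw [← LinearEquiv.mul_apply, inv_mul_cancel]
      exact (D.affCoord_simpleRoot l i).trans (if_neg hl)
    rw [D.sum_affCoord (y (D.simpleRoot i)), map_sum, map_sum] at h1
    simp only [map_smul, smul_eq_mul] at h1
    have h2 := (Finset.sum_eq_zero_iff_of_nonneg fun k _ => mul_nonneg
      (D.affCoord_nonneg (hy.2 i) k) (D.affCoord_nonneg (hpos k) l)).1 h1 j (Finset.mem_univ j)
    exact (mul_eq_zero.1 h2).resolve_left hj
  have h3 : y⁻¹ (D.simpleRoot j) = D.affCoord i (y⁻¹ (D.simpleRoot j)) • D.simpleRoot i := by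
    conv_lhs => rw [D.sum_affCoord (y⁻¹ (D.simpleRoot j))]
    exact Finset.sum_eq_single i (fun l _ hl => by rw [hcoord l hl, zero_smul]) (by simp)
  have h4 := D.smul_eq_imp (hpos j).isAffineRoot (D.isAffineRoot_simpleRoot i)
    (D.affCoord_nonneg (hpos j) i) h3
  rw [← h4, ← LinearEquiv.mul_apply, mul_inv_cancel]
  rfl

variable {D} in
theorem IsLengthZero.exists_perm {y : (V × ℝ) ≃ₗ[ℝ] (V × ℝ)} (hy : D.IsLengthZero y) :
    ∃ σ : Equiv.Perm D.Node, ∀ i, y (D.simpleRoot i) = D.simpleRoot (σ i) := by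
  choose σ hσ using hy.exists_simpleRoot
  have hinj : Function.Injective σ := fun i j h => D.simpleRoot_injective
    (y.injective (by rw [hσ, hσ, h]))
  exact ⟨Equiv.ofBijective σ (Finite.injective_iff_bijective.1 hinj), hσ⟩

variable {D} in
theorem IsLengthZero.mem_orbitO {y : (V × ℝ) ≃ₗ[ℝ] (V × ℝ)} (hy : D.IsLengthZero y) {j : D.Node}
    (hj : y (D.simpleRoot none) = D.simpleRoot j) : j ∈ D.orbitO := by
  obtain ⟨σ, hσ⟩ := hy.exists_perm
  refine ⟨σ, fun i j => ?_, D.simpleRoot_injective (by rw [← hσ, hj])⟩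
  rw [← hσ, D.corootForm_extWeyl hy.1 (hσ j)]

/-! ### Longest elements and the elements `u_r` -/

theorem affPos_mk_zero {β : ι} : D.AffPos (R.root β, 0) ↔ D.base.IsPos β := by
  have := D.affPos_mk (β := β) (k := 0)
  simpa using this

theorem weyl_apply_root {w : (V × ℝ) ≃ₗ[ℝ] (V × ℝ)} (hw : w ∈ D.weyl) (β : ι) :
    ∃ γ, w (R.root β, 0) = (R.root γ, 0) := by
  obtain ⟨g, hg, rfl⟩ := D.exists_of_mem_weyl hw
  obtain ⟨γ, hγ⟩ := hg.root β
  exact ⟨γ, by rw [prodOne_apply, hγ]⟩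

theorem finite_weyl : (D.weyl : Set ((V × ℝ) ≃ₗ[ℝ] (V × ℝ))).Finite := by
  have : ∀ w : D.weyl, ∀ β, ∃ γ, (w : (V × ℝ) ≃ₗ[ℝ] (V × ℝ)) (R.root β, 0) = (R.root γ, 0) :=
    fun w β => D.weyl_apply_root w.2 β
  choose f hf using this
  refine Finite.of_injective f fun v w h => ?_
  obtain ⟨g, -, hg⟩ := D.exists_of_mem_weyl v.2
  obtain ⟨g', -, hg'⟩ := D.exists_of_mem_weyl w.2
  have hgg : g = g' := by
    apply LinearEquiv.toLinearMap_injective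
    apply D.base.toWeightBasis.ext
    intro i
    have h1 := hf v i
    have h2 := hf w i
    rw [hg, prodOne_apply] at h1
    rw [hg', prodOne_apply, ← h, ← h1] at h2
    simpa using (congrArg Prod.fst h2).symm
  exact Subtype.ext (by rw [hg, hg', hgg])

theorem weylSystem : SignSystem (fun i : D.Simple => D.simpleReflection (some i))
    (fun i : D.Simple => D.simpleRoot (some i)) D.AffPos :=
  D.signSystem.comp some

theorem weylWord_spec {w : (V × ℝ) ≃ₗ[ℝ] (V × ℝ)} (hw : w ∈ D.weyl) :
    ((D.weylWord w).map fun i : D.Simple => D.simpleReflection (some i)).prod = w ∧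
      IsRedWord (fun i : D.Simple => D.simpleReflection (some i)) (D.weylWord w) :=
  redWord_spec (D.weylSystem.exists_word hw)

theorem longest_spec {S : Set ((V × ℝ) ≃ₗ[ℝ] (V × ℝ))} (hS : S ⊆ D.weyl) (hne : S.Nonempty) :
    D.longest S ∈ S ∧ ∀ v ∈ S, (D.weylWord v).length ≤ (D.weylWord (D.longest S)).length :=
  Classical.epsilon_spec (p := fun w => w ∈ S ∧
    ∀ v ∈ S, (D.weylWord v).length ≤ (D.weylWord w).length)
    (Set.exists_max_image S _ (D.finite_weyl.subset hS) hne)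

/-- Otherwise appending `i` to a reduced word of the longest element would give a longer element of
`S`. -/
theorem longest_neg {S : Set ((V × ℝ) ≃ₗ[ℝ] (V × ℝ))} (hS : S ⊆ D.weyl) (hne : S.Nonempty)
    (i : D.Simple) (hi : D.longest S * D.simpleReflection (some i) ∈ S) :
    D.AffPos (-D.longest S (D.simpleRoot (some i))) := by
  obtain ⟨h1, h2⟩ := D.longest_spec hS hne
  have hw := hS h1
  refine (D.extWeyl_isAffineRoot (D.weyl_le_extWeyl hw)
    (D.isAffineRoot_simpleRoot _)).pos_or_neg.resolve_left fun hpos => ?_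
  obtain ⟨h3, h4⟩ := D.weylWord_spec hw
  have h5 := D.weylSystem.isRedWord_concat h4 (i := i) (by rw [h3]; exact hpos)
  obtain ⟨h6, -⟩ := D.weylWord_spec (hS hi)
  have h7 := h5 _ (h6.trans (by rw [List.map_append, List.prod_append, h3]; simp))
  have h8 := h2 _ hi
  simp at h7
  omega

/-- The stabilizer of `ω_i` in `W`. -/
def omegaStab (i : D.Simple) : Set ((V × ℝ) ≃ₗ[ℝ] (V × ℝ)) :=
  {w | w ∈ D.weyl ∧ w (D.omega (some i), 0) = (D.omega (some i), 0)}

theorem u_some (i : D.Simple) :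
    D.u (some i) = D.longest D.weyl * D.longest (D.omegaStab i) := rfl

theorem longest_omegaStab_mem (i : D.Simple) : D.longest (D.omegaStab i) ∈ D.omegaStab i :=
  (D.longest_spec (S := D.omegaStab i) (fun _ h => h.1) ⟨1, one_mem _, rfl⟩).1

theorem longest_weyl_mem : D.longest D.weyl ∈ D.weyl :=
  (D.longest_spec subset_rfl ⟨1, one_mem D.weyl⟩).1

theorem u_mem (i : D.Node) : D.u i ∈ D.weyl := by
  cases i with
  | none => exact one_mem _
  | some i => exact mul_mem D.longest_weyl_mem (D.longest_omegaStab_mem i).1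

theorem longest_weyl_neg {β : ι} (hβ : D.base.IsPos β) :
    D.AffPos (-D.longest D.weyl (R.root β, 0)) := by
  refine D.affPos_neg_map_of_coord (D.weyl_le_extWeyl D.longest_weyl_mem)
    (D.affPos_mk_zero.2 hβ) fun i hi => ?_
  cases i with
  | none => exact absurd rfl hi
  | some i =>
    exact D.longest_neg subset_rfl ⟨1, one_mem D.weyl⟩ i
      (mul_mem D.longest_weyl_mem (Subgroup.subset_closure ⟨i, rfl⟩))

theorem longest_weyl_pos {β : ι} (hβ : ¬ D.base.IsPos β) :
    D.AffPos (D.longest D.weyl (R.root β, 0)) := by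
  rw [← D.isPos_reflectionPerm_self] at hβ
  have := D.longest_weyl_neg hβ
  rw [← map_neg] at this
  simpa using this

/-- The coefficient of `α_i` in `β` is proportional to `(ω_i, β^∨) = 0`, so only roots `α_j` with `j
≠ i` occur, and their reflections fix `ω_i`. -/
theorem longest_omegaStab_neg (i : D.Simple) {β : ι} (hβ : D.base.IsPos β)
    (h0 : R.coroot' β (D.omega (some i)) = 0) :
    D.AffPos (-D.longest (D.omegaStab i) (R.root β, 0)) := by
  classical
  refine D.affPos_neg_map_of_coord (D.weyl_le_extWeyl (D.longest_omegaStab_mem i).1)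
    (D.affPos_mk_zero.2 hβ) fun j hj => ?_
  cases j with
  | none => exact absurd rfl hj
  | some j =>
    have hji : j ≠ i := by
      rintro rfl
      apply hj
      have h1 := D.halfNorm_mul_coord j (R.root β)
      rw [D.form_root, h0, mul_zero] at h1
      have h2 := (mul_eq_zero.1 h1).resolve_left (D.halfNorm_pos j).ne'
      simp only [affCoord, LinearMap.add_apply, LinearMap.comp_apply, LinearMap.fst_apply,
        LinearMap.smul_apply, LinearMap.snd_apply, h2]
      simp
    refine D.longest_neg (S := D.omegaStab i) (fun _ h => h.1) ⟨1, one_mem _, rfl⟩ j ?_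
    refine ⟨mul_mem (D.longest_omegaStab_mem i).1 (Subgroup.subset_closure ⟨j, rfl⟩), ?_⟩
    have h3 : D.simpleReflection (some j) (D.omega (some i), 0) = (D.omega (some i), 0) := by
      rw [simpleReflection_apply]
      have : D.corootForm (some j) (D.omega (some i)) = 0 :=
        (D.coroot'_omega i j).trans (if_neg (Ne.symm hji))
      simp [this]
    rw [LinearEquiv.mul_apply, h3, (D.longest_omegaStab_mem i).2]

/-- The two longest elements each reverse the sign of such a root. -/
theorem u_pos (i : D.Simple) {β : ι} (hβ : D.base.IsPos β)
    (h0 : R.coroot' β (D.omega (some i)) = 0) : D.AffPos (D.u (some i) (R.root β, 0)) := by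
  rw [u_some, LinearEquiv.mul_apply]
  have h := D.longest_omegaStab_neg i hβ h0
  obtain ⟨γ, hγ⟩ := D.weyl_apply_root (D.longest_omegaStab_mem i).1 β
  rw [hγ] at h ⊢
  exact D.longest_weyl_pos fun hp => D.not_affPos_neg (D.affPos_mk_zero.2 hp) h

/-- The longest element of the stabilizer fixes `ω_i` and preserves the form, so the image of `β`
still has positive product with `ω_i` and is positive; `w_0` then makes it negative. -/
theorem u_neg (i : D.Simple) {β : ι} (hβ : D.base.IsPos β)
    (h0 : R.coroot' β (D.omega (some i)) ≠ 0) : D.AffPos (-D.u (some i) (R.root β, 0)) := by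
  rw [u_some, LinearEquiv.mul_apply]
  have hmem := D.longest_omegaStab_mem i
  obtain ⟨γ, hγ⟩ := D.weyl_apply_root hmem.1 β
  rw [hγ]
  refine D.longest_weyl_neg ?_
  have h1 := D.form_extWeyl (D.weyl_le_extWeyl hmem.1) (D.omega (some i), 0) (R.root β, 0)
  rw [hmem.2, hγ] at h1
  simp only [D.form_root] at h1
  have h2 : 0 < R.coroot' β (D.omega (some i)) :=
    lt_of_le_of_ne (D.coroot'_omega_nonneg _ hβ) (Ne.symm h0)
  by_contra hγn
  rw [← D.isPos_reflectionPerm_self] at hγn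
  have h3 := D.coroot'_omega_nonneg (some i) hγn
  rw [coroot'_neg] at h3
  have := mul_pos (D.halfNorm_pos β) h2
  have := mul_nonneg (D.halfNorm_pos γ).le h3
  linarith

theorem omega_mem (i : D.Node) : D.omega i ∈ D.weights := (D.fundWeight i).2

variable {D} in
/-- The elements of length zero are determined by the image of `α₀`. -/
theorem IsLengthZero.eq_of_apply {y : (V × ℝ) ≃ₗ[ℝ] (V × ℝ)} (hy : D.IsLengthZero y)
    {b : V} {w : (V × ℝ) ≃ₗ[ℝ] (V × ℝ)} (hw : w ∈ D.weyl) (hyb : y = D.translation b * w)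
    {j : D.Node} (hj : y (D.simpleRoot none) = D.simpleRoot j) :
    b = D.omega j ∧ w = (D.u j)⁻¹ := by
  classical
  obtain ⟨σ, hσ⟩ := hy.exists_perm
  obtain ⟨g, hg, rfl⟩ := D.exists_of_mem_weyl hw
  have happ : ∀ z, y z = (g z.1, z.2 - D.form.form (g z.1) b) := fun z => by rw [hyb]; rfl
  have hjσ : σ none = j := D.simpleRoot_injective (by rw [← hσ, hj])
  -- Such an `α_k` is the image of a finite simple root, so both have level zero, which means `(α_k,
  -- b) = 0`.
  have hzero : ∀ k : D.Simple, some k ≠ j → R.coroot' k b = 0 := by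
    intro k hk
    obtain ⟨i, hi⟩ := σ.surjective (some k)
    cases i with
    | none => exact absurd (hi.symm.trans hjσ) hk
    | some i =>
      have h1 := hσ (some i)
      rw [hi, happ] at h1
      have h2 : g (R.root i) = R.root k := congrArg Prod.fst h1
      have h3 : 0 - D.form.form (g (R.root i)) b = 0 := congrArg Prod.snd h1
      rw [h2, D.form_comm, D.form_root, zero_sub, neg_eq_zero] at h3
      exact (mul_eq_zero.1 h3).resolve_left (D.halfNorm_pos k).ne'
  cases j with
  | none =>
    have hb : b = 0 := D.ext_coroot' fun i => by rw [hzero i (by simp), map_zero]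
    refine ⟨hb, ?_⟩
    have h1 : prodOne g = 1 := by
      refine D.weylSystem.eq_one_of_pos hw fun i => ?_
      have := hy.2 (some i)
      rw [hyb, hb, translation_zero, one_mul] at this
      exact this
    rw [h1]
    exact inv_one.symm
  | some r =>
    rw [happ] at hj
    have h1 : g (-R.root D.theta) = R.root r := congrArg Prod.fst hj
    have h2 : 1 - D.form.form (g (-R.root D.theta)) b = 0 := congrArg Prod.snd hj
    rw [h1, D.form_comm, D.form_root] at h2
    have h3 : D.halfNorm r = 1 := by
      have : R.root (R.reflectionPerm D.theta D.theta) = -R.root D.theta := by simp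
      rw [← this] at h1
      rw [D.halfNorm_eq_of_form_eq hg.form h1, D.halfNorm_reflectionPerm, D.halfNorm_theta]
    have hb : b = D.omega (some r) := D.ext_coroot' fun i => by
      rw [D.coroot'_omega r i]
      split_ifs with h
      · subst h; rw [h3] at h2; linarith
      · exact hzero i (by simpa using Ne.symm h)
    refine ⟨hb, ?_⟩
    -- It suffices that `u_r w` keeps simple roots positive. Let `γ = w(α_i)` and `n = (ω_r, γ^∨)`.
    -- Positivity of `y(α_i) = [γ, -halfNorm γ * n]` leaves two cases: `n < 0`, where `γ` is
    -- negative and `u_r` makes it positive, or `n = 0` with `γ` positive, where `u_r` keeps its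
    -- sign.
    rw [eq_inv_iff_mul_eq_one, mul_eq_one_iff_inv_eq, eq_comm, ← mul_eq_one_iff_eq_inv]
    refine D.weylSystem.eq_one_of_pos (mul_mem (D.u_mem _) hw) fun i => ?_
    obtain ⟨γ, hγ⟩ := hg.root i
    change D.AffPos (D.u (some r) (g (R.root i), 0))
    rw [hγ]
    obtain ⟨n, hn⟩ := D.exists_int_coroot' (D.omega_mem (some r)) γ
    have h4 := hy.2 (some i)
    rw [happ] at h4
    have h5 : (g (D.simpleRoot (some i)).1, (D.simpleRoot (some i)).2 -
        D.form.form (g (D.simpleRoot (some i)).1) b) = (R.root γ, D.halfNorm γ * ((-n : ℤ) : ℝ)) := by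
      simp only [simpleRoot, hγ]
      rw [D.form_comm, D.form_root, hb, hn]
      push_cast
      simp
    rw [h5, affPos_mk] at h4
    rcases h4 with h4 | ⟨h4, h6⟩
    · have hneg : ¬ D.base.IsPos γ := fun hp => by
        have := D.coroot'_omega_nonneg (some r) hp
        rw [hn] at this
        have : 0 ≤ n := by exact_mod_cast this
        omega
      rw [← D.isPos_reflectionPerm_self] at hneg
      have h7 := D.u_neg r hneg (by
        rw [coroot'_neg, hn, neg_ne_zero]
        have : n ≠ 0 := by omega
        exact_mod_cast this)
      rw [← map_neg] at h7
      simpa using h7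
    · refine D.u_pos r h6 ?_
      have : n = 0 := by omega
      rw [hn, this]; simp

theorem piElt_mem (r : D.orbitO) : D.piElt r ∈ D.extWeyl :=
  mul_mem (D.translation_mem (D.omega_mem r)) (inv_mem (D.weyl_le_extWeyl (D.u_mem r)))

theorem exists_piElt {y : (V × ℝ) ≃ₗ[ℝ] (V × ℝ)} (hy : D.IsLengthZero y) :
    ∃ r : D.orbitO, y = D.piElt r ∧ y (D.simpleRoot none) = D.simpleRoot r := by
  obtain ⟨b, -, w, hw, hyb⟩ := id hy.1
  obtain ⟨j, hj⟩ := hy.exists_simpleRoot none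
  obtain ⟨hb, hw'⟩ := hy.eq_of_apply hw hyb hj
  exact ⟨⟨j, hy.mem_orbitO hj⟩, hyb.trans (by rw [hb, hw']; rfl), hj⟩

/-! ### The nodes in `O` are minuscule -/

/-- The marks `a_0 = 1`, `a_j = (ω_j, ϑ^∨)` are the coefficients of the linear relation between the
functionals `(·, α_j^∨)`, which is unique up to scalars. A diagram automorphism `σ` preserves the
relation, so `a ∘ σ = a(σ 0) a`. Summing over all nodes yields `a(σ 0) = 1`. -/
theorem coroot'_theta_omega {r : D.Node} (hr : r ∈ D.orbitO) (h0 : r ≠ none) :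
    R.coroot' D.theta (D.omega r) = 1 := by
  classical
  obtain ⟨σ, hσ, rfl⟩ := hr
  let a : D.Node → ℝ := fun i => match i with
    | none => 1
    | some i => R.coroot' D.theta (D.omega (some i))
  have ha0 : ∀ j, 0 ≤ a j := by
    intro j
    cases j with
    | none => exact zero_le_one
    | some j => exact D.coroot'_omega_nonneg _ D.isPos_theta
  have hnull : ∀ z, ∑ j, a j * D.corootForm j z = 0 := by
    intro z
    rw [Fintype.sum_option]
    have h := congrArg (R.coroot' D.theta) (D.eq_sum_omega z)
    rw [map_sum] at h
    simp only [map_smul, smul_eq_mul] at h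
    simp only [a, corootForm, LinearMap.neg_apply, one_mul]
    rw [h, neg_add_eq_zero]
    exact Finset.sum_congr rfl fun i _ => mul_comm _ _
  have hb : ∀ i, ∑ j, a (σ j) * D.corootForm j (D.simpleRoot i).1 = 0 := by
    intro i
    rw [← hnull (D.simpleRoot (σ i)).1,
      ← Equiv.sum_comp σ fun j => a j * D.corootForm j (D.simpleRoot (σ i)).1]
    exact Finset.sum_congr rfl fun j _ => by rw [hσ]
  have hb' : ∑ j, a (σ j) • D.corootForm j = 0 := by
    apply D.base.toWeightBasis.ext
    intro i
    have := hb (some i)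
    simpa [LinearMap.sum_apply, simpleRoot] using this
  have hprop : ∀ j, a (σ j) = a (σ none) * a j := by
    intro j
    cases j with
    | none => simp [a]
    | some j =>
      have h := LinearMap.congr_fun hb' (D.omega (some j))
      rw [LinearMap.sum_apply, Fintype.sum_option] at h
      simp only [LinearMap.smul_apply, corootForm, LinearMap.neg_apply, smul_eq_mul,
        D.coroot'_omega, LinearMap.zero_apply, mul_ite, mul_one, mul_zero, Finset.sum_ite_eq,
        Finset.mem_univ, if_true] at h
      change a (σ (some j)) = a (σ none) * R.coroot' D.theta (D.omega (some j))
      linarith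
  have hsum : ∑ j, a j = a (σ none) * ∑ j, a j := by
    rw [Finset.mul_sum, ← Equiv.sum_comp σ a]
    exact Finset.sum_congr rfl fun j _ => hprop j
  have hpos : 0 < ∑ j, a j := by
    refine Finset.sum_pos' (fun j _ => ha0 j) ⟨none, Finset.mem_univ _, ?_⟩
    exact one_pos
  have h1 : a (σ none) = 1 := by
    have : (a (σ none) - 1) * ∑ j, a j = 0 := by linarith
    rcases mul_eq_zero.1 this with h | h
    · linarith
    · exact absurd h hpos.ne'
  cases h : σ none with
  | none => exact absurd h h0
  | some j => rw [h] at h1; exact h1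

theorem coroot'_omega_cases {r : D.Node} (hr : r ∈ D.orbitO) {β : ι} (hβ : D.base.IsPos β) :
    R.coroot' β (D.omega r) = 0 ∨ R.coroot' β (D.omega r) = 1 := by
  by_cases h0 : r = none
  · left; rw [h0]; simp [omega]
  · have h1 := D.coroot'_omega_nonneg r hβ
    have h2 := D.coroot'_le_coroot'_theta (z := D.omega r) (D.coroot'_omega_some_nonneg r) β
    rw [D.coroot'_theta_omega hr h0] at h2
    obtain ⟨n, hn⟩ := D.exists_int_coroot' (D.omega_mem r) β
    rw [hn] at h1 h2 ⊢
    have h3 : 0 ≤ n := by exact_mod_cast h1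
    have h4 : n ≤ 1 := by exact_mod_cast h2
    have : n = 0 ∨ n = 1 := by omega
    rcases this with rfl | rfl <;> simp

/-- With `γ = u_r⁻¹(β)` the level `k` becomes `k - n`, where `n = (ω_r, γ^∨) ∈ {0, ±1}` by
minusculity, and `u_r` reverses the sign of `γ` exactly when `n ≠ 0`. So `n = 1` forces `β`
negative, `k ≥ 1` and `γ` positive; for `n = 0` the sign of the finite part is unchanged. -/
theorem isLengthZero_piElt (r : D.orbitO) : D.IsLengthZero (D.piElt r) := by
  refine ⟨D.piElt_mem r, fun i => ?_⟩
  obtain ⟨r, hr⟩ := r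
  cases r with
  | none =>
    have : D.piElt ⟨none, hr⟩ = 1 := by
      simp [piElt, omega, u, translation_zero]
    rw [this]
    exact D.affPos_simpleRoot i
  | some r =>
    obtain ⟨β, k, he, h⟩ := D.affPos_simpleRoot i
    obtain ⟨γ, hγ⟩ := D.weyl_apply_root (inv_mem (D.u_mem (some r))) β
    obtain ⟨g, hg, hgu⟩ := D.exists_of_mem_weyl (inv_mem (D.u_mem (some r)))
    have hγ' : D.u (some r) (R.root γ, 0) = (R.root β, 0) := by
      rw [← hγ, ← LinearEquiv.mul_apply, mul_inv_cancel]; rfl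
    obtain ⟨n, hn⟩ := D.exists_int_coroot' (D.omega_mem (some r)) γ
    have hgγ : g (R.root β) = R.root γ := by
      rw [hgu, prodOne_apply] at hγ
      exact congrArg Prod.fst hγ
    have hval : D.piElt ⟨some r, hr⟩ (D.simpleRoot i) =
        (R.root γ, D.halfNorm γ * ((k - n : ℤ) : ℝ)) := by
      rw [he, piElt, LinearEquiv.mul_apply, hgu, prodOne_apply, translation_apply]
      simp only [hgγ]
      rw [D.form_comm, D.form_root, hn, D.halfNorm_eq_of_form_eq hg.form hgγ]
      push_cast
      rw [mul_sub]
    rw [hval, affPos_mk]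
    by_cases hp : D.base.IsPos γ
    · rcases D.coroot'_omega_cases hr hp with h1 | h1
      · have hn0 : n = 0 := by rw [hn] at h1; exact_mod_cast h1
        have h2 := D.u_pos r hp h1
        rw [hγ', affPos_mk_zero] at h2
        rcases h with h | h
        · left; omega
        · right; exact ⟨by omega, hp⟩
      · have hn1 : n = 1 := by rw [hn] at h1; exact_mod_cast h1
        have h2 := D.u_neg r hp (by rw [h1]; exact one_ne_zero)
        rw [hγ'] at h2
        have h3 : ¬ D.base.IsPos β := fun h' => D.not_affPos_neg (D.affPos_mk_zero.2 h') h2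
        have h4 : 0 < k := by
          rcases h with h | h
          · exact h
          · exact absurd h.2 h3
        by_cases hk : k = 1
        · right; exact ⟨by omega, hp⟩
        · left; omega
    · have hp' := hp
      rw [← D.isPos_reflectionPerm_self] at hp'
      have hneg : (R.root (R.reflectionPerm γ γ), (0 : ℝ)) = -(R.root γ, 0) := by simp
      rcases D.coroot'_omega_cases hr hp' with h1 | h1
      · have h2 := D.u_pos r hp' h1
        rw [hneg, map_neg, hγ'] at h2
        have h3 : ¬ D.base.IsPos β := fun h' => D.not_affPos_neg (D.affPos_mk_zero.2 h') h2
        rw [coroot'_neg, hn] at h1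
        have hn0 : n = 0 := by
          have : (n : ℝ) = 0 := by linarith
          exact_mod_cast this
        rcases h with h | h
        · left; omega
        · exact absurd h.2 h3
      · rw [coroot'_neg, hn] at h1
        have hn1 : n = -1 := by
          have : (n : ℝ) = -1 := by linarith
          exact_mod_cast this
        left; omega

theorem omega_injective : Function.Injective D.omega := by
  classical
  intro i j h
  cases i with
  | none =>
    cases j with
    | none => rfl
    | some j =>
      have := D.coroot'_omega j j
      rw [← h] at this
      simp [omega] at this
  | some i =>
    have h1 := D.coroot'_omega i i
    rw [h] at h1
    cases j with
    | none => simp [omega] at h1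
    | some j =>
      rw [D.coroot'_omega j i] at h1
      by_contra hne
      rw [if_neg (fun h => hne (by rw [h])), if_pos rfl] at h1
      exact zero_ne_one h1

theorem piElt_simpleRoot_none (r : D.orbitO) :
    D.piElt r (D.simpleRoot none) = D.simpleRoot r := by
  obtain ⟨j, hj⟩ := (D.isLengthZero_piElt r).exists_simpleRoot none
  obtain ⟨h1, -⟩ := (D.isLengthZero_piElt r).eq_of_apply (inv_mem (D.u_mem r)) rfl hj
  rw [hj, D.omega_injective h1]

theorem piElt_injective : Function.Injective D.piElt := fun r s h =>
  Subtype.ext (D.simpleRoot_injective (by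
    rw [← piElt_simpleRoot_none, ← piElt_simpleRoot_none, h]))

theorem piElt_zeroO : D.piElt D.zeroO = 1 := by
  simp [piElt, zeroO, omega, u, translation_zero]

theorem piElt_star (r : D.orbitO) : D.piElt (D.star r) = (D.piElt r)⁻¹ := by
  obtain ⟨s, hs, -⟩ := D.exists_piElt (D.isLengthZero_piElt r).inv
  exact Classical.epsilon_spec (p := fun s => D.piElt s = (D.piElt r)⁻¹) ⟨s, hs.symm⟩

theorem exists_piElt_mul (r s : D.orbitO) : ∃ t, D.piElt r * D.piElt s = D.piElt t :=
  let ⟨t, ht, _⟩ := D.exists_piElt ((D.isLengthZero_piElt r).mul (D.isLengthZero_piElt s))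
  ⟨t, ht⟩

/-! ### Decomposition of the extended affine Weyl group -/

/-- The positive affine roots made negative by `y`. -/
def inversions (y : (V × ℝ) ≃ₗ[ℝ] (V × ℝ)) : Set (V × ℝ) := {e | D.AffPos e ∧ D.AffPos (-y e)}

theorem finite_inversions {y : (V × ℝ) ≃ₗ[ℝ] (V × ℝ)} (hy : y ∈ D.extWeyl) :
    (D.inversions y).Finite := by
  have hn : ∀ β : ι, ∃ n : ℤ, ∃ γ, ∀ k : ℤ, y (R.root β, D.halfNorm β * k) =
      (R.root γ, D.halfNorm γ * ((k - n : ℤ) : ℝ)) := by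
    intro β
    obtain ⟨g, hg, b, hb, h⟩ := D.exists_of_mem_extWeyl hy
    obtain ⟨γ, hγ⟩ := hg.root β
    obtain ⟨n, hn⟩ := D.exists_int_coroot' hb γ
    refine ⟨n, γ, fun k => ?_⟩
    rw [h, hγ, D.form_comm, D.form_root, hn, D.halfNorm_eq_of_form_eq hg.form hγ]
    push_cast
    rw [mul_sub]
  choose n γ hγ using hn
  refine (Set.finite_iUnion fun β : ι => (Set.finite_Icc 0 (n β)).image
    fun k : ℤ => (R.root β, D.halfNorm β * (k : ℝ))).subset ?_
  rintro e ⟨⟨β, k, rfl, hk⟩, hneg⟩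
  rw [hγ, affPos_neg_mk] at hneg
  rw [Set.mem_iUnion]
  exact ⟨β, k, ⟨by omega, by omega⟩, rfl⟩

/-- If `y(α_i)` is negative, `s_i` embeds the inversions of `y s_i` into those of `y` and misses
`α_i`. Hence the number of inversions drops until it reaches an element of length zero. -/
theorem exists_mul_isLengthZero {y : (V × ℝ) ≃ₗ[ℝ] (V × ℝ)} (hy : y ∈ D.extWeyl) :
    ∃ x ∈ D.affineWeyl, D.IsLengthZero (y * x) := by
  generalize hn : (D.inversions y).ncard = n
  induction n using Nat.strong_induction_on generalizing y with
  | _ n ih =>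
    by_cases hpos : ∀ i, D.AffPos (y (D.simpleRoot i))
    · exact ⟨1, one_mem _, by rw [mul_one]; exact ⟨hy, hpos⟩⟩
    · push Not at hpos
      obtain ⟨i, hi⟩ := hpos
      have hneg := ((D.extWeyl_isAffineRoot hy (D.isAffineRoot_simpleRoot i)).not_affPos_iff).1 hi
      have hys := mul_mem hy (D.simpleReflection_mem_extWeyl i)
      have hinv : ∀ e, D.simpleReflection i (D.simpleReflection i e) = e := fun e => by
        rw [← LinearEquiv.mul_apply, D.simpleReflection_mul_self]; rfl
      have hlt : (D.inversions (y * D.simpleReflection i)).ncard < n := by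
        rw [← hn, ← Set.ncard_image_of_injective (D.inversions (y * D.simpleReflection i))
          (D.simpleReflection i).injective]
        refine Set.ncard_lt_ncard ?_ (D.finite_inversions hy)
        rw [Set.ssubset_iff_of_subset]
        · refine ⟨D.simpleRoot i, ⟨D.affPos_simpleRoot i, hneg⟩, ?_⟩
          rintro ⟨e, ⟨he, -⟩, he'⟩
          have : e = -D.simpleRoot i := by rw [← hinv e, he', simpleReflection_simpleRoot]
          rw [this] at he
          exact D.not_affPos_neg (D.affPos_simpleRoot i) he
        · rintro _ ⟨e, ⟨he, he'⟩, rfl⟩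
          refine ⟨(D.affPos_simpleReflection i e he).resolve_left ?_, he'⟩
          rintro rfl
          rw [LinearEquiv.mul_apply, simpleReflection_simpleRoot, map_neg, neg_neg] at he'
          exact hi he'
      obtain ⟨x, hx, hx'⟩ := ih _ hlt hys rfl
      exact ⟨D.simpleReflection i * x, mul_mem (Subgroup.subset_closure ⟨i, rfl⟩) hx,
        by rwa [← mul_assoc]⟩

theorem exists_piElt_mul_mem {y : (V × ℝ) ≃ₗ[ℝ] (V × ℝ)} (hy : y ∈ D.extWeyl) :
    ∃ r, (D.piElt r)⁻¹ * y ∈ D.affineWeyl := by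
  obtain ⟨x, hx, hyx⟩ := D.exists_mul_isLengthZero hy
  obtain ⟨r, hr, -⟩ := D.exists_piElt hyx
  refine ⟨r, ?_⟩
  rw [← hr]
  have : (y * x)⁻¹ * y = x⁻¹ := by group
  rw [this]
  exact inv_mem hx

theorem piPart_spec {y : (V × ℝ) ≃ₗ[ℝ] (V × ℝ)} (hy : y ∈ D.extWeyl) :
    (D.piElt (D.piPart y))⁻¹ * y ∈ D.affineWeyl :=
  Classical.epsilon_spec (p := fun r => (D.piElt r)⁻¹ * y ∈ D.affineWeyl)
    (D.exists_piElt_mul_mem hy)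

theorem eq_one_of_isLengthZero {x : (V × ℝ) ≃ₗ[ℝ] (V × ℝ)} (hx : x ∈ D.affineWeyl)
    (h : D.IsLengthZero x) : x = 1 :=
  D.signSystem.eq_one_of_pos hx h.2

theorem piPart_mul {x : (V × ℝ) ≃ₗ[ℝ] (V × ℝ)} (r : D.orbitO) (hx : x ∈ D.affineWeyl) :
    D.piPart (D.piElt r * x) = r := by
  have h := D.piPart_spec (mul_mem (D.piElt_mem r) (D.affineWeyl_le_extWeyl hx))
  set s := D.piPart (D.piElt r * x)
  have h1 : (D.piElt s)⁻¹ * D.piElt r ∈ D.affineWeyl := by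
    have := mul_mem h (inv_mem hx)
    rwa [mul_assoc, mul_assoc, mul_inv_cancel, mul_one] at this
  have h2 := D.eq_one_of_isLengthZero h1 ((D.isLengthZero_piElt s).inv.mul (D.isLengthZero_piElt r))
  exact D.piElt_injective (inv_mul_eq_one.1 h2)

end AffineData

end

/-! ### The elements `T_w` and their semi-infinite limits. -/

set_option linter.unusedSectionVars false

noncomputable section

namespace AffineData

variable {ι V N : Type*} [AddCommGroup V] [Module ℝ V] [AddCommGroup N] [Module ℝ N]
  {R : RootPairing ι ℝ V N} (D : AffineData R)

variable [R.IsRootSystem] [Finite ι] [R.IsCrystallographic] [R.IsReduced]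

/-! ### The sign of the finite part of an affine root -/

/-- The component in `V` is a positive root. -/
def FinPos (e : V × ℝ) : Prop := ∃ β, D.base.IsPos β ∧ e.1 = R.root β

theorem finPos_mk {β : ι} {t : ℝ} : D.FinPos (R.root β, t) ↔ D.base.IsPos β :=
  ⟨fun ⟨γ, h, h'⟩ => by rwa [R.root.injective h'], fun h => ⟨β, h, rfl⟩⟩

theorem finPos_neg_mk {β : ι} {t : ℝ} : D.FinPos (-(R.root β, t)) ↔ ¬ D.base.IsPos β := by
  have : -(R.root β, t) = (R.root (R.reflectionPerm β β), -t) := by simp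
  rw [this, finPos_mk, isPos_reflectionPerm_self]

theorem finPos_congr {e e' : V × ℝ} (h : e.1 = e'.1) : D.FinPos e ↔ D.FinPos e' := by
  simp only [FinPos, h]

variable {D} in
theorem IsAffineRoot.finPos_or {e : V × ℝ} (h : D.IsAffineRoot e) :
    D.FinPos e ∨ D.FinPos (-e) := by
  obtain ⟨β, k, rfl⟩ := h
  rw [finPos_mk, finPos_neg_mk]
  exact em _

theorem finPos_simpleRoot (i : D.Simple) : D.FinPos (D.simpleRoot (some i)) :=
  D.finPos_mk.2 (D.affPos_mk_zero.1 (D.affPos_simpleRoot (some i)))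

/-- The sum of the fundamental weights. -/
def rho : V := ∑ i : D.Simple, D.omega (some i)

theorem rho_mem : D.rho ∈ D.weights := AddSubgroup.sum_mem _ fun _ _ => D.omega_mem _

theorem one_le_coroot'_rho {β : ι} (hβ : D.base.IsPos β) : 1 ≤ R.coroot' β D.rho := by
  have h0 : ∀ i : D.Simple, 0 ≤ R.coroot' β (D.omega (some i)) :=
    fun i => D.coroot'_omega_nonneg _ hβ
  have hpos : 0 < R.coroot' β D.rho := by
    rw [rho, map_sum]
    refine lt_of_le_of_ne (Finset.sum_nonneg fun i _ => h0 i) fun h => R.ne_zero β ?_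
    have h1 := (Finset.sum_eq_zero_iff_of_nonneg fun i _ => h0 i).1 h.symm
    apply D.base.toWeightBasis.ext_elem
    intro i
    have h2 := D.halfNorm_mul_coord i (R.root β)
    rw [D.form_root, h1 i (Finset.mem_univ i), mul_zero] at h2
    simpa using (mul_eq_zero.1 h2).resolve_left (D.halfNorm_pos i).ne'
  obtain ⟨n, hn⟩ := D.exists_int_coroot' D.rho_mem β
  rw [hn] at hpos ⊢
  exact_mod_cast (show 0 < n by exact_mod_cast hpos)

/-- Each translation by `ρ` lowers the level of `[β, ·]` by at least `halfNorm β`, so far out only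
the sign of the finite part matters. -/
theorem eventually_affPos_neg {e : V × ℝ} (he : D.IsAffineRoot e) (h : D.FinPos e) :
    ∀ᶠ n : ℕ in Filter.atTop, D.AffPos (-(D.translation (n • D.rho) e)) := by
  obtain ⟨β, k, rfl⟩ := he
  rw [finPos_mk] at h
  obtain ⟨l, hl⟩ := D.exists_int_coroot' D.rho_mem β
  have h1 : 1 ≤ l := by
    have := D.one_le_coroot'_rho h
    rw [hl] at this
    exact_mod_cast this
  filter_upwards [Filter.eventually_gt_atTop k.toNat] with n hn
  have h2 : D.translation (n • D.rho) (R.root β, D.halfNorm β * k) =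
      (R.root β, D.halfNorm β * ((k - n * l : ℤ) : ℝ)) := by
    rw [translation_apply, map_nsmul, D.form_comm, D.form_root, hl]
    push_cast
    rw [nsmul_eq_mul]
    congr 1
    ring
  rw [h2, affPos_neg_mk]
  left
  have : k < n := by omega
  nlinarith

theorem eventually_affPos {e : V × ℝ} (he : D.IsAffineRoot e) (h : D.FinPos (-e)) :
    ∀ᶠ n : ℕ in Filter.atTop, D.AffPos (D.translation (n • D.rho) e) := by
  have := D.eventually_affPos_neg he.neg h
  simpa only [map_neg, neg_neg] using this

/-! ### Induction along reduced decompositions -/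

theorem inversions_inv_subset {y : (V × ℝ) ≃ₗ[ℝ] (V × ℝ)} {i : D.Node}
    (h : D.AffPos (y (D.simpleRoot i))) :
    D.inversions y⁻¹ ⊆ D.inversions (y * D.simpleReflection i)⁻¹ := by
  rintro e ⟨he, he'⟩
  refine ⟨he, ?_⟩
  rw [mul_inv_rev, inv_eq_of_mul_eq_one_left (D.simpleReflection_mul_self i),
    LinearEquiv.mul_apply, ← map_neg]
  refine (D.affPos_simpleReflection i _ he').resolve_left fun h' => ?_
  refine D.not_affPos_neg he (e := e) ?_
  have : y (-y⁻¹ e) = -e := by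
    rw [map_neg, ← LinearEquiv.mul_apply, mul_inv_cancel]; rfl
  rwa [h', ← this] at *

theorem mem_inversions_inv {y : (V × ℝ) ≃ₗ[ℝ] (V × ℝ)} {i : D.Node}
    (h : D.AffPos (y (D.simpleRoot i))) :
    y (D.simpleRoot i) ∈ D.inversions (y * D.simpleReflection i)⁻¹ := by
  refine ⟨h, ?_⟩
  rw [mul_inv_rev, inv_eq_of_mul_eq_one_left (D.simpleReflection_mul_self i),
    LinearEquiv.mul_apply, ← LinearEquiv.mul_apply y⁻¹, inv_mul_cancel]
  change D.AffPos (-D.simpleReflection i (D.simpleRoot i))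
  rw [simpleReflection_simpleRoot, neg_neg]
  exact D.affPos_simpleRoot i

/-- Induction along a reduced decomposition, for elements `y` such that the inversions of `y⁻¹` lie
in a given set. -/
theorem ext_induction_of_subset {P : ((V × ℝ) ≃ₗ[ℝ] (V × ℝ)) → Prop} {S : Set (V × ℝ)}
    (hpi : ∀ r, P (D.piElt r))
    (hs : ∀ y ∈ D.extWeyl, ∀ i, D.AffPos (y (D.simpleRoot i)) → y (D.simpleRoot i) ∈ S →
      P y → P (y * D.simpleReflection i))
    {y : (V × ℝ) ≃ₗ[ℝ] (V × ℝ)} (hy : y ∈ D.extWeyl) (hyS : D.inversions y⁻¹ ⊆ S) : P y := by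
  obtain ⟨w, hw, hwy⟩ := D.signSystem.exists_isRedWord (D.piPart_spec hy)
  generalize D.piPart y = r at hwy
  have hwy' : y = D.piElt r * (w.map D.simpleReflection).prod := by
    rw [hwy, mul_inv_cancel_left]
  clear hwy
  induction w using List.reverseRecOn generalizing y with
  | nil => rw [hwy']; simpa using hpi r
  | append_singleton w i ih =>
    have hmem : D.piElt r * (w.map D.simpleReflection).prod ∈ D.extWeyl :=
      mul_mem (D.piElt_mem r) (D.affineWeyl_le_extWeyl (SignSystem.prod_mem_closure w))
    have hpos : D.AffPos ((D.piElt r * (w.map D.simpleReflection).prod) (D.simpleRoot i)) :=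
      (D.isLengthZero_piElt r).affPos (D.signSystem.pos_of_isRedWord_concat hw)
    have hy' : y = D.piElt r * (w.map D.simpleReflection).prod * D.simpleReflection i := by
      rw [hwy']; simp [mul_assoc]
    rw [hy'] at hyS ⊢
    exact hs _ hmem i hpos (hyS (D.mem_inversions_inv hpos))
      (ih hmem ((D.inversions_inv_subset hpos).trans hyS) hw.of_append_left rfl)

@[elab_as_elim]
theorem ext_induction {P : (y : (V × ℝ) ≃ₗ[ℝ] (V × ℝ)) → y ∈ D.extWeyl → Prop}
    (hpi : ∀ r, P (D.piElt r) (D.piElt_mem r))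
    (hs : ∀ y hy i, D.AffPos (y (D.simpleRoot i)) → P y hy →
      P (y * D.simpleReflection i) (mul_mem hy (D.simpleReflection_mem_extWeyl i)))
    {y : (V × ℝ) ≃ₗ[ℝ] (V × ℝ)} (hy : y ∈ D.extWeyl) : P y hy := by
  have h := D.ext_induction_of_subset (S := Set.univ) (P := fun y => ∃ h, P y h)
    (fun r => ⟨_, hpi r⟩) (fun y hy i h _ ih => ⟨_, hs y hy i h ih.2⟩) hy (Set.subset_univ _)
  exact h.2

theorem simpleReflection_simpleReflection (i : D.Node) (e : V × ℝ) :
    D.simpleReflection i (D.simpleReflection i e) = e := by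
  rw [← LinearEquiv.mul_apply, D.simpleReflection_mul_self]; rfl

theorem orderOf_simpleReflection_mul (i j : D.Node) :
    orderOf (D.simpleReflection i * D.simpleReflection j) =
      orderOf (D.simpleReflection j * D.simpleReflection i) := by
  rw [← orderOf_inv, mul_inv_rev, inv_eq_of_mul_eq_one_left (D.simpleReflection_mul_self i),
    inv_eq_of_mul_eq_one_left (D.simpleReflection_mul_self j)]

/-! ### The elements `T_w` -/

section Rep

variable {G : Type*} [Group G]

/-- The relations between the `T_i` and the `π_r` in the affine braid group. -/
structure IsAffineRep (T : D.Node → G) (p : D.orbitO → G) : Prop where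
  braid : ∀ i j, D.braidWord T i j = D.braidWord T j i
  mul : ∀ r s t, D.piElt r * D.piElt s = D.piElt t → p r * p s = p t
  conj : ∀ r i j, D.piElt r (D.simpleRoot i) = D.simpleRoot j → p r * T i * (p r)⁻¹ = T j

variable {D} {T : D.Node → G} {p : D.orbitO → G}

namespace IsAffineRep

theorem zero (hA : D.IsAffineRep T p) : p D.zeroO = 1 := by
  have := hA.mul D.zeroO D.zeroO D.zeroO (by rw [piElt_zeroO, one_mul])
  simpa using this

theorem pi_mul_T (hA : D.IsAffineRep T p) {r : D.orbitO} {i j : D.Node}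
    (h : D.piElt r (D.simpleRoot i) = D.simpleRoot j) : p r * T i = T j * p r := by
  rw [← hA.conj r i j h]; group

/-- Matsumoto's theorem enters here: the reduced word chosen in `extT` may be replaced by any other
one. -/
theorem extT_of_isRedWord (hA : D.IsAffineRep T p) (r : D.orbitO) {w : List D.Node}
    (hw : IsRedWord D.simpleReflection w) :
    D.extT T p (D.piElt r * (w.map D.simpleReflection).prod) = p r * (w.map T).prod := by
  have hmem : (w.map D.simpleReflection).prod ∈ D.affineWeyl := SignSystem.prod_mem_closure w
  rw [extT, D.piPart_mul r hmem, inv_mul_cancel_left]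
  obtain ⟨h1, h2⟩ := redWord_spec (s := D.simpleReflection) ⟨w, rfl⟩
  refine congrArg (p r * ·) (D.signSystem.matsumoto T (fun i j => (hA.braid i j).trans ?_) h2 hw h1)
  rw [braidWord, orderOf_simpleReflection_mul]

theorem extT_piElt (hA : D.IsAffineRep T p) (r : D.orbitO) : D.extT T p (D.piElt r) = p r := by
  have := hA.extT_of_isRedWord r (w := []) fun _ _ => Nat.zero_le _
  simpa using this

theorem extT_one (hA : D.IsAffineRep T p) : D.extT T p 1 = 1 := by
  rw [← D.piElt_zeroO, hA.extT_piElt, hA.zero]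

theorem extT_mul_of_pos (hA : D.IsAffineRep T p) {y : (V × ℝ) ≃ₗ[ℝ] (V × ℝ)} (hy : y ∈ D.extWeyl)
    {i : D.Node} (h : D.AffPos (y (D.simpleRoot i))) :
    D.extT T p (y * D.simpleReflection i) = D.extT T p y * T i := by
  obtain ⟨w, hw, hwy⟩ := D.signSystem.exists_isRedWord (D.piPart_spec hy)
  generalize D.piPart y = r at hwy
  have hwy' : y = D.piElt r * (w.map D.simpleReflection).prod := by
    rw [hwy, mul_inv_cancel_left]
  have hpos : D.AffPos ((w.map D.simpleReflection).prod (D.simpleRoot i)) := by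
    rw [hwy]
    exact (D.isLengthZero_piElt r).inv.affPos h
  have h1 := hA.extT_of_isRedWord r (D.signSystem.isRedWord_concat hw hpos)
  rw [hwy', hA.extT_of_isRedWord r hw, mul_assoc (p r), mul_assoc (D.piElt r)]
  simpa using h1

theorem extT_mul_of_neg (hA : D.IsAffineRep T p) {y : (V × ℝ) ≃ₗ[ℝ] (V × ℝ)} (hy : y ∈ D.extWeyl)
    {i : D.Node} (h : D.AffPos (-y (D.simpleRoot i))) :
    D.extT T p (y * D.simpleReflection i) = D.extT T p y * (T i)⁻¹ := by
  have h1 := hA.extT_mul_of_pos (mul_mem hy (D.simpleReflection_mem_extWeyl i)) (i := i)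
    (by rwa [LinearEquiv.mul_apply, simpleReflection_simpleRoot, map_neg])
  rw [mul_assoc, simpleReflection_mul_self, mul_one] at h1
  rw [h1, mul_inv_cancel_right]

/-- `π_r⁻¹ α_i = α_j` for some `j`. -/
theorem _root_.AffineData.exists_piElt_simpleRoot (D : AffineData R) (r : D.orbitO) (i : D.Node) :
    ∃ j, D.piElt r (D.simpleRoot j) = D.simpleRoot i := by
  obtain ⟨j, hj⟩ := (D.isLengthZero_piElt r).inv.exists_simpleRoot i
  exact ⟨j, by rw [← hj, ← LinearEquiv.mul_apply, mul_inv_cancel]; rfl⟩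

theorem extT_mul_piElt (hA : D.IsAffineRep T p) (r : D.orbitO) {y : (V × ℝ) ≃ₗ[ℝ] (V × ℝ)}
    (hy : y ∈ D.extWeyl) : D.extT T p (y * D.piElt r) = D.extT T p y * p r := by
  induction hy using D.ext_induction with
  | hpi s =>
    obtain ⟨t, ht⟩ := D.exists_piElt_mul s r
    rw [ht, hA.extT_piElt, hA.extT_piElt, hA.mul s r t ht]
  | hs y hy i h ih =>
    obtain ⟨j, hj⟩ := D.exists_piElt_simpleRoot r i
    rw [mul_assoc, ← D.mul_simpleReflection_of_eq (D.piElt_mem r) hj, ← mul_assoc,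
      hA.extT_mul_of_pos (mul_mem hy (D.piElt_mem r)) (by rwa [LinearEquiv.mul_apply, hj]), ih,
      hA.extT_mul_of_pos hy h, mul_assoc, mul_assoc, hA.pi_mul_T hj]

theorem extT_piElt_mul (hA : D.IsAffineRep T p) (r : D.orbitO) {y : (V × ℝ) ≃ₗ[ℝ] (V × ℝ)}
    (hy : y ∈ D.extWeyl) : D.extT T p (D.piElt r * y) = p r * D.extT T p y := by
  induction hy using D.ext_induction with
  | hpi s => rw [hA.extT_mul_piElt s (D.piElt_mem r), hA.extT_piElt, hA.extT_piElt]
  | hs y hy i h ih =>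
    rw [← mul_assoc, hA.extT_mul_of_pos (mul_mem (D.piElt_mem r) hy)
      ((D.isLengthZero_piElt r).affPos h), ih, hA.extT_mul_of_pos hy h, mul_assoc]

/-- Induction on a word of `y` from the right. For `y s_j` the two positivity conditions needed can
fail only if `y(α_j) = ±α_i`. The sign `-` contradicts `y(α_j) > 0`, and the sign `+` contradicts
the assumption on `(y s_j)⁻¹(α_i)`. -/
theorem extT_simpleReflection_mul (hA : D.IsAffineRep T p) {i : D.Node}
    {y : (V × ℝ) ≃ₗ[ℝ] (V × ℝ)} (hy : y ∈ D.extWeyl) (h : D.AffPos (y⁻¹ (D.simpleRoot i))) :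
    D.extT T p (D.simpleReflection i * y) = T i * D.extT T p y := by
  induction hy using D.ext_induction with
  | hpi r =>
    obtain ⟨j, hj⟩ := D.exists_piElt_simpleRoot r i
    rw [← D.mul_simpleReflection_of_eq (D.piElt_mem r) hj, hA.extT_mul_of_pos (D.piElt_mem r)
      (by rw [hj]; exact D.affPos_simpleRoot i), hA.extT_piElt, hA.pi_mul_T hj]
  | hs y hy j hj ih =>
    rw [mul_inv_rev, inv_eq_of_mul_eq_one_left (D.simpleReflection_mul_self j),
      LinearEquiv.mul_apply] at h
    have hyi : D.AffPos (y⁻¹ (D.simpleRoot i)) := by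
      have h2 := D.affPos_simpleReflection j _ h
      rw [simpleReflection_simpleReflection] at h2
      refine h2.resolve_left fun h3 => D.not_affPos_neg (D.affPos_simpleRoot i) ?_
      have h4 : y⁻¹ (D.simpleRoot i) = -D.simpleRoot j := by
        rw [← simpleReflection_simpleRoot, ← h3, simpleReflection_simpleReflection]
      have h5 : D.simpleRoot i = y (-D.simpleRoot j) := by
        rw [← h4, ← LinearEquiv.mul_apply, mul_inv_cancel]; rfl
      rwa [h5, map_neg, neg_neg]
    have hsy : D.AffPos ((D.simpleReflection i * y) (D.simpleRoot j)) := by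
      refine (D.affPos_simpleReflection i _ hj).resolve_left fun h3 => ?_
      rw [← h3, ← LinearEquiv.mul_apply y⁻¹, inv_mul_cancel] at h
      change D.AffPos (D.simpleReflection j (D.simpleRoot j)) at h
      rw [simpleReflection_simpleRoot] at h
      exact D.not_affPos_neg (D.affPos_simpleRoot j) h
    rw [← mul_assoc, hA.extT_mul_of_pos (mul_mem (D.simpleReflection_mem_extWeyl i) hy) hsy,
      ih hyi, hA.extT_mul_of_pos hy hj, mul_assoc]

theorem weylT_eq (hA : D.IsAffineRep T p) {w : (V × ℝ) ≃ₗ[ℝ] (V × ℝ)} (hw : w ∈ D.weyl) :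
    D.weylT T w = D.extT T p w := by
  obtain ⟨h1, h2⟩ := D.weylWord_spec hw
  have h3 := hA.extT_of_isRedWord D.zeroO (D.signSystem.isRedWord_map some h2)
  rw [piElt_zeroO, one_mul, hA.zero, one_mul, List.map_map, List.map_map] at h3
  rw [weylT]
  conv_rhs => rw [← h1]
  exact h3.symm

/-! ### The semi-infinite version of `T_w` -/

variable (T p) in
/-- The eventual value of `T_{nρ}⁻¹ T_{nρ x}` for `n → ∞`. -/
def _root_.AffineData.semiT (x : (V × ℝ) ≃ₗ[ℝ] (V × ℝ)) : G :=
  Classical.epsilon fun g => ∀ᶠ n : ℕ in Filter.atTop,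
    D.extT T p (D.translation (n • D.rho) * x) = D.extT T p (D.translation (n • D.rho)) * g

theorem _root_.AffineData.translation_nsmul_rho_mem (D : AffineData R) (n : ℕ) :
    D.translation (n • D.rho) ∈ D.extWeyl :=
  D.translation_mem (AddSubgroup.nsmul_mem _ D.rho_mem n)

theorem semiT_eq_of_eventually {x : (V × ℝ) ≃ₗ[ℝ] (V × ℝ)} {g : G}
    (h : ∀ᶠ n : ℕ in Filter.atTop, D.extT T p (D.translation (n • D.rho) * x) =
      D.extT T p (D.translation (n • D.rho)) * g) : D.semiT T p x = g := by
  have h1 := Classical.epsilon_spec (p := fun g => ∀ᶠ n : ℕ in Filter.atTop,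
    D.extT T p (D.translation (n • D.rho) * x) = D.extT T p (D.translation (n • D.rho)) * g) ⟨g, h⟩
  obtain ⟨n, hn, hn'⟩ := (h1.and h).exists
  exact mul_left_cancel (hn.symm.trans hn')

theorem eventually_semiT_mul_of_pos (hA : D.IsAffineRep T p) {x : (V × ℝ) ≃ₗ[ℝ] (V × ℝ)}
    (hx : x ∈ D.extWeyl) {g : G} {i : D.Node} (h : D.FinPos (x (D.simpleRoot i)))
    (hg : ∀ᶠ n : ℕ in Filter.atTop, D.extT T p (D.translation (n • D.rho) * x) =
      D.extT T p (D.translation (n • D.rho)) * g) :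
    ∀ᶠ n : ℕ in Filter.atTop,
      D.extT T p (D.translation (n • D.rho) * (x * D.simpleReflection i)) =
        D.extT T p (D.translation (n • D.rho)) * (g * (T i)⁻¹) := by
  filter_upwards [hg, D.eventually_affPos_neg (D.extWeyl_isAffineRoot hx
    (D.isAffineRoot_simpleRoot i)) h] with n hn hn'
  rw [← mul_assoc, hA.extT_mul_of_neg (mul_mem (D.translation_nsmul_rho_mem n) hx) hn', hn,
    mul_assoc]

theorem eventually_semiT_mul_of_neg (hA : D.IsAffineRep T p) {x : (V × ℝ) ≃ₗ[ℝ] (V × ℝ)}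
    (hx : x ∈ D.extWeyl) {g : G} {i : D.Node} (h : D.FinPos (-x (D.simpleRoot i)))
    (hg : ∀ᶠ n : ℕ in Filter.atTop, D.extT T p (D.translation (n • D.rho) * x) =
      D.extT T p (D.translation (n • D.rho)) * g) :
    ∀ᶠ n : ℕ in Filter.atTop,
      D.extT T p (D.translation (n • D.rho) * (x * D.simpleReflection i)) =
        D.extT T p (D.translation (n • D.rho)) * (g * T i) := by
  filter_upwards [hg, D.eventually_affPos (D.extWeyl_isAffineRoot hx
    (D.isAffineRoot_simpleRoot i)) h] with n hn hn'
  rw [← mul_assoc, hA.extT_mul_of_pos (mul_mem (D.translation_nsmul_rho_mem n) hx) hn', hn,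
    mul_assoc]

/-- For large `n` the sign of `nρ x(α_i)` depends only on the finite part of `x(α_i)`, so each
letter of a word for `x` contributes `T_i` or `T_i⁻¹` independently of `n`. -/
theorem eventually_semiT (hA : D.IsAffineRep T p) {x : (V × ℝ) ≃ₗ[ℝ] (V × ℝ)}
    (hx : x ∈ D.extWeyl) : ∀ᶠ n : ℕ in Filter.atTop,
      D.extT T p (D.translation (n • D.rho) * x) =
        D.extT T p (D.translation (n • D.rho)) * D.semiT T p x := by
  refine Classical.epsilon_spec (p := fun g => ∀ᶠ n : ℕ in Filter.atTop,
    D.extT T p (D.translation (n • D.rho) * x) = D.extT T p (D.translation (n • D.rho)) * g) ?_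
  induction hx using D.ext_induction with
  | hpi r => exact ⟨p r, Filter.Eventually.of_forall fun n =>
      hA.extT_mul_piElt r (D.translation_nsmul_rho_mem n)⟩
  | hs y hy i _ ih =>
    obtain ⟨g, hg⟩ := ih
    rcases (D.extWeyl_isAffineRoot hy (D.isAffineRoot_simpleRoot i)).finPos_or with h | h
    · exact ⟨_, hA.eventually_semiT_mul_of_pos hy h hg⟩
    · exact ⟨_, hA.eventually_semiT_mul_of_neg hy h hg⟩

theorem semiT_mul_of_pos (hA : D.IsAffineRep T p) {x : (V × ℝ) ≃ₗ[ℝ] (V × ℝ)}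
    (hx : x ∈ D.extWeyl) {i : D.Node} (h : D.FinPos (x (D.simpleRoot i))) :
    D.semiT T p (x * D.simpleReflection i) = D.semiT T p x * (T i)⁻¹ :=
  semiT_eq_of_eventually (hA.eventually_semiT_mul_of_pos hx h (hA.eventually_semiT hx))

theorem semiT_mul_of_neg (hA : D.IsAffineRep T p) {x : (V × ℝ) ≃ₗ[ℝ] (V × ℝ)}
    (hx : x ∈ D.extWeyl) {i : D.Node} (h : D.FinPos (-x (D.simpleRoot i))) :
    D.semiT T p (x * D.simpleReflection i) = D.semiT T p x * T i :=
  semiT_eq_of_eventually (hA.eventually_semiT_mul_of_neg hx h (hA.eventually_semiT hx))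

theorem semiT_one (_ : D.IsAffineRep T p) : D.semiT T p 1 = 1 :=
  semiT_eq_of_eventually (Filter.Eventually.of_forall fun n => by rw [mul_one, mul_one])

theorem semiT_mul_piElt (hA : D.IsAffineRep T p) (r : D.orbitO) {x : (V × ℝ) ≃ₗ[ℝ] (V × ℝ)}
    (hx : x ∈ D.extWeyl) : D.semiT T p (x * D.piElt r) = D.semiT T p x * p r := by
  refine semiT_eq_of_eventually ?_
  filter_upwards [hA.eventually_semiT hx] with n hn
  rw [← mul_assoc, hA.extT_mul_piElt r (mul_mem (D.translation_nsmul_rho_mem n) hx), hn, mul_assoc]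

theorem semiT_piElt (hA : D.IsAffineRep T p) (r : D.orbitO) :
    D.semiT T p (D.piElt r) = p r := by
  have := hA.semiT_mul_piElt r (one_mem _)
  rwa [hA.semiT_one, one_mul, one_mul] at this

/-- A translation does not change finite parts, so the letters of a word for `x` contribute the same
factors with or without `b` in front. -/
theorem semiT_translation_mul (hA : D.IsAffineRep T p) {b : V} (hb : b ∈ D.weights)
    {x : (V × ℝ) ≃ₗ[ℝ] (V × ℝ)} (hx : x ∈ D.extWeyl) :
    D.semiT T p (D.translation b * x) = D.semiT T p (D.translation b) * D.semiT T p x := by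
  have hb' := D.translation_mem hb
  induction hx using D.ext_induction with
  | hpi r => rw [hA.semiT_mul_piElt r hb', hA.semiT_piElt]
  | hs y hy i _ ih =>
    rw [← mul_assoc]
    have hfin : ∀ e : V × ℝ, D.FinPos (D.translation b e) ↔ D.FinPos e :=
      fun e => D.finPos_congr rfl
    rcases (D.extWeyl_isAffineRoot hy (D.isAffineRoot_simpleRoot i)).finPos_or with h | h
    · rw [hA.semiT_mul_of_pos (mul_mem hb' hy) ((hfin _).2 h), ih, hA.semiT_mul_of_pos hy h,
        mul_assoc]
    · rw [hA.semiT_mul_of_neg (mul_mem hb' hy)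
        (by rw [LinearEquiv.mul_apply, ← map_neg]; exact (hfin _).2 h), ih,
        hA.semiT_mul_of_neg hy h, mul_assoc]

/-- `f(x) = T_x` if no inversion of `x⁻¹` has a positive finite part. -/
theorem semiT_eq_extT (hA : D.IsAffineRep T p) {x : (V × ℝ) ≃ₗ[ℝ] (V × ℝ)} (hx : x ∈ D.extWeyl)
    (h : ∀ e ∈ D.inversions x⁻¹, D.FinPos (-e)) : D.semiT T p x = D.extT T p x := by
  refine D.ext_induction_of_subset (S := {e | D.FinPos (-e)})
    (P := fun x => D.semiT T p x = D.extT T p x) (fun r => ?_) (fun y hy i hi hS ih => ?_) hx h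
  · rw [hA.semiT_piElt, hA.extT_piElt]
  · rw [hA.semiT_mul_of_neg hy hS, hA.extT_mul_of_pos hy hi, ih]

/-- For dominant `b` the inverse translation does not lower the level of an affine root with
positive finite part, so all its inversions have negative finite part. -/
theorem semiT_translation_eq_extT (hA : D.IsAffineRep T p) {b : V} (hb : b ∈ D.weights)
    (h0 : ∀ β, D.base.IsPos β → 0 ≤ R.coroot' β b) :
    D.semiT T p (D.translation b) = D.extT T p (D.translation b) := by
  refine hA.semiT_eq_extT (D.translation_mem hb) ?_
  rintro _ ⟨⟨β, k, rfl, hk⟩, he⟩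
  rw [finPos_neg_mk]
  intro hβ
  obtain ⟨n, hn⟩ := D.exists_int_coroot' hb β
  have h1 : (D.translation b)⁻¹ (R.root β, D.halfNorm β * k) =
      (R.root β, D.halfNorm β * ((k + n : ℤ) : ℝ)) := by
    rw [← translation_neg, translation_apply, map_neg, D.form_comm, D.form_root, hn]
    push_cast
    congr 1
    ring
  have h2 := h0 β hβ
  rw [hn] at h2
  have h3 : 0 ≤ n := by exact_mod_cast h2
  rw [h1, affPos_neg_mk] at he
  rcases he with he | he
  · omega
  · exact he.2 hβ

/-- Along a reduced word of `w ∈ W` every root met is a positive finite one, so every letter enters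
inverted. -/
theorem semiT_weyl (hA : D.IsAffineRep T p) {w : (V × ℝ) ≃ₗ[ℝ] (V × ℝ)} (hw : w ∈ D.weyl) :
    D.semiT T p w = (D.weylT T w⁻¹)⁻¹ := by
  rw [hA.weylT_eq (inv_mem hw)]
  obtain ⟨u, hu, rfl⟩ := D.weylSystem.exists_isRedWord hw
  induction u using List.reverseRecOn with
  | nil => simp [hA.semiT_one, hA.extT_one]
  | append_singleton u i ih =>
    have hmem : (u.map fun i : D.Simple => D.simpleReflection (some i)).prod ∈ D.weyl :=
      SignSystem.prod_mem_closure u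
    have hpos := D.weylSystem.pos_of_isRedWord_concat hu
    have hfin : D.FinPos ((u.map fun i : D.Simple => D.simpleReflection (some i)).prod
        (D.simpleRoot (some i))) := by
      obtain ⟨γ, hγ⟩ := D.weyl_apply_root hmem i
      change D.AffPos ((u.map fun i : D.Simple => D.simpleReflection (some i)).prod
        (R.root i, 0)) at hpos
      change D.FinPos ((u.map fun i : D.Simple => D.simpleReflection (some i)).prod (R.root i, 0))
      rw [hγ, affPos_mk_zero] at hpos
      rwa [hγ, finPos_mk]
    rw [List.map_append, List.prod_append, List.map_singleton, List.prod_singleton,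
      hA.semiT_mul_of_pos (D.weyl_le_extWeyl hmem) hfin, ih hu.of_append_left hmem, mul_inv_rev,
      inv_eq_of_mul_eq_one_left (D.simpleReflection_mul_self _),
      hA.extT_simpleReflection_mul (inv_mem (D.weyl_le_extWeyl hmem)) (by rwa [inv_inv]),
      mul_inv_rev]

end IsAffineRep

end Rep

end AffineData

end

/-! ### The affine weight lattice and the exchange of `X` with `T`. -/

set_option linter.unusedSectionVars false

noncomputable section

namespace AffineData

variable {ι V N : Type*} [AddCommGroup V] [Module ℝ V] [AddCommGroup N] [Module ℝ N]
  {R : RootPairing ι ℝ V N} (D : AffineData R)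

variable [R.IsRootSystem]

/-! ### Powers of the central element -/

/-- The exponents `j` for which `2 m j` is an integer. -/
def qLattice : AddSubgroup ℝ where
  carrier := {j | ∃ n : ℤ, 2 * D.denom * j = n}
  add_mem' := by
    rintro a b ⟨m, hm⟩ ⟨n, hn⟩
    exact ⟨m + n, by push_cast; rw [← hm, ← hn]; ring⟩
  zero_mem' := ⟨0, by simp⟩
  neg_mem' := by
    rintro a ⟨m, hm⟩
    exact ⟨-m, by push_cast; rw [← hm]; ring⟩

theorem intCast_mem_qLattice (k : ℤ) : (k : ℝ) ∈ D.qLattice :=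
  ⟨2 * D.denom * k, by push_cast; ring⟩

theorem one_mem_qLattice : (1 : ℝ) ∈ D.qLattice := by simpa using D.intCast_mem_qLattice 1

theorem exists_denom_mul_form {a b : V} (ha : a ∈ D.weights) (hb : b ∈ D.weights) :
    ∃ n : ℤ, D.denom * D.form.form a b = n := by
  by_cases h : {k : ℕ | 0 < k ∧ ∀ b ∈ D.weights, ∀ c ∈ D.weights,
      ∃ z : ℤ, k * D.form.form b c = z}.Nonempty
  · exact (Nat.sInf_mem h).2 a ha b hb
  -- The infimum of the empty set of natural numbers is `0`, and then the product is `0`; existence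
  -- of a common denominator need not be proved.
  · refine ⟨0, ?_⟩
    have : D.denom = 0 := by rw [denom, Set.not_nonempty_iff_eq_empty.1 h, Nat.sInf_empty]
    simp [this]

theorem form_mem_qLattice {a b : V} (ha : a ∈ D.weights) (hb : b ∈ D.weights) :
    D.form.form a b ∈ D.qLattice := by
  obtain ⟨n, hn⟩ := D.exists_denom_mul_form ha hb
  exact ⟨2 * n, by push_cast; rw [← hn]; ring⟩

theorem half_form_mem_qLattice {a b : V} (ha : a ∈ D.weights) (hb : b ∈ D.weights) :
    D.form.form a b / 2 ∈ D.qLattice := by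
  obtain ⟨n, hn⟩ := D.exists_denom_mul_form ha hb
  exact ⟨n, by rw [← hn]; ring⟩

section QPow

variable {G : Type*} [Group G] (c : G)

theorem qpow_add {j : ℝ} (hj : j ∈ D.qLattice) (k : ℝ) :
    D.qpow c (j + k) = D.qpow c j * D.qpow c k := by
  obtain ⟨n, hn⟩ := hj
  rw [qpow, qpow, qpow, mul_add, hn, Int.floor_intCast_add, Int.floor_intCast, zpow_add]

theorem qpow_zero : D.qpow c 0 = 1 := by simp [qpow]

theorem qpow_neg {j : ℝ} (hj : j ∈ D.qLattice) : D.qpow c (-j) = (D.qpow c j)⁻¹ := by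
  rw [eq_inv_iff_mul_eq_one, ← D.qpow_add c (neg_mem hj), neg_add_cancel, qpow_zero]

theorem qpow_inv {j : ℝ} (hj : j ∈ D.qLattice) : D.qpow c⁻¹ j = D.qpow c (-j) := by
  rw [D.qpow_neg c hj, qpow, qpow, inv_zpow]

theorem map_qpow {H : Type*} [Group H] (φ : G →* H) (j : ℝ) :
    φ (D.qpow c j) = D.qpow (φ c) j := map_zpow φ _ _

variable {c} in
theorem qpow_commute {g : G} (h : c * g = g * c) (j : ℝ) :
    D.qpow c j * g = g * D.qpow c j :=
  (Commute.zpow_left (show Commute c g from h) _).eq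

end QPow

/-! ### The affine weight lattice -/

/-- The affine weights `[b, j]`, `b ∈ P`, with `2 m j` an integer. -/
def affLattice : AddSubgroup (V × ℝ) := D.weights.prod D.qLattice

theorem mk_zero_mem_affLattice {b : V} (hb : b ∈ D.weights) : (b, (0 : ℝ)) ∈ D.affLattice :=
  ⟨hb, zero_mem _⟩

section Lattice

variable {G : Type*} [Group G] (X : D.weights → G) (c : G)

open Classical in
/-- `X_{[b, j]} = X_b q^j`. -/
def affX (e : V × ℝ) : G := if h : e.1 ∈ D.weights then X ⟨e.1, h⟩ * D.qpow c e.2 else 1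

theorem affX_mk (b : D.weights) (j : ℝ) : D.affX X c ((b : V), j) = X b * D.qpow c j :=
  dif_pos b.2

theorem affX_mk_zero (b : D.weights) : D.affX X c ((b : V), 0) = X b := by
  rw [affX_mk, qpow_zero, mul_one]

end Lattice

variable [Finite ι] [R.IsCrystallographic] [R.IsReduced]

theorem simpleRoot_mem_affLattice (i : D.Node) : D.simpleRoot i ∈ D.affLattice := by
  cases i with
  | none => exact ⟨D.weights.neg_mem (D.root_mem_weights _), D.one_mem_qLattice⟩
  | some i => exact ⟨D.root_mem_weights _, zero_mem _⟩

theorem coe_simpleWeight (i : D.Node) : (D.simpleWeight i : V) = (D.simpleRoot i).1 := by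
  cases i <;> rfl

theorem extWeyl_mem_affLattice {y : (V × ℝ) ≃ₗ[ℝ] (V × ℝ)} (hy : y ∈ D.extWeyl) {e : V × ℝ}
    (he : e ∈ D.affLattice) : y e ∈ D.affLattice := by
  refine ⟨D.extWeyl_mem_weights hy he.1, ?_⟩
  obtain ⟨g, hg, b, hb, h⟩ := D.exists_of_mem_extWeyl hy
  rw [h]
  exact D.qLattice.sub_mem he.2 (D.form_mem_qLattice (hg.weights _ he.1) hb)

section LatticeRep

variable {G : Type*} [Group G]

/-- The relations between `X_b`, `T_i`, `π_r` and `q` (except those without `X_b`). -/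
structure IsLatticeRep (X : D.weights → G) (T : D.Node → G) (p : D.orbitO → G) (c : G) : Prop where
  centralT : ∀ i, c * T i = T i * c
  centralPi : ∀ r, c * p r = p r * c
  rel : ∀ a b, D.LatticeRel X T p c a b → a = b

variable {D} {X : D.weights → G} {T : D.Node → G} {p : D.orbitO → G} {c : G}

namespace IsLatticeRep

theorem add (hX : D.IsLatticeRep X T p c) (a b : D.weights) : X (a + b) = X a * X b :=
  hX.rel _ _ (.add a b)

theorem comm (hX : D.IsLatticeRep X T p c) (a b : D.weights) : X a * X b = X b * X a := by
  rw [← hX.add, ← hX.add, add_comm]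

theorem zero (hX : D.IsLatticeRep X T p c) : X 0 = 1 := by
  simpa using hX.add 0 0

theorem neg (hX : D.IsLatticeRep X T p c) (a : D.weights) : X (-a) = (X a)⁻¹ := by
  rw [eq_inv_iff_mul_eq_one, ← hX.add, neg_add_cancel, hX.zero]

theorem centralX (hX : D.IsLatticeRep X T p c) (a : D.weights) : c * X a = X a * c :=
  hX.rel _ _ (.central a)

theorem affX_add (hX : D.IsLatticeRep X T p c) {e e' : V × ℝ} (he : e ∈ D.affLattice)
    (he' : e' ∈ D.affLattice) : D.affX X c (e + e') = D.affX X c e * D.affX X c e' := by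
  obtain ⟨b, j⟩ := e
  obtain ⟨b', j'⟩ := e'
  lift b to D.weights using he.1
  lift b' to D.weights using he'.1
  rw [Prod.mk_add_mk, ← AddSubgroup.coe_add, affX_mk, affX_mk, affX_mk, hX.add,
    D.qpow_add c he.2, mul_assoc, mul_assoc, ← mul_assoc (D.qpow c j),
    D.qpow_commute (hX.centralX b'), mul_assoc]

theorem affX_zero (hX : D.IsLatticeRep X T p c) : D.affX X c 0 = 1 := by
  have := D.affX_mk_zero X c 0
  rwa [hX.zero] at this

theorem affX_neg (hX : D.IsLatticeRep X T p c) {e : V × ℝ} (he : e ∈ D.affLattice) :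
    D.affX X c (-e) = (D.affX X c e)⁻¹ := by
  rw [eq_inv_iff_mul_eq_one, ← hX.affX_add (neg_mem he) he, neg_add_cancel, hX.affX_zero]

theorem affX_comm (hX : D.IsLatticeRep X T p c) {e e' : V × ℝ} (he : e ∈ D.affLattice)
    (he' : e' ∈ D.affLattice) :
    D.affX X c e * D.affX X c e' = D.affX X c e' * D.affX X c e := by
  rw [← hX.affX_add he he', add_comm, hX.affX_add he' he]

theorem affX_simpleRoot (_ : D.IsLatticeRep X T p c) (i : D.Node) :
    D.affX X c (D.simpleRoot i) = X (D.simpleWeight i) * D.qpow c (D.simpleRoot i).2 := by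
  rw [← affX_mk, coe_simpleWeight]

/-- `T_i X_e T_i = X_{s_i(e)}` if `(e, α_i^∨) = 1`. -/
theorem T_affX_T (hX : D.IsLatticeRep X T p c) {i : D.Node} {e : V × ℝ} (he : e ∈ D.affLattice)
    (h : D.corootForm i e.1 = 1) : T i * D.affX X c e * T i = D.affX X c (D.simpleReflection i e) := by
  rw [simpleReflection_apply, h, one_smul, sub_eq_add_neg,
    hX.affX_add he (neg_mem (D.simpleRoot_mem_affLattice i)),
    hX.affX_neg (D.simpleRoot_mem_affLattice i), hX.affX_simpleRoot]
  obtain ⟨b, j⟩ := e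
  lift b to D.weights using he.1
  have h1 := hX.rel _ _ (.cross i b h)
  have h2 := D.qpow_commute (hX.centralT i) j
  have h3 : D.qpow c j * (X (D.simpleWeight i) * D.qpow c (D.simpleRoot i).2)⁻¹ =
      (X (D.simpleWeight i) * D.qpow c (D.simpleRoot i).2)⁻¹ * D.qpow c j :=
    D.qpow_commute (((show Commute c _ from hX.centralX _).mul_right
      ((Commute.refl c).zpow_right _)).inv_right).eq j
  rw [affX_mk, mul_assoc (X b), h3, ← mul_assoc (X b), ← h1, mul_assoc (_ * _), ← h2]
  simp only [mul_assoc]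

theorem T_affX (hX : D.IsLatticeRep X T p c) {i : D.Node} {e : V × ℝ} (he : e ∈ D.affLattice)
    (h : D.corootForm i e.1 = 0) : T i * D.affX X c e = D.affX X c e * T i := by
  obtain ⟨b, j⟩ := e
  lift b to D.weights using he.1
  rw [affX_mk, ← mul_assoc, hX.rel _ _ (.comm i b h), mul_assoc, mul_assoc,
    D.qpow_commute (hX.centralT i)]

theorem inv_T_affX_inv_T (hX : D.IsLatticeRep X T p c) {i : D.Node} {e : V × ℝ}
    (he : e ∈ D.affLattice) (h : D.corootForm i e.1 = -1) :
    (T i)⁻¹ * D.affX X c e * (T i)⁻¹ = D.affX X c (D.simpleReflection i e) := by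
  have h1 := hX.T_affX_T (i := i)
    (D.extWeyl_mem_affLattice (D.simpleReflection_mem_extWeyl i) he) (by
    have h2 := D.corootForm_simpleRoot i
    rw [LinearMap.comp_apply, LinearMap.fst_apply] at h2
    rw [simpleReflection_apply, Prod.fst_sub, Prod.smul_fst, map_sub, map_smul, h, h2]
    norm_num)
  have h3 : D.simpleReflection i (D.simpleReflection i e) = e := by
    rw [← LinearEquiv.mul_apply, D.simpleReflection_mul_self]; rfl
  rw [h3] at h1
  rw [← h1]
  group

theorem p_affX (hX : D.IsLatticeRep X T p c) (r : D.orbitO) {e : V × ℝ}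
    (he : e ∈ D.affLattice) : p r * D.affX X c e = D.affX X c (D.piElt r e) * p r := by
  obtain ⟨b, j⟩ := e
  lift b to D.weights using he.1
  have h1 : D.piElt r ((b : V), j) = D.piElt r ((b : V), 0) + (0, j) := by
    obtain ⟨g, -, b', -, h⟩ := D.exists_of_mem_extWeyl (D.piElt_mem r)
    rw [h, h]
    ext <;> simp
    ring
  have hm := D.extWeyl_mem_affLattice (D.piElt_mem r) (D.mk_zero_mem_affLattice b.2)
  have hm' : ((0 : V), j) ∈ D.affLattice := ⟨zero_mem _, he.2⟩
  rw [h1, hX.affX_add hm hm']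
  generalize he' : D.piElt r ((b : V), (0 : ℝ)) = e' at hm
  obtain ⟨b', j'⟩ := e'
  lift b' to D.weights using hm.1
  have h2 := hX.rel _ _ (.pi r b b' j' he')
  have h3 : D.affX X c ((0 : V), j) = D.qpow c j := by
    have := D.affX_mk X c 0 j
    rwa [hX.zero, one_mul] at this
  rw [h3, affX_mk, affX_mk, ← h2, mul_assoc _ (D.qpow c j), D.qpow_commute (hX.centralPi r)]
  group

/-- The exchange of a finite Weyl group element with a weight, which contains both the
presentation of the `Y_b` and the dual relations. -/
theorem affX_mul_semiT (hX : D.IsLatticeRep X T p c) (hA : D.IsAffineRep T p)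
    {v : (V × ℝ) ≃ₗ[ℝ] (V × ℝ)} (hv : v ∈ D.weyl) (z : D.weights) {S : Set V}
    (hS : ∀ β γ, R.root β ∈ S → v (R.root β, 0) = (R.root γ, 0) →
      R.coroot' β z = 0 ∧ (D.base.IsPos γ ↔ D.base.IsPos β) ∨
      R.coroot' β z = 1 ∧ D.base.IsPos β ∧ ¬ D.base.IsPos γ ∨
      R.coroot' β z = -1 ∧ ¬ D.base.IsPos β ∧ D.base.IsPos γ)
    {x : (V × ℝ) ≃ₗ[ℝ] (V × ℝ)} (hx : x ∈ D.extWeyl) (hxS : ∀ e ∈ D.inversions x⁻¹, e.1 ∈ S) :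
    X z * D.weylT T v⁻¹ * D.semiT T p (v * x) =
      D.semiT T p x * D.affX X c (x⁻¹ ((z : V), 0)) := by
  have hv' := D.weyl_le_extWeyl hv
  have hz := D.mk_zero_mem_affLattice z.2
  refine D.ext_induction_of_subset (S := {e | e.1 ∈ S})
    (P := fun x => X z * D.weylT T v⁻¹ * D.semiT T p (v * x) =
      D.semiT T p x * D.affX X c (x⁻¹ ((z : V), 0))) (fun r => ?_)
    (fun y hy i hi hyS ih => ?_) hx hxS
  · rw [hA.semiT_mul_piElt r hv', hA.semiT_weyl hv, hA.semiT_piElt,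
      hX.p_affX r (D.extWeyl_mem_affLattice (inv_mem (D.piElt_mem r)) hz),
      ← LinearEquiv.mul_apply, mul_inv_cancel]
    rw [LinearEquiv.coe_one, id, affX_mk_zero]
    group
  · have hyz := D.extWeyl_mem_affLattice (inv_mem hy) hz
    obtain ⟨β, k, hβ⟩ := D.extWeyl_isAffineRoot hy (D.isAffineRoot_simpleRoot i)
    -- `β` is the finite part of `y(α_i)`, and `y` acts on finite parts by an isometry.
    have hcor : D.corootForm i (y⁻¹ ((z : V), 0)).1 = R.coroot' β z := by
      have h1 := D.form_simpleRoot (y⁻¹ ((z : V), 0)).1 i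
      rw [← D.form_extWeyl hy, ← D.form_extWeyl hy (D.simpleRoot i), hβ, ← LinearEquiv.mul_apply,
        mul_inv_cancel] at h1
      have h5 : D.form.form (R.root β) (R.root β) = 2 * D.halfNorm β := by rw [halfNorm]; ring
      simp only [LinearEquiv.coe_one, id, h5, D.form_root] at h1
      have := D.halfNorm_pos β
      have h2 : D.halfNorm β * (D.corootForm i (y⁻¹ ((z : V), 0)).1 - R.coroot' β z) = 0 := by
        linarith
      rcases mul_eq_zero.1 h2 with h | h
      · exact absurd h this.ne'
      · linarith
    obtain ⟨γ, hγ⟩ := D.weyl_apply_root hv β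
    have hvy : (v * y) (D.simpleRoot i) = (R.root γ, D.halfNorm β * k) := by
      obtain ⟨g, -, hg⟩ := D.exists_of_mem_weyl hv
      rw [hg, prodOne_apply] at hγ
      have hγ' : g (R.root β) = R.root γ := congrArg Prod.fst hγ
      rw [LinearEquiv.mul_apply, hβ, hg, prodOne_apply, hγ']
    have hβS : R.root β ∈ S := by
      have : (y (D.simpleRoot i)).1 ∈ S := hyS
      rwa [hβ] at this
    have hinv : (y * D.simpleReflection i)⁻¹ ((z : V), (0 : ℝ)) =
        D.simpleReflection i (y⁻¹ ((z : V), 0)) := by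
      rw [mul_inv_rev, inv_eq_of_mul_eq_one_left (D.simpleReflection_mul_self i),
        LinearEquiv.mul_apply]
    rw [hinv, ← mul_assoc]
    have hpos : ∀ {β : ι} {t : ℝ} {u : (V × ℝ) ≃ₗ[ℝ] (V × ℝ)}, u ∈ D.extWeyl →
        u (D.simpleRoot i) = (R.root β, t) → D.base.IsPos β →
        D.semiT T p (u * D.simpleReflection i) = D.semiT T p u * (T i)⁻¹ :=
      fun hu h h' => hA.semiT_mul_of_pos hu (by rw [h, finPos_mk]; exact h')
    have hneg : ∀ {β : ι} {t : ℝ} {u : (V × ℝ) ≃ₗ[ℝ] (V × ℝ)}, u ∈ D.extWeyl →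
        u (D.simpleRoot i) = (R.root β, t) → ¬ D.base.IsPos β →
        D.semiT T p (u * D.simpleReflection i) = D.semiT T p u * T i :=
      fun hu h h' => hA.semiT_mul_of_neg hu (by rw [h, finPos_neg_mk]; exact h')
    -- Appending `s_i` adds a factor `T_i^{±1}` on each side: `t` is governed by the sign of `β`,
    -- `t'` by that of `v(β) = γ`. The three cases of `hS` are those in which the factors match one
    -- of `T X = X T`, `T X_e T = X_{s_i(e)}`, `T⁻¹ X_e T⁻¹ = X_{s_i(e)}`.
    suffices h : ∃ t t', D.semiT T p (v * y * D.simpleReflection i) = D.semiT T p (v * y) * t' ∧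
        D.semiT T p (y * D.simpleReflection i) = D.semiT T p y * t ∧
        D.affX X c (y⁻¹ ((z : V), 0)) * t' =
          t * D.affX X c (D.simpleReflection i (y⁻¹ ((z : V), 0))) by
      obtain ⟨t, t', h1, h2, h3⟩ := h
      rw [h1, h2, ← mul_assoc, ih, mul_assoc, h3, mul_assoc]
    have hvy' := mul_mem hv' hy
    rcases hS β γ hβS hγ with ⟨h0, h⟩ | ⟨h1, h2, h3⟩ | ⟨h1, h2, h3⟩
    · have hfix : D.simpleReflection i (y⁻¹ ((z : V), 0)) = y⁻¹ ((z : V), 0) := by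
        rw [simpleReflection_apply, hcor, h0, zero_smul, sub_zero]
      have hc : Commute (T i) (D.affX X c (y⁻¹ ((z : V), 0))) :=
        hX.T_affX hyz (hcor.trans h0)
      rw [hfix]
      by_cases hp : D.base.IsPos β
      · exact ⟨_, _, hpos hvy' hvy (h.2 hp), hpos hy hβ hp, hc.inv_left.eq.symm⟩
      · exact ⟨_, _, hneg hvy' hvy (mt h.1 hp), hneg hy hβ hp, hc.eq.symm⟩
    · refine ⟨_, _, hneg hvy' hvy h3, hpos hy hβ h2, ?_⟩
      rw [← hX.T_affX_T hyz (hcor.trans h1)]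
      group
    · refine ⟨_, _, hpos hvy' hvy h3, hneg hy hβ h2, ?_⟩
      rw [← hX.inv_T_affX_inv_T hyz (hcor.trans h1)]
      group

end IsLatticeRep

end LatticeRep

end AffineData

end

/-! ### The commuting elements `Y_b` and their relations. -/

set_option linter.unusedSectionVars false

noncomputable section

namespace AffineData

variable {ι V N : Type*} [AddCommGroup V] [Module ℝ V] [AddCommGroup N] [Module ℝ N]
  {R : RootPairing ι ℝ V N} (D : AffineData R)

variable [R.IsRootSystem] [Finite ι] [R.IsCrystallographic] [R.IsReduced]

/-! ### The inversions of translations -/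

/-- The translation fixes affine roots whose finite part is orthogonal to `b`, so these are not
inversions. This and the next lemma check the hypothesis of the exchange identity. -/
theorem inversions_translation {δ : ι} {b : V} (h : R.coroot' δ b = 0) :
    ∀ e ∈ D.inversions (D.translation b)⁻¹, e.1 ≠ R.root δ ∧ e.1 ≠ -R.root δ := by
  rintro e ⟨he, he'⟩
  have hfix : D.form.form e.1 b = 0 → False := fun h0 => by
    have : (D.translation b)⁻¹ e = e := by
      rw [← translation_neg, translation_apply, map_neg, h0]
      simp
    rw [this] at he'
    exact D.not_affPos_neg he he'
  have h1 : D.form.form (R.root δ) b = 0 := by rw [D.form_comm, D.form_root, h, mul_zero]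
  refine ⟨fun h2 => hfix (by rw [h2, h1]), fun h2 => hfix (by rw [h2, map_neg]; simp [h1])⟩

/-- The inverse sends `δ` at level `k` to `-δ` at level `k + 1`, and `-δ` at level `k` to `δ` at
level `k - 1`. A positive root of the second kind has `k ≥ 1`, so neither becomes negative. -/
theorem inversions_translation_mul_reflection {δ : ι} (hδ : D.base.IsPos δ) {b : V}
    (h : R.coroot' δ b = 1) :
    ∀ e ∈ D.inversions (D.translation b * prodOne (R.reflection δ))⁻¹,
      e.1 ≠ R.root δ ∧ e.1 ≠ -R.root δ := by
  have h1 : D.form.form (R.root δ) b = D.halfNorm δ := by rw [D.form_comm, D.form_root, h, mul_one]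
  have hr : (prodOne (R.reflection δ))⁻¹ = prodOne (R.reflection δ) := by
    refine inv_eq_of_mul_eq_one_left ?_
    apply LinearEquiv.ext
    intro z
    simp [prodOne_apply]
  rintro _ ⟨⟨β, k, rfl, hk⟩, he'⟩
  rw [mul_inv_rev, hr, ← translation_neg, LinearEquiv.mul_apply, translation_apply,
    prodOne_apply] at he'
  constructor
  · rintro (h2 : R.root β = R.root δ)
    obtain rfl := R.root.injective h2
    have : (R.reflection β (R.root β), D.halfNorm β * k - D.form.form (R.root β) (-b)) =
        -(R.root β, D.halfNorm β * ((-(k + 1) : ℤ) : ℝ)) := by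
      rw [map_neg, h1, RootPairing.reflection_apply_self, Prod.neg_mk]
      push_cast
      congr 1
      ring
    simp only [this, neg_neg] at he'
    rw [affPos_mk] at he'
    omega
  · rintro (h2 : R.root β = -R.root δ)
    have h3 : β = R.reflectionPerm δ δ := R.root.injective (by rw [h2]; simp)
    have h4 : D.halfNorm β = D.halfNorm δ := by rw [h3, halfNorm_reflectionPerm]
    have hβ : ¬ D.base.IsPos β := by rw [h3, isPos_reflectionPerm_self]; exact not_not.2 hδ
    have : (R.reflection δ (R.root β), D.halfNorm β * k - D.form.form (R.root β) (-b)) =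
        (R.root δ, D.halfNorm δ * ((k - 1 : ℤ) : ℝ)) := by
      rw [map_neg, h2, map_neg, map_neg, LinearMap.neg_apply, h1,
        RootPairing.reflection_apply_self, h4]
      push_cast
      rw [neg_neg]
      congr 1
      ring
    simp only [this] at he'
    rw [affPos_neg_mk] at he'
    have h5 : 0 < k := hk.resolve_right fun h => hβ h.2
    rcases he' with he' | he'
    · omega
    · exact he'.2 hδ

section Rep

variable {G : Type*} [Group G]

/-- The elements `Y_b`, defined as semi-infinite `T_b`. -/
def semiY (T : D.Node → G) (p : D.orbitO → G) (b : D.weights) : G :=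
  D.semiT T p (D.translation b)

variable {D} {X : D.weights → G} {T : D.Node → G} {p : D.orbitO → G} {c : G}

namespace IsAffineRep

theorem semiY_add (hA : D.IsAffineRep T p) (a b : D.weights) :
    D.semiY T p (a + b) = D.semiY T p a * D.semiY T p b := by
  rw [semiY, AddSubgroup.coe_add, translation_add,
    hA.semiT_translation_mul a.2 (D.translation_mem b.2)]
  rfl

theorem semiY_zero (hA : D.IsAffineRep T p) : D.semiY T p 0 = 1 := by
  simpa using hA.semiY_add 0 0

theorem semiY_neg (hA : D.IsAffineRep T p) (a : D.weights) :
    D.semiY T p (-a) = (D.semiY T p a)⁻¹ := by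
  rw [eq_inv_iff_mul_eq_one, ← hA.semiY_add, neg_add_cancel, hA.semiY_zero]

theorem semiT_translation_mul_weyl (hA : D.IsAffineRep T p) (b : D.weights)
    {w : (V × ℝ) ≃ₗ[ℝ] (V × ℝ)} (hw : w ∈ D.weyl) :
    D.semiT T p (D.translation b * w) = D.semiY T p b * (D.weylT T w⁻¹)⁻¹ := by
  rw [hA.semiT_translation_mul b.2 (D.weyl_le_extWeyl hw), hA.semiT_weyl hw]
  rfl

/-- Both sides are multiplicative in `b` and agree at the fundamental weights, which are dominant.
Multiplicativity of the right side makes the order of the factors irrelevant. -/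
theorem prodY_eq (hA : D.IsAffineRep T p) (b : D.weights) : D.prodY T p b = D.semiY T p b := by
  let φ : Multiplicative D.weights →* G :=
    { toFun := fun b => D.semiY T p b.toAdd
      map_one' := hA.semiY_zero
      map_mul' := fun a b => hA.semiY_add _ _ }
  have hb : b = ∑ i : D.Simple, ⌊R.coroot' i (b : V)⌋ • D.fundWeight (some i) := by
    apply Subtype.ext
    conv_lhs => rw [D.eq_sum_omega b]
    rw [AddSubgroup.val_finsetSum]
    refine Finset.sum_congr rfl fun i _ => ?_
    obtain ⟨n, hn⟩ := D.exists_int_coroot' b.2 i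
    rw [hn, Int.floor_intCast, AddSubgroup.coe_zsmul, Int.cast_smul_eq_zsmul]
    rfl
  have h1 : ∀ i : D.Simple, D.extT T p (D.translation (D.omega (some i))) =
      φ (Multiplicative.ofAdd (D.fundWeight (some i))) := fun i =>
    (hA.semiT_translation_eq_extT (D.omega_mem _) fun β hβ => D.coroot'_omega_nonneg _ hβ).symm
  conv_rhs => rw [hb]
  change _ = φ (Multiplicative.ofAdd (∑ i : D.Simple, ⌊R.coroot' i (b : V)⌋ • D.fundWeight (some i)))
  rw [prodY, ← Finset.sum_map_toList, ofAdd_list_prod, map_list_prod, List.map_map, List.map_map]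
  congr 1
  refine List.map_congr_left fun i _ => ?_
  rw [h1, ← map_zpow, ← ofAdd_zsmul]
  rfl

/-- `ϑ` is dominant, translation by it is `s_0 s_ϑ`, and lengths add because `s_ϑ(α₀) = [ϑ, 1]` is
positive. -/
theorem semiY_theta (hA : D.IsAffineRep T p) :
    D.semiY T p D.thetaWeight = T none * D.weylT T D.thetaReflection := by
  have h1 : D.semiY T p D.thetaWeight = D.extT T p (D.translation (R.root D.theta)) :=
    hA.semiT_translation_eq_extT (D.root_mem_weights _) fun β hβ => by
      change 0 ≤ R.coroot' β (R.root D.theta)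
      rw [RootPairing.root_coroot'_eq_pairing]
      exact D.pairing_theta_left_nonneg hβ
  rw [h1, translation_theta, hA.weylT_eq D.thetaReflection_mem]
  refine hA.extT_simpleReflection_mul (D.weyl_le_extWeyl D.thetaReflection_mem) ?_
  rw [inv_eq_of_mul_eq_one_left D.thetaReflection_mul_self, thetaReflection_eq, prodOne_apply]
  have : (R.reflection D.theta (D.simpleRoot none).1, (D.simpleRoot none).2) =
      (R.root D.theta, D.halfNorm D.theta * ((1 : ℤ) : ℝ)) := by
    simp [simpleRoot, halfNorm_theta]
  rw [this, affPos_mk]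
  exact Or.inl one_pos

/-- The translation `ω_r` equals `π_r u_r`, and `π_r` has length zero. -/
theorem semiY_fundWeight (hA : D.IsAffineRep T p) (r : D.orbitO) :
    D.semiY T p (D.fundWeight r) = p r * D.weylT T (D.u r) := by
  have h1 : D.semiY T p (D.fundWeight r) = D.extT T p (D.translation (D.omega r)) :=
    hA.semiT_translation_eq_extT (D.omega_mem _) fun β hβ => D.coroot'_omega_nonneg _ hβ
  have h2 : D.translation (D.omega r) = D.piElt r * D.u r := by
    rw [piElt, inv_mul_cancel_right]
  rw [h1, h2, hA.extT_piElt_mul r (D.weyl_le_extWeyl (D.u_mem r)), hA.weylT_eq (D.u_mem r)]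

end IsAffineRep

namespace IsLatticeRep

/-- The exchange identity for `v = s_i`, `z = 0`: the reflection changes the sign of `±α_i` only,
and these are excluded. -/
theorem simple_exchange (hX : D.IsLatticeRep X T p c) (hA : D.IsAffineRep T p) (i : D.Simple)
    {x : (V × ℝ) ≃ₗ[ℝ] (V × ℝ)} (hx : x ∈ D.extWeyl)
    (hxS : ∀ e ∈ D.inversions x⁻¹, e.1 ≠ R.root i ∧ e.1 ≠ -R.root i) :
    T (some i) * D.semiT T p (D.simpleReflection (some i) * x) = D.semiT T p x := by
  have hs : D.simpleReflection (some i) ∈ D.weyl := Subgroup.subset_closure ⟨i, rfl⟩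
  have key : ∀ {β γ : ι}, R.root β ≠ R.root i →
      D.simpleReflection (some i) (R.root β, 0) = (R.root γ, 0) → D.base.IsPos β →
      D.base.IsPos γ := by
    intro β γ hβ hγ hp
    have h := D.affPos_simpleReflection (some i) _ (D.affPos_mk_zero.2 hp)
    rw [hγ, affPos_mk_zero] at h
    exact h.resolve_left fun h' => hβ (congrArg Prod.fst h')
  have h := hX.affX_mul_semiT hA hs 0 (S := {v | v ≠ R.root i ∧ v ≠ -R.root i})
    (fun β γ hβ hγ => Or.inl ⟨by simp, ⟨fun hp => ?_, key hβ.1 hγ⟩⟩) hx hxS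
  · have hT : D.weylT T (D.simpleReflection (some i)) = T (some i) := by
      have h1 := hA.extT_mul_of_pos (one_mem _) (i := some i) (D.affPos_simpleRoot (some i))
      rw [hA.weylT_eq hs]
      rwa [one_mul, hA.extT_one, one_mul] at h1
    rw [hX.zero, one_mul, inv_eq_of_mul_eq_one_left (D.simpleReflection_mul_self _), hT] at h
    rw [h]
    have : ((((0 : D.weights) : V), (0 : ℝ))) = (0 : V × ℝ) := rfl
    rw [this, map_zero, hX.affX_zero, mul_one]
  · refine key (β := γ) (γ := β) (fun h' => hβ.2 ?_)
      (by rw [← hγ, simpleReflection_simpleReflection]) hp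
    have h2 : D.simpleReflection (some i) (R.root γ, 0) = (R.root β, 0) := by
      rw [← hγ, simpleReflection_simpleReflection]
    rw [h'] at h2
    have h3 := D.simpleReflection_simpleRoot (some i)
    have h4 : (R.root β, (0 : ℝ)) = -D.simpleRoot (some i) := by rw [← h2, ← h3]; rfl
    exact congrArg Prod.fst h4

theorem T_semiY (hX : D.IsLatticeRep X T p c) (hA : D.IsAffineRep T p) (i : D.Simple)
    (b : D.weights) (h : R.coroot' i (b : V) = 0) :
    T (some i) * D.semiY T p b = D.semiY T p b * T (some i) := by
  have hs : D.simpleReflection (some i) ∈ D.weyl := Subgroup.subset_closure ⟨i, rfl⟩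
  have h1 := hX.simple_exchange hA i (D.translation_mem b.2) (D.inversions_translation h)
  have h2 : (D.simpleReflection (some i) ((b : V), 0)).1 = b := by
    rw [simpleReflection_apply]
    simp [corootForm, h]
  rw [D.weyl_mul_translation hs, h2, hA.semiT_mul_of_pos (i := some i) (D.translation_mem b.2)
    ((D.finPos_congr rfl).2 (D.finPos_simpleRoot i))] at h1
  change T (some i) * (D.semiY T p b * (T (some i))⁻¹) = D.semiY T p b at h1
  rw [← mul_assoc, mul_inv_eq_iff_eq_mul] at h1
  exact h1

/-- `simple_exchange` at `x = b s_i`, where `s_i x` is the translation by `b - α_i`; the case `(b,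
α_i^∨) = 0` uses `x = b`. -/
theorem inv_T_semiY_inv_T (hX : D.IsLatticeRep X T p c) (hA : D.IsAffineRep T p) (i : D.Simple)
    (b : D.weights) (h : R.coroot' i (b : V) = 1) :
    (T (some i))⁻¹ * D.semiY T p b * (T (some i))⁻¹ =
      D.semiY T p b * (D.semiY T p (D.simpleWeight (some i)))⁻¹ := by
  have hs : D.simpleReflection (some i) ∈ D.weyl := Subgroup.subset_closure ⟨i, rfl⟩
  have hpos : D.base.IsPos i := D.finPos_mk.1 (D.finPos_simpleRoot i)
  have hbs := mul_mem (D.translation_mem b.2) (D.simpleReflection_mem_extWeyl (some i))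
  have h1 := hX.simple_exchange hA i hbs (by
    rw [simpleReflection_some]; exact D.inversions_translation_mul_reflection hpos h)
  have h2 : (D.simpleReflection (some i) ((b : V), 0)).1 =
      ((b - D.simpleWeight (some i) : D.weights) : V) := by
    rw [simpleReflection_apply]
    simp [corootForm, h, simpleRoot, simpleWeight]
  rw [← mul_assoc, D.weyl_mul_translation hs, mul_assoc, simpleReflection_mul_self, mul_one, h2,
    hA.semiT_mul_of_pos (i := some i) (D.translation_mem b.2)
    ((D.finPos_congr rfl).2 (D.finPos_simpleRoot i))] at h1
  change T (some i) * D.semiY T p (b - D.simpleWeight (some i)) =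
    D.semiY T p b * (T (some i))⁻¹ at h1
  rw [sub_eq_add_neg, hA.semiY_add, hA.semiY_neg] at h1
  rw [mul_assoc, ← h1, inv_mul_cancel_left]

theorem central_weylT (hX : D.IsLatticeRep X T p c) (w : (V × ℝ) ≃ₗ[ℝ] (V × ℝ)) :
    c * D.weylT T w = D.weylT T w * c := by
  rw [weylT]
  induction D.weylWord w with
  | nil => simp
  | cons i l ih =>
    rw [List.map_cons, List.prod_cons, ← mul_assoc, hX.centralT, mul_assoc, ih, mul_assoc]

/-! ### The dual relations -/

/-- The exchange identity for `v = s_ϑ`, `z = ϑ`. Away from `±ϑ` the number `(ϑ, β^∨)` is `0` or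
`±1`. It is nonzero exactly when `s_ϑ` changes the sign of `β`, since `s_ϑ` negates `(β, ϑ^∨)` and
this number is non-negative on positive roots. -/
theorem theta_exchange (hX : D.IsLatticeRep X T p c) (hA : D.IsAffineRep T p)
    {x : (V × ℝ) ≃ₗ[ℝ] (V × ℝ)} (hx : x ∈ D.extWeyl)
    (hxS : ∀ e ∈ D.inversions x⁻¹, e.1 ≠ R.root D.theta ∧ e.1 ≠ -R.root D.theta) :
    X D.thetaWeight * D.weylT T D.thetaReflection * D.semiT T p (D.thetaReflection * x) =
      D.semiT T p x * D.affX X c (x⁻¹ (R.root D.theta, 0)) := by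
  have h := hX.affX_mul_semiT hA D.thetaReflection_mem D.thetaWeight
    (S := {v | v ≠ R.root D.theta ∧ v ≠ -R.root D.theta}) (fun β γ hβ hγ => ?_) hx hxS
  · rwa [inv_eq_of_mul_eq_one_left D.thetaReflection_mul_self] at h
  · have hγ' : R.root γ = R.root β - R.pairing β D.theta • R.root D.theta := by
      rw [thetaReflection_eq, prodOne_apply] at hγ
      have := congrArg Prod.fst hγ
      simp only [RootPairing.reflection_apply] at this
      rw [← this]
      simp
    have hc : R.coroot' β (D.thetaWeight : V) = R.pairing D.theta β := by
      simp [thetaWeight]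
    rw [hc]
    have hγp : R.pairing γ D.theta = -R.pairing β D.theta := by
      have := congrArg (R.coroot' D.theta) hγ'
      simp only [map_sub, map_smul, RootPairing.root_coroot'_eq_pairing, smul_eq_mul,
        RootPairing.pairing_same] at this
      linarith
    have h1 := D.pairing_theta_eq β
    have h2 := D.halfNorm_pos β
    rcases D.pairing_theta_cases β with h0 | h0 | h0 | h0 | h0
    · left
      rw [h0, mul_zero] at h1
      rw [h1, zero_smul, sub_zero] at hγ'
      exact ⟨h0, by rw [R.root.injective hγ']⟩
    · right; left
      rw [h0, mul_one] at h1
      refine ⟨h0, ?_, fun hp => ?_⟩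
      · by_contra hn
        rw [← isPos_reflectionPerm_self] at hn
        have := D.coroot'_theta_nonneg hn
        simp at this
        linarith
      · have := D.coroot'_theta_nonneg hp
        linarith
    · right; right
      rw [h0] at h1
      refine ⟨h0, fun hp => ?_, ?_⟩
      · have := D.coroot'_theta_nonneg hp
        linarith
      · by_contra hn
        rw [← isPos_reflectionPerm_self] at hn
        have := D.coroot'_theta_nonneg hn
        simp at this
        linarith
    · exact absurd (by rw [h0]) hβ.1
    · exact absurd h0 hβ.2

theorem theta_semiY (hX : D.IsLatticeRep X T p c) (hA : D.IsAffineRep T p) (b : D.weights)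
    (h : R.coroot' D.theta (b : V) = 0) :
    X D.thetaWeight * D.weylT T D.thetaReflection * D.semiY T p b =
      D.semiY T p b * (X D.thetaWeight * D.weylT T D.thetaReflection) := by
  have h1 := hX.theta_exchange hA (D.translation_mem b.2) (D.inversions_translation h)
  have h2 : (D.thetaReflection ((b : V), 0)).1 = b := by
    rw [thetaReflection_eq, prodOne_apply]
    change R.reflection D.theta (b : V) = b
    rw [RootPairing.reflection_apply, h, zero_smul, sub_zero]
  have h3 : (D.translation (b : V))⁻¹ (R.root D.theta, 0) = ((D.thetaWeight : V), 0) := by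
    rw [← translation_neg, translation_apply, map_neg, D.form_comm, D.form_theta, h]
    simp [thetaWeight]
  rw [D.weyl_mul_translation D.thetaReflection_mem, h2, h3, affX_mk_zero,
    hA.semiT_translation_mul_weyl b D.thetaReflection_mem,
    inv_eq_of_mul_eq_one_left D.thetaReflection_mul_self] at h1
  rw [← mul_assoc, mul_inv_eq_iff_eq_mul] at h1
  rw [h1, mul_assoc]
  rfl

/-- `theta_exchange` at `x = b s_ϑ`; the factor `q` is the level of `x⁻¹(ϑ) = [-ϑ, 1]`. -/
theorem theta_semiY_theta (hX : D.IsLatticeRep X T p c) (hA : D.IsAffineRep T p) (b : D.weights)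
    (h : R.coroot' D.theta (b : V) = 1) :
    X D.thetaWeight * D.weylT T D.thetaReflection * D.semiY T p (b - D.thetaWeight) *
      (X D.thetaWeight * D.weylT T D.thetaReflection) = D.semiY T p b * D.qpow c 1 := by
  have hbs := mul_mem (D.translation_mem b.2) (D.weyl_le_extWeyl D.thetaReflection_mem)
  have h1 := hX.theta_exchange hA hbs (by
    rw [thetaReflection_eq]; exact D.inversions_translation_mul_reflection D.isPos_theta h)
  have h2 : (D.thetaReflection ((b : V), 0)).1 = ((b - D.thetaWeight : D.weights) : V) := by
    rw [thetaReflection_eq, prodOne_apply]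
    change R.reflection D.theta (b : V) = _
    rw [RootPairing.reflection_apply, h, one_smul]
    rfl
  have h3 : (D.translation (b : V) * D.thetaReflection)⁻¹ (R.root D.theta, 0) =
      (((-D.thetaWeight : D.weights) : V), 1) := by
    rw [mul_inv_rev, inv_eq_of_mul_eq_one_left D.thetaReflection_mul_self, LinearEquiv.mul_apply,
      ← translation_neg, translation_apply, map_neg, D.form_comm, D.form_theta, h,
      thetaReflection_eq, prodOne_apply]
    simp [thetaWeight]
  rw [← mul_assoc, D.weyl_mul_translation D.thetaReflection_mem, mul_assoc (D.translation _),
    thetaReflection_mul_self, mul_one, h2, h3, affX_mk, hX.neg,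
    hA.semiT_translation_mul_weyl b D.thetaReflection_mem,
    inv_eq_of_mul_eq_one_left D.thetaReflection_mul_self] at h1
  change X D.thetaWeight * D.weylT T D.thetaReflection * D.semiY T p (b - D.thetaWeight) = _ at h1
  have hc := D.qpow_commute (hX.centralX D.thetaWeight) 1
  have hc' : D.qpow c 1 * D.weylT T D.thetaReflection = D.weylT T D.thetaReflection * D.qpow c 1 :=
    D.qpow_commute (hX.central_weylT _) 1
  rw [h1]
  simp only [mul_assoc]
  rw [← mul_assoc (D.qpow c 1), hc]
  simp only [mul_assoc]
  rw [hc']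
  group

/-- The exchange identity for `v = u_r`, `z = ω_r`. As `ω_r` is minuscule or zero, `u_r` changes the
sign of `β` exactly when `(ω_r, β^∨) = ±1`, so no inversions have to be excluded. -/
theorem u_semiY (hX : D.IsLatticeRep X T p c) (hA : D.IsAffineRep T p) (r : D.orbitO)
    (a b : D.weights) (h : D.u r ((a : V), 0) = ((b : V), 0)) :
    X (D.fundWeight r) * D.weylT T (D.u r)⁻¹ * D.semiY T p b =
      D.semiY T p a * D.qpow c (D.form.form (D.omega r) a) *
        (X (D.fundWeight r) * D.weylT T (D.u r)⁻¹) := by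
  have h1 := hX.affX_mul_semiT hA (D.u_mem r) (D.fundWeight r) (S := Set.univ)
    (fun β γ _ hγ => ?_) (D.translation_mem a.2) (fun _ _ => Set.mem_univ _)
  · have h3 : (D.translation (a : V))⁻¹ ((D.fundWeight r : V), 0) =
        ((D.fundWeight r : V), D.form.form (D.omega r) a) := by
      rw [← translation_neg, translation_apply, map_neg, zero_sub, neg_neg]
      rfl
    rw [D.weyl_mul_translation (D.u_mem r), h, h3, affX_mk,
      hA.semiT_translation_mul_weyl b (D.u_mem r), ← mul_assoc, mul_inv_eq_iff_eq_mul] at h1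
    rw [h1, ← D.qpow_commute (hX.centralX (D.fundWeight r))]
    simp only [mul_assoc]
    rfl
  · obtain ⟨r, hr⟩ := r
    change D.u r (R.root β, 0) = (R.root γ, 0) at hγ
    change R.coroot' β (D.omega r) = 0 ∧ _ ∨ R.coroot' β (D.omega r) = 1 ∧ _ ∨
      R.coroot' β (D.omega r) = -1 ∧ _
    cases r with
    | none =>
      have : R.root β = R.root γ := congrArg Prod.fst hγ
      rw [R.root.injective this]
      exact Or.inl ⟨map_zero _, Iff.rfl⟩
    | some r =>
      by_cases hp : D.base.IsPos β
      · rcases D.coroot'_omega_cases hr hp with h0 | h0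
        · have h2 := D.u_pos r hp h0
          rw [hγ, affPos_mk_zero] at h2
          exact Or.inl ⟨h0, by simp [h2, hp]⟩
        · have h2 := D.u_neg r hp (by rw [h0]; exact one_ne_zero)
          rw [hγ] at h2
          exact Or.inr (Or.inl ⟨h0, hp, fun h' => D.not_affPos_neg (D.affPos_mk_zero.2 h') h2⟩)
      · have hp' := hp
        rw [← isPos_reflectionPerm_self] at hp'
        have hneg : (R.root (R.reflectionPerm β β), (0 : ℝ)) = -(R.root β, 0) := by simp
        have hc := coroot'_neg (R := R) β (D.omega (some r))
        rcases D.coroot'_omega_cases hr hp' with h0 | h0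
        · have h2 := D.u_pos r hp' h0
          rw [hneg, map_neg, hγ] at h2
          refine Or.inl ⟨by linarith, ?_⟩
          have : ¬ D.base.IsPos γ := fun h' => D.not_affPos_neg (D.affPos_mk_zero.2 h') h2
          simp [this, hp]
        · have h2 := D.u_neg r hp' (by rw [h0]; exact one_ne_zero)
          rw [hneg, map_neg, hγ, neg_neg, affPos_mk_zero] at h2
          exact Or.inr (Or.inr ⟨by linarith, hp, h2⟩)

end IsLatticeRep

end Rep

end AffineData

end

/-! ### Orders of the products `s_0 s_j`, and inverted generators. -/

set_option linter.unusedSectionVars false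

noncomputable section

namespace AffineData

variable {ι V N : Type*} [AddCommGroup V] [Module ℝ V] [AddCommGroup N] [Module ℝ N]
  {R : RootPairing ι ℝ V N} (D : AffineData R)

variable [R.IsRootSystem] [Finite ι] [R.IsCrystallographic] [R.IsReduced]

/-! ### The link between `α₀` and the other simple roots -/

theorem translation_mul_weyl_inj {b b' : V} {w w' : (V × ℝ) ≃ₗ[ℝ] (V × ℝ)} (hw : w ∈ D.weyl)
    (hw' : w' ∈ D.weyl) (h : D.translation b * w = D.translation b' * w') : b = b' := by
  obtain ⟨g, -, rfl⟩ := D.exists_of_mem_weyl hw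
  obtain ⟨g', -, rfl⟩ := D.exists_of_mem_weyl hw'
  have h1 : ∀ z : V, D.form.form (g z) b = D.form.form (g z) b' := fun z => by
    have h2 := LinearEquiv.congr_fun h (z, 0)
    simp only [LinearEquiv.mul_apply, translation_apply, prodOne_apply, Prod.mk.injEq] at h2
    have h3 := h2.2
    rw [← h2.1] at h3
    linarith
  refine D.ext_coroot' fun i => ?_
  have h2 := h1 (g.symm (R.root i))
  rw [LinearEquiv.apply_symm_apply, D.form_comm, D.form_root, D.form_comm, D.form_root] at h2
  exact mul_left_cancel₀ (D.halfNorm_pos i).ne' h2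

theorem simpleReflection_none_ne (j : D.Simple) :
    D.simpleReflection none ≠ D.simpleReflection (some j) := by
  intro h
  have h1 := LinearEquiv.congr_fun h (D.simpleRoot none)
  rw [simpleReflection_simpleRoot, simpleReflection_apply] at h1
  have h2 := congrArg Prod.snd h1
  simp [simpleRoot] at h2
  norm_num at h2

/-- The types of links between `α₀` and `α_j`. -/
theorem simpleRoot_none_cases (j : D.Simple) :
    (j : ι) = D.theta ∨
    (D.corootForm j (D.simpleRoot none).1 = 0 ∧ D.corootForm none (D.simpleRoot (some j)).1 = 0) ∨
    (D.corootForm j (D.simpleRoot none).1 = -1 ∧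
      D.corootForm none (D.simpleRoot (some j)).1 = -1) ∨
    (D.corootForm j (D.simpleRoot none).1 = -1 ∧
      D.corootForm none (D.simpleRoot (some j)).1 = -2) := by
  have hj : D.base.IsPos j := D.finPos_mk.1 (D.finPos_simpleRoot j)
  have hx : D.corootForm j (D.simpleRoot none).1 = -R.pairing D.theta j := by
    simp [corootForm, simpleRoot]
  have hy : D.corootForm none (D.simpleRoot (some j)).1 = -R.pairing j D.theta := by
    simp [corootForm, simpleRoot]
  rw [hx, hy]
  by_cases hjθ : (j : ι) = D.theta
  · exact Or.inl hjθ
  have h2 : R.root D.theta ≠ -R.root j := by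
    intro h
    have h3 : D.theta = R.reflectionPerm j j := R.root.injective (by rw [h]; simp)
    have h4 := D.isPos_theta
    rw [h3, isPos_reflectionPerm_self] at h4
    exact h4 hj
  have h := R.pairingIn_pairingIn_mem_set_of_isCrystal_of_isRed' (i := D.theta) (j := j)
    (fun h => hjθ (R.root.injective h).symm) h2
  have e1 : R.pairing D.theta j = R.pairingIn ℤ D.theta j := (R.algebraMap_pairingIn ℤ _ _).symm
  have e2 : R.pairing j D.theta = R.pairingIn ℤ j D.theta := (R.algebraMap_pairingIn ℤ _ _).symm
  have h3 := D.pairing_theta_eq j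
  have h4 := D.one_le_halfNorm j
  have h5 := D.coroot'_theta_nonneg hj
  -- A triple link is impossible. It would make `γ = s_ϑ s_j(ϑ) = 2 ϑ - α_j` a short root; comparing
  -- its coroot with `ϑ^∨` at `ω_i`, `i ≠ j`, gives `2 (ω_i, ϑ) ≤ (ω_i, ϑ)`. Hence `ϑ` would be a
  -- multiple of `α_j`, against the pairings `3` and `1`.
  have hthree : R.pairing j D.theta = 3 → R.pairing D.theta j = 1 → False := by
    intro hj3 hj1
    rw [hj3, hj1] at h3
    have hγ : R.root (R.reflectionPerm D.theta (R.reflectionPerm j D.theta)) =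
        (2 : ℝ) • R.root D.theta - R.root j := by
      rw [R.root_reflectionPerm, R.root_reflectionPerm, RootPairing.reflection_apply_root, hj1,
        map_sub, map_smul, RootPairing.reflection_apply_self, RootPairing.reflection_apply_root, hj3]
      module
    have hν : D.halfNorm (R.reflectionPerm D.theta (R.reflectionPerm j D.theta)) = 1 := by
      rw [halfNorm_reflectionPerm, halfNorm_reflectionPerm, halfNorm_theta]
    have hle : ∀ i : D.Simple, i ≠ j → D.base.toWeightBasis.coord i (R.root D.theta) = 0 := by
      classical
      intro i hij
      have h6 := D.coroot'_le_coroot'_theta (z := D.omega (some i))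
        (D.coroot'_omega_some_nonneg (some i)) (R.reflectionPerm D.theta (R.reflectionPerm j D.theta))
      have h7 := D.form_root (D.omega (some i))
        (R.reflectionPerm D.theta (R.reflectionPerm j D.theta))
      rw [hν, one_mul, hγ, map_sub, map_smul, D.form_theta, D.form_root, D.coroot'_omega i j,
        if_neg hij, mul_zero, sub_zero, smul_eq_mul] at h7
      have h8 := D.coroot'_omega_nonneg (some i) D.isPos_theta
      have h9 := D.halfNorm_mul_coord i (R.root D.theta)
      rw [D.form_theta] at h9
      have h10 : R.coroot' D.theta (D.omega (some i)) = 0 := by linarith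
      rw [h10] at h9
      exact (mul_eq_zero.1 h9).resolve_left (D.halfNorm_pos i).ne'
    have hθ := D.base.toWeightBasis.sum_repr (R.root D.theta)
    rw [Finset.sum_eq_single j (fun i _ hij => by
      have := hle i hij
      rw [Module.Basis.coord_apply] at this
      rw [this, zero_smul]) (by simp), RootPairing.Base.toWeightBasis_apply] at hθ
    have h11 := congrArg (R.coroot' D.theta) hθ
    have h12 := congrArg (R.coroot' j) hθ
    simp only [map_smul, RootPairing.root_coroot'_eq_pairing, smul_eq_mul,
      RootPairing.pairing_same, hj3, hj1] at h11 h12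
    linarith
  rw [e1, e2] at h3 hthree
  rw [e2] at h5
  rw [e1, e2]
  simp only [Set.mem_insert_iff, Set.mem_singleton_iff, Prod.mk.injEq] at h
  rcases h with h | h | h | h | h | h | h | h | h | h | h <;>
    simp only [h.1, h.2] at h3 h5 hthree ⊢ <;>
    first
    | (norm_num; done)
    | (exfalso; norm_num at h5; done)
    | (exfalso; norm_num at hthree; done)
    | (exfalso; norm_num at h3; linarith)

/-- Here `s_j = s_ϑ`, and `s_0 s_ϑ` is a translation by a nonzero vector. -/
theorem orderOf_of_theta {j : D.Simple} (h : (j : ι) = D.theta) :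
    orderOf (D.simpleReflection none * D.simpleReflection (some j)) = 0 := by
  have h1 : D.simpleReflection (some j) = D.thetaReflection := by
    rw [simpleReflection_some, thetaReflection_eq, h]
  rw [h1, ← translation_theta, orderOf_eq_zero_iff']
  intro n hn h2
  have h3 : ∀ k : ℕ, D.translation (R.root D.theta) ^ k = D.translation (k • R.root D.theta) := by
    intro k
    induction k with
    | zero => rw [pow_zero, zero_smul, translation_zero]
    | succ k ih => rw [pow_succ, ih, succ_nsmul, translation_add]
  rw [h3] at h2
  have h4 := congrArg Prod.snd (LinearEquiv.congr_fun h2 (R.root D.theta, 0))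
  simp only [translation_apply, map_nsmul, D.form_theta, RootPairing.root_coroot'_eq_pairing,
    RootPairing.pairing_same, nsmul_eq_mul, LinearEquiv.coe_one, id] at h4
  have h5 : (0 : ℝ) < n := by exact_mod_cast hn
  linarith

theorem orderOf_eq_two {j : D.Simple} (h : D.corootForm none (D.simpleRoot (some j)).1 = 0) :
    orderOf (D.simpleReflection none * D.simpleReflection (some j)) = 2 := by
  have h0 := D.simpleReflection_mul_self none
  have h1 := D.simpleReflection_mul_self (some j)
  have h2 : D.simpleReflection none (D.simpleRoot (some j)) = D.simpleRoot (some j) := by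
    rw [simpleReflection_apply, h, zero_smul, sub_zero]
  have h3 := D.mul_simpleReflection_of_eq (D.simpleReflection_mem_extWeyl none) h2
  refine orderOf_eq_prime ?_ fun h4 => D.simpleReflection_none_ne j ?_
  · rw [pow_two]
    nth_rw 1 [h3]
    rw [mul_assoc, ← mul_assoc (D.simpleReflection none), h0, one_mul, h1]
  · rw [eq_inv_of_mul_eq_one_left h4, inv_eq_of_mul_eq_one_left h1]

/-- `s_0 s_j` takes `α₀` to `α_j` and thus conjugates `s_0` into `s_j`. For order four the analogous
fact is that `s_0 s_j s_0` fixes `α_j`. -/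
theorem orderOf_eq_three {j : D.Simple} (hj : D.corootForm j (D.simpleRoot none).1 = -1)
    (h : D.corootForm none (D.simpleRoot (some j)).1 = -1) :
    orderOf (D.simpleReflection none * D.simpleReflection (some j)) = 3 := by
  have h0 := D.simpleReflection_mul_self none
  have h1 := D.simpleReflection_mul_self (some j)
  have h2 : (D.simpleReflection none * D.simpleReflection (some j)) (D.simpleRoot none) =
      D.simpleRoot (some j) := by
    rw [LinearEquiv.mul_apply, D.simpleReflection_apply (some j), hj, neg_one_smul, sub_neg_eq_add,
      map_add, simpleReflection_simpleRoot, simpleReflection_apply, h]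
    module
  have h3 := D.mul_simpleReflection_of_eq (mul_mem (D.simpleReflection_mem_extWeyl none)
    (D.simpleReflection_mem_extWeyl (some j))) h2
  have : Fact (Nat.Prime 3) := ⟨Nat.prime_three⟩
  refine orderOf_eq_prime ?_ fun h4 => D.simpleReflection_none_ne j ?_
  · generalize D.simpleReflection none = a at *
    generalize D.simpleReflection (some j) = b at *
    calc (a * b) ^ 3 = a * b * a * b * a * b := by simp only [pow_succ, pow_zero, one_mul, mul_assoc]
      _ = b * a * (b * b) * a * b := by rw [h3]; group
      _ = b * (a * a) * b := by rw [h1]; group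
      _ = 1 := by rw [h0, mul_one, h1]
  · rw [eq_inv_of_mul_eq_one_left h4, inv_eq_of_mul_eq_one_left h1]

theorem orderOf_eq_four {j : D.Simple} (hj : D.corootForm j (D.simpleRoot none).1 = -1)
    (h : D.corootForm none (D.simpleRoot (some j)).1 = -2) :
    orderOf (D.simpleReflection none * D.simpleReflection (some j)) = 4 := by
  have h0 := D.simpleReflection_mul_self none
  have h1 := D.simpleReflection_mul_self (some j)
  have h2 : (D.simpleReflection none * D.simpleReflection (some j) * D.simpleReflection none)
      (D.simpleRoot (some j)) = D.simpleRoot (some j) := by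
    rw [LinearEquiv.mul_apply, D.simpleReflection_apply none, h, LinearEquiv.mul_apply, map_sub,
      map_smul, simpleReflection_simpleRoot, D.simpleReflection_apply (some j), hj, map_sub,
      map_smul, map_sub, map_smul, map_neg, simpleReflection_simpleRoot, simpleReflection_apply, h]
    module
  have h3 := D.mul_simpleReflection_of_eq (mul_mem (mul_mem (D.simpleReflection_mem_extWeyl none)
    (D.simpleReflection_mem_extWeyl (some j))) (D.simpleReflection_mem_extWeyl none)) h2
  refine orderOf_eq_prime_pow (p := 2) (n := 1) (fun h4 => ?_) ?_
  · have h5 : D.simpleReflection none * D.simpleReflection (some j) =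
        D.simpleReflection (some j) * D.simpleReflection none := by
      rw [pow_one, pow_two] at h4
      rw [eq_inv_of_mul_eq_one_left h4, mul_inv_rev, inv_eq_of_mul_eq_one_left h0,
        inv_eq_of_mul_eq_one_left h1]
    have h6 := congrArg Prod.snd (LinearEquiv.congr_fun h5 (D.simpleRoot none))
    rw [LinearEquiv.mul_apply, LinearEquiv.mul_apply, simpleReflection_simpleRoot, map_neg,
      D.simpleReflection_apply (some j), hj, neg_one_smul, sub_neg_eq_add, map_add,
      simpleReflection_simpleRoot, simpleReflection_apply, h] at h6
    simp [simpleRoot] at h6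
  · have : (2 : ℕ) ^ (1 + 1) = 2 * 2 := rfl
    rw [this, pow_mul, pow_two, pow_two]
    generalize D.simpleReflection none = a at *
    generalize D.simpleReflection (some j) = b at *
    calc a * b * (a * b) * (a * b * (a * b)) = (a * b * a * b) * (a * b * a * b) := by group
      _ = (b * (a * b * a)) * (a * b * a * b) := by rw [h3]
      _ = b * a * b * (a * a) * b * a * b := by group
      _ = b * a * (b * b) * a * b := by rw [h0]; group
      _ = b * (a * a) * b := by rw [h1]; group
      _ = 1 := by rw [h0, mul_one, h1]

section Rep

variable {G : Type*} [Group G]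

/-! ### Twisted representations -/

theorem prod_map_inv_alternatingWord (T : D.Node → G) (i j : D.Node) (m : ℕ) :
    ((CoxeterSystem.alternatingWord i j m).map fun k => (T k)⁻¹).prod⁻¹ =
      if Even m then ((CoxeterSystem.alternatingWord j i m).map T).prod
      else ((CoxeterSystem.alternatingWord i j m).map T).prod := by
  induction m generalizing i j with
  | zero => simp [CoxeterSystem.alternatingWord]
  | succ m ih =>
    rw [CoxeterSystem.alternatingWord_succ, List.concat_eq_append, List.map_append,
      List.prod_append, List.map_singleton, List.prod_singleton, mul_inv_rev, inv_inv, ih]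
    by_cases hm : Even m
    · have h1 : ¬ Even (m + 1) := by rwa [Nat.even_add_one, not_not]
      rw [if_pos hm, if_neg h1, ← List.concat_eq_append, ← CoxeterSystem.alternatingWord_succ,
        CoxeterSystem.alternatingWord_succ', if_pos hm, List.map_cons, List.prod_cons]
    · have h1 : Even (m + 1) := by rwa [Nat.even_add_one]
      rw [if_neg hm, if_pos h1, CoxeterSystem.alternatingWord_succ', if_neg hm, List.map_cons,
        List.prod_cons]

variable {D} {X : D.weights → G} {T : D.Node → G} {p : D.orbitO → G} {c : G}

theorem IsAffineRep.inv (hA : D.IsAffineRep T p) : D.IsAffineRep (fun i => (T i)⁻¹) p where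
  braid i j := by
    have h := hA.braid i j
    rw [braidWord, braidWord, orderOf_simpleReflection_mul] at h
    rw [braidWord, braidWord, orderOf_simpleReflection_mul, ← inv_inj,
      prod_map_inv_alternatingWord, prod_map_inv_alternatingWord]
    split_ifs
    · exact h.symm
    · exact h
  mul := hA.mul
  conj r i j h := by rw [← hA.conj r i j h]; group

/-- Together with `IsAffineRep.inv`, this yields the involution of `𝔅` that inverts `X_b`, `T_i` and
`q` and fixes `π_r`. The relation at pairing `1` becomes the inverted one at pairing `-1`. -/
theorem IsLatticeRep.neg_inv (hX : D.IsLatticeRep X T p c) :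
    D.IsLatticeRep (fun b => X (-b)) (fun i => (T i)⁻¹) p c⁻¹ where
  centralT i := ((show Commute c (T i) from hX.centralT i).inv_left.inv_right).eq
  centralPi r := (show Commute c (p r) from hX.centralPi r).inv_left.eq
  rel := by
    have hneg : ∀ (b : D.weights), (((-b : D.weights) : V), (0 : ℝ)) = -((b : V), 0) := by
      intro b; ext <;> simp
    rintro _ _ (⟨a, b⟩ | ⟨b⟩ | ⟨i, b, h⟩ | ⟨i, b, h⟩ | ⟨r, b, b', j, h⟩)
    · rw [neg_add, hX.add]
    · exact (show Commute c (X (-b)) from hX.centralX _).inv_left.eq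
    · have hm := D.mk_zero_mem_affLattice b.2
      have h1 := hX.inv_T_affX_inv_T (i := i) (neg_mem hm) (by
        rw [Prod.fst_neg, map_neg, h])
      rw [← hneg, affX_mk_zero] at h1
      rw [h1, simpleReflection_apply, hneg, Prod.fst_neg, map_neg, h, neg_one_smul, sub_neg_eq_add,
        hX.affX_add (neg_mem hm) (D.simpleRoot_mem_affLattice i), ← hneg, affX_mk_zero,
        hX.affX_simpleRoot, D.qpow_inv c (D.simpleRoot_mem_affLattice i).2,
        D.qpow_neg c (D.simpleRoot_mem_affLattice i).2, hX.neg (D.simpleWeight i), mul_inv_rev,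
        inv_inv, inv_inv, D.qpow_commute (hX.centralX _)]
    · have hm := D.mk_zero_mem_affLattice (-b).2
      have h1 : Commute (T i) (X (-b)) := by
        have := hX.T_affX (i := i) hm (by rw [AddSubgroup.coe_neg, map_neg, h, neg_zero])
        rwa [affX_mk_zero] at this
      exact h1.inv_left.eq
    · have hm := D.mk_zero_mem_affLattice b.2
      have h1 := hX.p_affX r (neg_mem hm)
      have h2 := D.extWeyl_mem_affLattice (D.piElt_mem r) hm
      rw [← hneg, affX_mk_zero, hneg, map_neg, h, hX.affX_neg (by rwa [← h]), affX_mk] at h1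
      rw [h1, mul_inv_cancel_right, D.qpow_inv c (by rw [h] at h2; exact h2.2),
        D.qpow_neg c (by rw [h] at h2; exact h2.2), hX.neg, mul_inv_rev,
        ((show Commute (D.qpow c j) (X b') from D.qpow_commute (hX.centralX _) j).inv_inv).eq]

end Rep

end AffineData

end

/-! ### The relations of `𝔅` for the images under `τ_+`. -/

set_option linter.unusedSectionVars false

noncomputable section

namespace AffineData

variable {ι V N : Type*} [AddCommGroup V] [Module ℝ V] [AddCommGroup N] [Module ℝ N]
  {R : RootPairing ι ℝ V N} (D : AffineData R)

variable [R.IsRootSystem] [Finite ι] [R.IsCrystallographic] [R.IsReduced]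

/-! ### The twist by `τ_+` -/

theorem corootForm_none_omega {r : D.Node} (hr : r ∈ D.orbitO) (h0 : r ≠ none) :
    D.corootForm none (D.omega r) = -1 := by
  rw [corootForm, LinearMap.neg_apply, D.coroot'_theta_omega hr h0]

theorem corootForm_self_omega (i : D.Simple) : D.corootForm (some i) (D.omega (some i)) = 1 := by
  classical exact (D.coroot'_omega i i).trans (if_pos rfl)

theorem corootForm_omega_of_ne {i : D.Simple} {r : D.Node} (h : some i ≠ r) :
    D.corootForm (some i) (D.omega r) = 0 := by
  classical
  cases r with
  | none => exact map_zero _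
  | some r => exact (D.coroot'_omega r i).trans (if_neg fun h' => h (by rw [h']))

theorem weyl_apply_mk {w : (V × ℝ) ≃ₗ[ℝ] (V × ℝ)} (hw : w ∈ D.weyl) (v : V) (j : ℝ) :
    w (v, j) = ((w (v, 0)).1, j) := by
  obtain ⟨g, -, rfl⟩ := D.exists_of_mem_weyl hw
  rfl

theorem piElt_apply (r : D.orbitO) (v : V) (j : ℝ) : D.piElt r (v, j) =
    (((D.u r)⁻¹ (v, 0)).1, j - D.form.form (D.omega r) ((D.u r)⁻¹ (v, 0)).1) := by
  rw [piElt, LinearEquiv.mul_apply, D.weyl_apply_mk (inv_mem (D.u_mem r)), translation_apply,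
    D.form_comm]

theorem omega_of_piElt_mul {r s t : D.orbitO} (h : D.piElt r * D.piElt s = D.piElt t) :
    D.omega t = D.omega r + ((D.u r)⁻¹ (D.omega s, 0)).1 := by
  have hr := inv_mem (D.u_mem r)
  have hs := inv_mem (D.u_mem s)
  refine (D.translation_mul_weyl_inj (mul_mem hr hs) (inv_mem (D.u_mem t)) ?_).symm
  rw [← piElt, ← h, piElt, piElt, translation_add]
  have := D.weyl_mul_translation hr (D.omega s)
  simp only [mul_assoc]
  rw [← mul_assoc (D.u r)⁻¹, this]
  simp only [mul_assoc]

theorem form_weyl {w : (V × ℝ) ≃ₗ[ℝ] (V × ℝ)} (hw : w ∈ D.weyl) (x y : V) :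
    D.form.form (w (x, 0)).1 (w (y, 0)).1 = D.form.form x y :=
  D.form_extWeyl (D.weyl_le_extWeyl hw) (x, 0) (y, 0)

/-- The level contains the cross term `-(ω_r, u_r⁻¹ ω_s)`. As `u_r⁻¹ ω_s = ω_t - ω_r` has the same
length as `ω_s`, it is a combination of half square lengths. This is why the factor `q^{-(ω_r,
ω_r)/2}` makes `X_r π_r` multiplicative. -/
theorem piElt_omega {r s t : D.orbitO} (h : D.piElt r * D.piElt s = D.piElt t) :
    D.piElt r (D.omega s, 0) = (D.omega t - D.omega r,
      D.form.form (D.omega r) (D.omega r) / 2 + D.form.form (D.omega s) (D.omega s) / 2 -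
        D.form.form (D.omega t) (D.omega t) / 2) := by
  have h1 := D.omega_of_piElt_mul h
  have h2 := D.form_weyl (inv_mem (D.u_mem r)) (D.omega s) (D.omega s)
  rw [piElt_apply, ← h2, h1, add_sub_cancel_left]
  generalize ((D.u r)⁻¹ (D.omega s, 0)).1 = v
  simp only [map_add, LinearMap.add_apply, D.form_comm v (D.omega r)]
  congr 1
  ring

section Rep

variable {G : Type*} [Group G]

/-- The images of the `T_i` under `τ_+`. -/
def tauT (X : D.weights → G) (T : D.Node → G) (c : G) : D.Node → G
  | none => D.qpow c (-1) * X D.thetaWeight * (T none)⁻¹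
  | some i => T (some i)

/-- The images of the `π_r` under `τ_+`. -/
def tauPi (X : D.weights → G) (p : D.orbitO → G) (c : G) (r : D.orbitO) : G :=
  D.qpow c (-(D.form.form (D.omega r) (D.omega r) / 2)) * (X (D.fundWeight r) * p r)

variable {D} {X : D.weights → G} {T : D.Node → G} {p : D.orbitO → G} {c : G}

theorem IsLatticeRep.tauT_none (hX : D.IsLatticeRep X T p c) :
    D.tauT X T c none = D.affX X c (-D.simpleRoot none) * (T none)⁻¹ := by
  have h : -D.simpleRoot none = ((D.thetaWeight : V), -1) := by simp [simpleRoot, thetaWeight]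
  rw [tauT, h, affX_mk, D.qpow_commute (hX.centralX _)]

theorem IsLatticeRep.central_tauT (hX : D.IsLatticeRep X T p c) (i : D.Node) :
    c * D.tauT X T c i = D.tauT X T c i * c := by
  cases i with
  | none =>
    exact (((Commute.refl c).zpow_right _).mul_right (show Commute c _ from hX.centralX _)
      |>.mul_right (show Commute c _ from hX.centralT none).inv_right).eq
  | some i => exact hX.centralT _

theorem IsLatticeRep.central_tauPi (hX : D.IsLatticeRep X T p c) (r : D.orbitO) :
    c * D.tauPi X p c r = D.tauPi X p c r * c :=
  (((Commute.refl c).zpow_right _).mul_right ((show Commute c _ from hX.centralX _).mul_right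
    (show Commute c _ from hX.centralPi r))).eq

/-- With `A = X_{α₀}⁻¹`, `B = X_{α_j}⁻¹`, `a = T_0`, `b = T_j` the image of `T_0` is `A a⁻¹`. The
relations of `X` with `T` allow `A` and `B` to be moved to the left, and what remains is a form of
the braid relation of `a` and `b`. In the case of infinite order both words are empty. -/
theorem braidWord_comm_tau (hX : D.IsLatticeRep X T p c) (hA : D.IsAffineRep T p) (j : D.Simple) :
    D.braidWord (D.tauT X T c) none (some j) = D.braidWord (D.tauT X T c) (some j) none := by
  have hb := hA.braid none (some j)
  have h0 : D.tauT X T c none = D.affX X c (-D.simpleRoot none) * (T none)⁻¹ := hX.tauT_none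
  have h1 : D.tauT X T c (some j) = T (some j) := rfl
  have hm0 := neg_mem (D.simpleRoot_mem_affLattice none)
  have hmj := neg_mem (D.simpleRoot_mem_affLattice (some j))
  have h00 : D.corootForm none (D.simpleRoot none).1 = 2 := D.corootForm_simpleRoot none
  rw [braidWord, braidWord, D.orderOf_simpleReflection_mul (some j)] at hb ⊢
  rcases D.simpleRoot_none_cases j with h | ⟨hj, h⟩ | ⟨hj, h⟩ | ⟨hj, h⟩
  · rw [D.orderOf_of_theta h]
    simp [CoxeterSystem.alternatingWord]
  · rw [D.orderOf_eq_two h] at hb ⊢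
    simp only [CoxeterSystem.alternatingWord, List.concat_eq_append, List.nil_append,
      List.cons_append, List.map_cons, List.map_nil, List.prod_cons, List.prod_nil, mul_one,
      h0, h1] at hb ⊢
    have h2 : Commute (T (some j)) (D.affX X c (-D.simpleRoot none)) :=
      hX.T_affX hm0 (by rw [Prod.fst_neg, map_neg, hj, neg_zero])
    exact (h2.symm.mul_left (show Commute _ _ from hb).inv_left).eq
  · rw [D.orderOf_eq_three hj h] at hb ⊢
    simp only [CoxeterSystem.alternatingWord, List.concat_eq_append, List.nil_append,
      List.cons_append, List.map_cons, List.map_nil, List.prod_cons, List.prod_nil, mul_one,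
      h0, h1] at hb ⊢
    have h2 := hX.T_affX_T (i := some j) hm0 (by rw [Prod.fst_neg, map_neg, hj, neg_neg])
    rw [simpleReflection_apply, Prod.fst_neg, map_neg, hj, neg_neg, one_smul, sub_eq_add_neg,
      hX.affX_add hm0 hmj] at h2
    have h3 := hX.inv_T_affX_inv_T (i := none) (add_mem hm0 hmj) (by
      rw [Prod.fst_add, Prod.fst_neg, Prod.fst_neg, map_add, map_neg, map_neg, h00, h]; norm_num)
    rw [simpleReflection_apply, Prod.fst_add, Prod.fst_neg, Prod.fst_neg, map_add, map_neg,
      map_neg, h00, h, show -(2 : ℝ) + -(-1) = -1 by norm_num, neg_one_smul, sub_neg_eq_add,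
      neg_add_cancel_comm, hX.affX_add hm0 hmj] at h3
    have h4 := hX.affX_comm hm0 hmj
    generalize D.affX X c (-D.simpleRoot none) = A at *
    generalize D.affX X c (-D.simpleRoot (some j)) = B at *
    generalize T none = a at *
    generalize T (some j) = b at *
    have h5 : b * A = A * B * b⁻¹ := by rw [← h2]; group
    have h6 : a⁻¹ * (A * B) = B * a := mul_inv_eq_iff_eq_mul.1 h3
    have h7 : b⁻¹ * a⁻¹ * b = a * b⁻¹ * a⁻¹ := by
      rw [eq_mul_inv_iff_mul_eq, mul_assoc, mul_assoc, inv_mul_eq_iff_eq_mul, inv_mul_eq_iff_eq_mul,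
        ← mul_assoc, ← mul_assoc, eq_mul_inv_iff_mul_eq]
      simpa only [mul_assoc] using hb
    calc b * (A * a⁻¹ * b) = (b * A) * (a⁻¹ * b) := by group
      _ = A * B * (b⁻¹ * a⁻¹ * b) := by rw [h5]; group
      _ = A * (B * a) * (b⁻¹ * a⁻¹) := by rw [h7]; group
      _ = A * a⁻¹ * (A * B * b⁻¹) * a⁻¹ := by rw [← h6]; group
      _ = A * a⁻¹ * (b * (A * a⁻¹)) := by rw [← h5]; group
  · rw [D.orderOf_eq_four hj h] at hb ⊢
    simp only [CoxeterSystem.alternatingWord, List.concat_eq_append, List.nil_append,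
      List.cons_append, List.map_cons, List.map_nil, List.prod_cons, List.prod_nil, mul_one,
      h0, h1] at hb ⊢
    have h2 := hX.T_affX_T (i := some j) hm0 (by rw [Prod.fst_neg, map_neg, hj, neg_neg])
    rw [simpleReflection_apply, Prod.fst_neg, map_neg, hj, neg_neg, one_smul, sub_eq_add_neg,
      hX.affX_add hm0 hmj] at h2
    have h3 := hX.T_affX (i := none) (add_mem hm0 hmj) (by
      rw [Prod.fst_add, Prod.fst_neg, Prod.fst_neg, map_add, map_neg, map_neg, h00, h]; norm_num)
    rw [hX.affX_add hm0 hmj] at h3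
    have h4 := hX.affX_comm hm0 hmj
    generalize D.affX X c (-D.simpleRoot none) = A at *
    generalize D.affX X c (-D.simpleRoot (some j)) = B at *
    generalize T none = a at *
    generalize T (some j) = b at *
    have h5 : b * A = A * B * b⁻¹ := by rw [← h2]; group
    have h6 : b⁻¹ * (A * B) = A * b := by rw [← h2]; group
    have h8 : a⁻¹ * (A * B) = A * B * a⁻¹ := (show Commute a (A * B) from h3).inv_left.eq
    have h9 : A * (A * B) = A * B * A := by rw [mul_assoc A B A, ← h4]
    have h7 : a⁻¹ * b⁻¹ * a⁻¹ * b = b * a⁻¹ * b⁻¹ * a⁻¹ := by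
      rw [eq_mul_inv_iff_mul_eq, eq_mul_inv_iff_mul_eq, eq_mul_inv_iff_mul_eq]
      simp only [mul_assoc, inv_mul_eq_iff_eq_mul]
      exact hb.symm
    calc A * a⁻¹ * (b * (A * a⁻¹ * b)) = A * a⁻¹ * (b * A) * a⁻¹ * b := by group
      _ = A * (a⁻¹ * (A * B)) * b⁻¹ * a⁻¹ * b := by rw [h5]; group
      _ = A * (A * B) * (a⁻¹ * b⁻¹ * a⁻¹ * b) := by rw [h8]; group
      _ = A * B * (A * b) * a⁻¹ * b⁻¹ * a⁻¹ := by rw [h7, h9]; group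
      _ = A * B * b⁻¹ * (A * B * a⁻¹) * b⁻¹ * a⁻¹ := by rw [← h6]; group
      _ = A * B * b⁻¹ * a⁻¹ * (A * B * b⁻¹) * a⁻¹ := by rw [← h8]; group
      _ = b * (A * a⁻¹ * (b * (A * a⁻¹))) := by rw [← h5]; group

theorem isAffineRep_tau (hX : D.IsLatticeRep X T p c) (hA : D.IsAffineRep T p) :
    D.IsAffineRep (D.tauT X T c) (D.tauPi X p c) where
  braid i j := by
    cases i with
    | none =>
      cases j with
      | none => rfl
      | some j => exact braidWord_comm_tau hX hA j
    | some i =>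
      cases j with
      | none => exact (braidWord_comm_tau hX hA i).symm
      | some j =>
        have hw : ∀ (m : ℕ) (i j : D.Simple),
            (CoxeterSystem.alternatingWord (some i) (some j) m).map (D.tauT X T c) =
              (CoxeterSystem.alternatingWord (some i) (some j) m).map T := by
          intro m
          induction m with
          | zero => intro i j; rfl
          | succ m ih =>
            intro i j
            rw [CoxeterSystem.alternatingWord_succ, List.concat_eq_append, List.map_append,
              List.map_append, ih]
            rfl
        have h := hA.braid (some i) (some j)
        rw [braidWord, braidWord] at h ⊢
        rw [hw, hw, h]
  mul r s t h := by
    have h1 := D.piElt_omega h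
    have hm := D.extWeyl_mem_affLattice (D.piElt_mem r) (D.mk_zero_mem_affLattice (D.omega_mem s))
    have h2 := hX.p_affX r (D.mk_zero_mem_affLattice (D.omega_mem s))
    have h3 : ∀ r, X (D.fundWeight r) = D.affX X c (D.omega r, 0) := fun r =>
      (D.affX_mk_zero X c (D.fundWeight r)).symm
    have hq := D.qpow_commute (hX.central_tauPi r)
    have hs := D.half_form_mem_qLattice (D.omega_mem s) (D.omega_mem s)
    have hr := D.half_form_mem_qLattice (D.omega_mem r) (D.omega_mem r)
    have hc : ∀ j : ℝ, D.qpow c j * (X (D.fundWeight r) * p r) =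
        X (D.fundWeight r) * p r * D.qpow c j := D.qpow_commute
      ((show Commute c _ from hX.centralX _).mul_right (show Commute c _ from hX.centralPi r)).eq
    have h4 : p r * X (D.fundWeight s) = D.affX X c (D.piElt r (D.omega s, 0)) * p r := by
      rw [h3, h2]
    have h5 : X (D.fundWeight r) * D.affX X c (D.piElt r (D.omega s, 0)) =
        X (D.fundWeight t) * D.qpow c (D.piElt r (D.omega s, 0)).2 := by
      rw [h3, ← hX.affX_add (D.mk_zero_mem_affLattice (D.omega_mem r)) hm, ← affX_mk]
      congr 1
      rw [h1]
      ext <;> simp [fundWeight]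
    have h6 : -(D.form.form (D.omega r) (D.omega r) / 2) +
        (-(D.form.form (D.omega s) (D.omega s) / 2) + (D.piElt r (D.omega s, 0)).2) =
        -(D.form.form (D.omega t) (D.omega t) / 2) := by
      rw [h1]; ring
    generalize (D.piElt r (D.omega s, 0)).2 = e at h5 h6
    rw [tauPi, tauPi, tauPi, ← h6, D.qpow_add c (neg_mem hr), D.qpow_add c (neg_mem hs),
      ← hA.mul r s t h]
    calc _ = D.qpow c (-(D.form.form (D.omega r) (D.omega r) / 2)) *
          (X (D.fundWeight r) * p r * D.qpow c (-(D.form.form (D.omega s) (D.omega s) / 2))) *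
          (X (D.fundWeight s) * p s) := by simp only [mul_assoc]
      _ = D.qpow c (-(D.form.form (D.omega r) (D.omega r) / 2)) *
          D.qpow c (-(D.form.form (D.omega s) (D.omega s) / 2)) *
          (X (D.fundWeight r) * (p r * X (D.fundWeight s)) * p s) := by
        rw [← hc]; simp only [mul_assoc]
      _ = D.qpow c (-(D.form.form (D.omega r) (D.omega r) / 2)) *
          D.qpow c (-(D.form.form (D.omega s) (D.omega s) / 2)) *
          ((X (D.fundWeight r) * D.affX X c (D.piElt r (D.omega s, 0))) * (p r * p s)) := by
        rw [h4]; simp only [mul_assoc]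
      _ = _ := by
        rw [h5, ← D.qpow_commute (hX.centralX _)]; simp only [mul_assoc]
  conj r i j h := by
    suffices hs : X (D.fundWeight r) * p r * D.tauT X T c i =
        D.tauT X T c j * (X (D.fundWeight r) * p r) by
      have hc := D.qpow_commute (hX.central_tauT j)
        (-(D.form.form (D.omega r) (D.omega r) / 2))
      rw [mul_inv_eq_iff_eq_mul, tauPi, mul_assoc, hs, ← mul_assoc, hc, mul_assoc]
    obtain ⟨r, hr⟩ := r
    have hp := hA.pi_mul_T h
    have hXr : X (D.fundWeight r) = D.affX X c (D.omega r, 0) :=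
      (D.affX_mk_zero X c (D.fundWeight r)).symm
    have hmr := D.mk_zero_mem_affLattice (D.omega_mem r)
    have hm0 := neg_mem (D.simpleRoot_mem_affLattice none)
    cases r with
    | none =>
      have h1 : D.piElt ⟨none, hr⟩ = 1 := D.piElt_zeroO
      have h2 : p ⟨none, hr⟩ = 1 := hA.zero
      have h3 : D.fundWeight none = 0 := rfl
      rw [h1] at h
      obtain rfl := D.simpleRoot_injective h
      simp only [h2, h3, hX.zero, mul_one, one_mul]
    | some r =>
      have hnone := D.piElt_simpleRoot_none ⟨some r, hr⟩
      -- As `π_r` sends `α₀` to `α_r`, there are three cases: `j = r` with `i = 0`, `j = 0`, and all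
      -- other `j`. They correspond to `(ω_r, α_j^∨) = 1, -1, 0`, and each needs the relation of
      -- `T_j` with `X_r` for that value.
      have hiff : i = none ↔ j = some r := by
        constructor
        · rintro rfl
          exact D.simpleRoot_injective (by rw [← h, hnone])
        · rintro rfl
          exact D.simpleRoot_injective ((D.piElt ⟨some r, hr⟩).injective (by rw [h, hnone]))
      cases i with
      | none =>
        obtain rfl := hiff.1 rfl
        have h1 := hX.p_affX ⟨some r, hr⟩ hm0
        rw [map_neg, h] at h1
        have h2 := hX.T_affX_T (i := some r) hmr (D.corootForm_self_omega r)
        rw [simpleReflection_apply, D.corootForm_self_omega, one_smul, sub_eq_add_neg,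
          hX.affX_add hmr (neg_mem (D.simpleRoot_mem_affLattice _))] at h2
        rw [hX.tauT_none, hXr]
        change _ = T (some r) * _
        rw [← mul_assoc, mul_inv_eq_iff_eq_mul, mul_assoc, h1, ← mul_assoc, ← h2]
        simp only [mul_assoc]
        rw [hp]
      | some i =>
        cases j with
        | none =>
          have h2 := hX.inv_T_affX_inv_T (i := none) hmr
            (D.corootForm_none_omega hr (Option.some_ne_none r))
          rw [simpleReflection_apply, D.corootForm_none_omega hr (Option.some_ne_none r),
            neg_one_smul, sub_neg_eq_add, hX.affX_add hmr (D.simpleRoot_mem_affLattice _)] at h2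
          change _ * T (some i) = _
          rw [hX.tauT_none, hXr, hX.affX_neg (D.simpleRoot_mem_affLattice _), mul_assoc, hp,
            ← mul_assoc, ← mul_assoc]
          congr 1
          rw [mul_assoc, eq_inv_mul_iff_mul_eq, ← mul_assoc,
            hX.affX_comm (D.simpleRoot_mem_affLattice _) hmr, ← h2, inv_mul_cancel_right]
        | some j =>
          have hjr : some j ≠ some r := fun h' => Option.some_ne_none i (hiff.2 h')
          have h2 := hX.T_affX (i := some j) hmr (D.corootForm_omega_of_ne hjr)
          change _ * T (some i) = T (some j) * _
          rw [hXr, mul_assoc, hp, ← mul_assoc, ← h2, mul_assoc]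

theorem isLatticeRep_tau (hX : D.IsLatticeRep X T p c) :
    D.IsLatticeRep X (D.tauT X T c) (D.tauPi X p c) c where
  centralT := hX.central_tauT
  centralPi := hX.central_tauPi
  rel := by
    have hm0 := neg_mem (D.simpleRoot_mem_affLattice none)
    rintro _ _ (⟨a, b⟩ | ⟨b⟩ | ⟨i, b, h⟩ | ⟨i, b, h⟩ | ⟨r, b, b', j, h⟩)
    · exact hX.add a b
    · exact hX.centralX b
    · cases i with
      | none =>
        have hb := D.mk_zero_mem_affLattice b.2
        have h00 : D.corootForm none (D.simpleRoot none).1 = 2 := D.corootForm_simpleRoot none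
        -- The new `T_0` brings a second `X_{α₀}⁻¹` next to `X_b`, and `b - α₀` has pairing `1 - 2 =
        -- -1` with `α₀^∨`, so the relation with inverse `T_0` applies.
        have hcor : D.corootForm none (((b : V), (0 : ℝ)) + -D.simpleRoot none).1 = -1 := by
          rw [Prod.fst_add, Prod.fst_neg, map_add, map_neg, h00, h]; norm_num
        have h2 := hX.inv_T_affX_inv_T (i := none) (add_mem hb hm0) hcor
        rw [simpleReflection_apply, hcor, neg_one_smul, sub_neg_eq_add, neg_add_cancel_right,
          hX.affX_add hb hm0, affX_mk_zero] at h2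
        have h3 := hX.affX_comm hb hm0
        rw [affX_mk_zero] at h3
        rw [← hX.affX_simpleRoot, ← hX.affX_neg (D.simpleRoot_mem_affLattice none), hX.tauT_none,
          h3]
        simp only [mul_assoc] at h2 ⊢
        rw [h2]
      | some i => exact hX.rel _ _ (.cross (some i) b h)
    · cases i with
      | none =>
        have hb := D.mk_zero_mem_affLattice b.2
        have h2 := hX.T_affX hb h
        have h3 := hX.affX_comm hm0 hb
        rw [affX_mk_zero] at h2 h3
        rw [hX.tauT_none]
        exact ((show Commute _ _ from h3).mul_left (show Commute _ _ from h2).inv_left).eq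
      | some i => exact hX.rel _ _ (.comm (some i) b h)
    · have h2 := hX.rel _ _ (.pi r b b' j h)
      rw [mul_inv_eq_iff_eq_mul] at h2 ⊢
      have h3 : Commute (X b' * D.qpow c j) (D.qpow c (-(D.form.form (D.omega r) (D.omega r) / 2)) *
          X (D.fundWeight r)) := by
        have h4 : ∀ j a, Commute (D.qpow c j) (X a) := fun j a => D.qpow_commute (hX.centralX a) j
        refine ((h4 _ _).symm.mul_right (hX.comm _ _)).mul_left (Commute.mul_right ?_ (h4 _ _))
        exact ((Commute.refl c).zpow_left _).zpow_right _
      rw [tauPi, ← mul_assoc (D.qpow c _), mul_assoc _ (p r), h2, ← mul_assoc, ← h3.eq, mul_assoc]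

end Rep

end AffineData

end

/-! ### The `Y`-half of the universal relations for the same images. -/

set_option linter.unusedSectionVars false

noncomputable section

namespace AffineData

variable {ι V N : Type*} [AddCommGroup V] [Module ℝ V] [AddCommGroup N] [Module ℝ N]
  {R : RootPairing ι ℝ V N} (D : AffineData R)

variable [R.IsRootSystem] [Finite ι] [R.IsCrystallographic] [R.IsReduced]

theorem star_mul (r : D.orbitO) : D.piElt r * D.piElt (D.star r) = D.piElt D.zeroO := by
  rw [piElt_star, mul_inv_cancel, piElt_zeroO]

/-- `π_r⁻¹ = u_r (-ω_r)` is the translation by `-u_r(ω_r)` followed on the right by `u_r`; compare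
with `π_{r*} = ω_{r*} u_{r*}⁻¹`. -/
theorem u_star (r : D.orbitO) : D.u (D.star r) = (D.u r)⁻¹ := by
  have hr := D.u_mem r
  have h1 : D.translation (D.omega (D.star r)) * (D.u (D.star r))⁻¹ =
      D.translation (D.u r (-D.omega r, 0)).1 * D.u r := by
    have h2 := D.piElt_star r
    rw [piElt, piElt, mul_inv_rev, inv_inv, ← translation_neg, D.weyl_mul_translation hr] at h2
    exact h2
  rw [D.translation_mul_weyl_inj (inv_mem (D.u_mem _)) hr h1] at h1
  rw [← mul_left_cancel h1, inv_inv]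

theorem omega_star (r : D.orbitO) : D.omega (D.star r) = -(D.u r (D.omega r, 0)).1 := by
  have h := D.omega_of_piElt_mul (r := D.star r) (s := r) (t := D.zeroO)
    (by rw [piElt_star, inv_mul_cancel, piElt_zeroO])
  rw [u_star, inv_inv] at h
  exact eq_neg_of_add_eq_zero_left h.symm

theorem form_omega_star (r : D.orbitO) :
    D.form.form (D.omega (D.star r)) (D.omega (D.star r)) =
      D.form.form (D.omega r) (D.omega r) := by
  rw [omega_star, map_neg, map_neg, LinearMap.neg_apply, neg_neg, D.form_weyl (D.u_mem r)]

section Rep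

variable {G : Type*} [Group G]

variable {D} {X : D.weights → G} {T : D.Node → G} {p : D.orbitO → G} {c : G}

theorem IsAffineRep.pi_star (hA : D.IsAffineRep T p) (r : D.orbitO) : p (D.star r) = (p r)⁻¹ := by
  rw [eq_inv_iff_mul_eq_one, ← hA.zero]
  exact hA.mul _ _ _ (by rw [piElt_star, inv_mul_cancel, piElt_zeroO])

theorem IsAffineRep.extT_inv (hA : D.IsAffineRep T p) {y : (V × ℝ) ≃ₗ[ℝ] (V × ℝ)}
    (hy : y ∈ D.extWeyl) : D.extT (fun i => (T i)⁻¹) p y = (D.extT T p y⁻¹)⁻¹ := by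
  induction hy using D.ext_induction with
  | hpi r => rw [hA.inv.extT_piElt, ← piElt_star, hA.extT_piElt, hA.pi_star, inv_inv]
  | hs y hy i h ih =>
    rw [hA.inv.extT_mul_of_pos hy h, ih, mul_inv_rev y,
      inv_eq_of_mul_eq_one_left (D.simpleReflection_mul_self i),
      hA.extT_simpleReflection_mul (inv_mem hy) (by rwa [inv_inv]), mul_inv_rev]

theorem IsAffineRep.weylT_inv (hA : D.IsAffineRep T p) {w : (V × ℝ) ≃ₗ[ℝ] (V × ℝ)}
    (hw : w ∈ D.weyl) : D.weylT (fun i => (T i)⁻¹) w = (D.weylT T w⁻¹)⁻¹ := by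
  rw [hA.inv.weylT_eq hw, hA.weylT_eq (inv_mem hw), hA.extT_inv (D.weyl_le_extWeyl hw)]

theorem IsLatticeRep.central_extT (hX : D.IsLatticeRep X T p c) (y : (V × ℝ) ≃ₗ[ℝ] (V × ℝ)) :
    Commute c (D.extT T p y) := by
  refine (show Commute c _ from hX.centralPi _).mul_right ?_
  refine Commute.list_prod_right _ _ fun g hg => ?_
  obtain ⟨i, -, rfl⟩ := List.mem_map.1 hg
  exact hX.centralT i

/-- For large `n` the element `Y_b` is a quotient of two elements `T_w`. -/
theorem IsLatticeRep.central_semiY (hX : D.IsLatticeRep X T p c) (hA : D.IsAffineRep T p)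
    (b : D.weights) : c * D.semiY T p b = D.semiY T p b * c := by
  obtain ⟨n, hn⟩ := (hA.eventually_semiT (D.translation_mem b.2)).exists
  rw [semiY, ← inv_mul_eq_iff_eq_mul.2 hn]
  exact ((hX.central_extT _).inv_right.mul_right (hX.central_extT _)).eq

/-- `τ_+(T_0) = q⁻¹ X_ϑ T_{s_ϑ} Y_ϑ⁻¹`. -/
theorem IsAffineRep.tauT_none_eq (hA : D.IsAffineRep T p) :
    D.tauT X T c none = D.hatT0 X (D.semiY T p) T c := by
  rw [tauT, hatT0, hA.semiY_theta]
  group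

/-- `τ_+(π_r) = q^{(ω_r, ω_r)/2} Y_r T_{u_r}⁻¹ X_{r*}⁻¹`. -/
theorem IsLatticeRep.tauPi_eq (hX : D.IsLatticeRep X T p c) (hA : D.IsAffineRep T p)
    (r : D.orbitO) : D.tauPi X p c r = D.hatPi X (D.semiY T p) T c r := by
  have hms := D.mk_zero_mem_affLattice (D.omega_mem (D.star r))
  have h1 := hX.p_affX r (neg_mem hms)
  have h0 : D.omega D.zeroO = 0 := rfl
  have h2 : -(D.omega D.zeroO - D.omega r, D.form.form (D.omega r) (D.omega r) / 2 +
      D.form.form (D.omega (D.star r)) (D.omega (D.star r)) / 2 -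
        D.form.form (D.omega D.zeroO) (D.omega D.zeroO) / 2) =
      ((D.fundWeight r : V), -(D.form.form (D.omega r) (D.omega r) / 2) +
        -(D.form.form (D.omega r) (D.omega r) / 2)) := by
    rw [D.form_omega_star, h0]
    ext
    · simp [fundWeight]
    · simp; ring
  have h3 : D.affX X c (D.omega (D.star r), 0) = X (D.fundWeight (D.star r)) :=
    D.affX_mk_zero X c (D.fundWeight (D.star r))
  have hr := D.half_form_mem_qLattice (D.omega_mem r) (D.omega_mem r)
  rw [map_neg, D.piElt_omega (D.star_mul r), h2, affX_mk, hX.affX_neg hms, h3,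
    D.qpow_add c (neg_mem hr), ← mul_assoc, ← D.qpow_commute (hX.centralX _)] at h1
  rw [hatPi, hA.semiY_fundWeight, mul_assoc (D.qpow c _), mul_inv_cancel_right, mul_assoc, h1,
    D.qpow_neg c hr, tauPi, D.qpow_neg c hr]
  have h4 : Commute (D.qpow c (D.form.form (D.omega r) (D.omega r) / 2)) (X (D.fundWeight r)) :=
    D.qpow_commute (hX.centralX _) _
  have h5 := h4.inv_left.eq
  generalize D.qpow c (D.form.form (D.omega r) (D.omega r) / 2) = Q at *
  rw [h5]
  simp only [mul_assoc]
  rw [← mul_assoc Q, h4.eq, mul_assoc, mul_inv_cancel_left, ← mul_assoc, h5, mul_assoc]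

/-- This makes `𝔭𝔯` well defined. At nodes `i > 0` it is the pair of relations of `T_i` with `Y_b`.
At node `0` the image is `q⁻¹ U Y_ϑ⁻¹` with `U = X_ϑ T_{s_ϑ}`, and the exchange relations of `U`
apply. For `π_r` the image is `q^{(ω_r, ω_r)/2} Y_r (X_{r*} T_{u_r})⁻¹`, and `u_semiY` is used at
`r*` since `u_{r*} = u_r⁻¹`. -/
theorem isLatticeRep_semiY (hX : D.IsLatticeRep X T p c) (hA : D.IsAffineRep T p) :
    D.IsLatticeRep (D.semiY T p) (fun i => (D.tauT X T c i)⁻¹) (D.tauPi X p c) c⁻¹ where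
  centralT i := ((show Commute c _ from hX.central_tauT i).inv_left.inv_right).eq
  centralPi r := (show Commute c _ from hX.central_tauPi r).inv_left.eq
  rel := by
    have hYc : ∀ a b, D.semiY T p a * D.semiY T p b = D.semiY T p b * D.semiY T p a := fun a b => by
      rw [← hA.semiY_add, ← hA.semiY_add, add_comm]
    have hqY : ∀ j b, Commute (D.qpow c j) (D.semiY T p b) := fun j b =>
      D.qpow_commute (hX.central_semiY hA b) j
    have hqU : ∀ j, Commute (D.qpow c j) (X D.thetaWeight * D.weylT T D.thetaReflection) := fun j =>
      D.qpow_commute ((show Commute c _ from hX.centralX _).mul_right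
        (show Commute c _ from hX.central_weylT _)).eq j
    have hT0 : D.tauT X T c none = D.qpow c (-1) *
        (X D.thetaWeight * D.weylT T D.thetaReflection) * (D.semiY T p D.thetaWeight)⁻¹ := by
      rw [hA.tauT_none_eq, hatT0, mul_assoc (D.qpow c _)]
    rintro _ _ (⟨a, b⟩ | ⟨b⟩ | ⟨i, b, h⟩ | ⟨i, b, h⟩ | ⟨r, b, b', j, h⟩)
    · exact hA.semiY_add a b
    · exact (show Commute c _ from hX.central_semiY hA b).inv_left.eq
    · cases i with
      | none =>
        -- The hypothesis says `(b, ϑ^∨) = -1`, so the exchange relation at pairing `1` is applied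
        -- to `b + ϑ`.
        have h' : R.coroot' D.theta ((b + D.thetaWeight : D.weights) : V) = 1 := by
          rw [corootForm, LinearMap.neg_apply] at h
          have h2 : R.coroot' D.theta (D.thetaWeight : V) = 2 := by
            change R.coroot' D.theta (R.root D.theta) = 2
            rw [RootPairing.root_coroot'_eq_pairing, RootPairing.pairing_same]
          rw [AddSubgroup.coe_add, map_add, h2]
          linarith
        have h1 := hX.theta_semiY_theta hA (b + D.thetaWeight) h'
        have h3 : D.simpleWeight none = -D.thetaWeight := rfl
        have h4 : (D.simpleRoot none).2 = 1 := rfl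
        rw [add_sub_cancel_right, hA.semiY_add] at h1
        rw [hT0, h3, h4, hA.semiY_neg, D.qpow_inv c D.one_mem_qLattice,
          D.qpow_neg c D.one_mem_qLattice]
        have h5 := hqU 1
        have h6 := hqY 1
        have h7 := hYc b D.thetaWeight
        have h8 := h6 D.thetaWeight
        have h9 := h6 b
        generalize X D.thetaWeight * D.weylT T D.thetaReflection = U at *
        generalize D.semiY T p D.thetaWeight = Z at *
        generalize D.semiY T p b = Y at *
        generalize D.qpow c 1 = Q at *
        have h10 : U⁻¹ * (Y * Z) * U⁻¹ = Y * Q⁻¹ := by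
          have : Y * Z = U * Y * U * Q⁻¹ := by rw [h1]; group
          rw [this]
          have := h5.inv_left.eq
          calc _ = Y * (U * Q⁻¹) * U⁻¹ := by group
            _ = _ := by rw [← this]; group
        have h11 : (Q⁻¹ * U * Z⁻¹)⁻¹ = Z * U⁻¹ * Q := by group
        rw [h11]
        have h12 : Z * U⁻¹ * Q = Q * (Z * U⁻¹) := (h8.mul_right h5.inv_right).eq.symm
        calc Z * U⁻¹ * Q * Y * (Z * U⁻¹ * Q) = (Z * U⁻¹ * Q) * (Y * Z * U⁻¹ * Q) := by group
          _ = Q * Z * (U⁻¹ * (Y * Z) * U⁻¹) * Q := by rw [h12]; group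
          _ = Q * (Y * Z) := by rw [h10, h7]; group
          _ = Y * (Z⁻¹ * Q⁻¹)⁻¹ := by
            rw [mul_inv_rev, inv_inv, inv_inv, ← mul_assoc, h9.eq, mul_assoc]
      | some i =>
        have h3 : (D.simpleRoot (some i)).2 = 0 := rfl
        have := hX.inv_T_semiY_inv_T hA i b h
        rw [h3, qpow_zero, mul_one]
        exact this
    · cases i with
      | none =>
        have h' : R.coroot' D.theta (b : V) = 0 := by
          rw [corootForm, LinearMap.neg_apply] at h
          linarith
        have h1 : Commute _ _ := hX.theta_semiY hA b h'
        have h2 : Commute _ _ := hYc D.thetaWeight b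
        rw [hT0]
        exact ((((hqY _ _).mul_left h1).mul_left h2.inv_left).inv_left).eq
      | some i => exact (show Commute _ _ from hX.T_semiY hA i b h).inv_left.eq
    · have h1 := D.piElt_apply r (b : V) 0
      rw [h, Prod.mk.injEq] at h1
      have hj : D.form.form (D.omega (D.star r)) b = j := by
        have h3 := D.form_weyl (inv_mem (D.u_mem r)) (D.u r (D.omega r, 0)).1 b
        have h4 : (D.u r)⁻¹ ((D.u r (D.omega r, 0)).1, 0) = (D.omega r, 0) := by
          rw [← D.weyl_apply_mk (D.u_mem r), ← LinearEquiv.mul_apply, inv_mul_cancel]; rfl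
        rw [h4] at h3
        rw [omega_star, map_neg, LinearMap.neg_apply, ← h3, h1.2, zero_sub]
      have hjq : j ∈ D.qLattice := by
        rw [← hj]; exact D.form_mem_qLattice (D.omega_mem _) b.2
      have h2 := hX.u_semiY hA (D.star r) b b' (by
        rw [u_star, D.weyl_apply_mk (inv_mem (D.u_mem r)), ← h1.1])
      rw [hj, u_star, inv_inv] at h2
      rw [hX.tauPi_eq hA, hatPi, D.qpow_inv c hjq, D.qpow_neg c hjq]
      have h5 : Commute _ _ := hYc (D.fundWeight r) b'
      have h6 := hqY j (D.fundWeight r)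
      have h7 := hqY (D.form.form (D.omega r) (D.omega r) / 2) b'
      have h9 : Commute (D.qpow c (D.form.form (D.omega r) (D.omega r) / 2)) (D.qpow c j) :=
        ((Commute.refl c).zpow_left _).zpow_right _
      have h10 := hqY j b'
      have h11 := D.qpow_commute ((show Commute c _ from hX.centralX
        (D.fundWeight (D.star r))).mul_right (show Commute c _ from
          hX.central_weylT (D.u r))).eq j
      generalize X (D.fundWeight (D.star r)) = A at *
      generalize D.weylT T (D.u r) = W at *
      generalize D.semiY T p (D.fundWeight r) = Z at *
      generalize D.semiY T p b = B at *
      generalize D.semiY T p b' = B' at *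
      generalize D.qpow c (D.form.form (D.omega r) (D.omega r) / 2) = Q at *
      generalize D.qpow c j = q at *
      have h8 : (A * W)⁻¹ * B * (A * W) = B' * q⁻¹ := by
        rw [mul_assoc, inv_mul_eq_iff_eq_mul, ← mul_assoc (A * W) B', h2, mul_assoc B, h11]
        group
      calc _ = Q * Z * ((A * W)⁻¹ * B * (A * W)) * (Q * Z)⁻¹ := by group
        _ = _ := by
          rw [h8, mul_inv_eq_iff_eq_mul]
          exact ((h7.mul_left h5).mul_right (h9.inv_right.mul_left h6.symm.inv_right)).eq

end Rep

end AffineData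

end

/-! ### All `Y_b` from `Y_ϑ`, the `Y_r` and the finite `T_i`. -/

set_option linter.unusedSectionVars false

noncomputable section

namespace AffineData

variable {ι V N : Type*} [AddCommGroup V] [Module ℝ V] [AddCommGroup N] [Module ℝ N]
  {R : RootPairing ι ℝ V N} (D : AffineData R)

variable [R.IsRootSystem] [Finite ι] [R.IsCrystallographic] [R.IsReduced]

/-! ### Maps that agree on enough of the `Y_b` -/

/-- A subgroup of the weights that contains `ϑ` and the `ω_r`, `r ∈ O`, and is stable under those
simple reflections that change an element by a multiple of a simple root in `{0, ±1}`, contains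
all weights. -/
theorem weights_le_of_stable (S : AddSubgroup V) (hθ : R.root D.theta ∈ S)
    (hω : ∀ r : D.orbitO, D.omega r ∈ S)
    (hs : ∀ (i : D.Simple) (v : V), v ∈ S → R.coroot' i v = 1 → v - R.root i ∈ S) :
    D.weights ≤ S := by
  have hs' : ∀ (i : D.Simple) (v : V), v ∈ S → R.coroot' i v = -1 → v + R.root i ∈ S := by
    intro i v hv h
    have := S.neg_mem (hs i (-v) (S.neg_mem hv) (by rw [map_neg, h, neg_neg]))
    rwa [neg_sub, sub_neg_eq_add, add_comm] at this
  -- For `wϑ ≠ ±α_i` the pairing `(wϑ, α_i^∨)` equals some `(ϑ, β^∨)` in `{0, ±1}`, so `s_i` is an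
  -- allowed reflection; for `wϑ = ±α_i` it acts as negation.
  have horbit : ∀ w ∈ D.weyl, (w (R.root D.theta, 0)).1 ∈ S := by
    intro w hw
    have key : ∀ (i : D.Simple) (w : (V × ℝ) ≃ₗ[ℝ] (V × ℝ)), w ∈ D.weyl →
        (w (R.root D.theta, 0)).1 ∈ S →
        ((D.simpleReflection (some i) * w) (R.root D.theta, 0)).1 ∈ S := by
      intro i w hw h
      have h1 : ((D.simpleReflection (some i) * w) (R.root D.theta, 0)).1 =
          (w (R.root D.theta, 0)).1 - R.coroot' i (w (R.root D.theta, 0)).1 • R.root i := rfl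
      obtain ⟨g, hg, rfl⟩ := D.exists_of_mem_weyl hw
      rw [h1]
      simp only [prodOne_apply] at h ⊢
      obtain ⟨β, hβ⟩ : ∃ β, g (R.root β) = R.root i := by
        obtain ⟨g', hg', h2⟩ := D.exists_of_mem_weyl (inv_mem hw)
        obtain ⟨β, hβ⟩ := hg'.root i
        refine ⟨β, ?_⟩
        have h3 := LinearEquiv.congr_fun h2 (R.root i, 0)
        rw [prodOne_apply, hβ] at h3
        have h4 := congrArg (prodOne g) h3
        rw [← LinearEquiv.mul_apply, mul_inv_cancel] at h4
        exact (congrArg Prod.fst h4).symm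
      have h5 : R.coroot' i (g (R.root D.theta)) = R.pairing D.theta β := by
        have h6 := hg.form (R.root D.theta) (R.root β)
        rw [hβ, D.form_root, D.form_root, RootPairing.root_coroot'_eq_pairing] at h6
        have h7 : D.halfNorm i = D.halfNorm β := by
          rw [halfNorm, halfNorm, ← hg.form (R.root β), hβ]
        rw [h7] at h6
        exact mul_left_cancel₀ (D.halfNorm_pos β).ne' h6
      rw [h5]
      rcases D.pairing_theta_cases β with h0 | h0 | h0 | h0 | h0
      · rwa [h0, zero_smul, sub_zero]
      · rw [h0, one_smul]
        exact hs i _ h (h5.trans h0)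
      · rw [h0, neg_one_smul, sub_neg_eq_add]
        exact hs' i _ h (h5.trans h0)
      · rw [h0, RootPairing.pairing_same, ← hβ, h0, two_smul, sub_add_cancel_left]
        exact S.neg_mem h
      · have h8 : R.pairing D.theta β = -2 := by
          have : β = R.reflectionPerm D.theta D.theta := R.root.injective (by rw [h0]; simp)
          rw [this]
          simp
        rw [h8, ← hβ, h0, map_neg]
        have : g (R.root D.theta) - (-2 : ℝ) • -g (R.root D.theta) = -g (R.root D.theta) := by
          module
        rw [this]
        exact S.neg_mem h
    unfold weyl at hw
    induction hw using Subgroup.closure_induction_left with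
    | one => exact hθ
    | mul_left x hx y hy ih =>
      obtain ⟨i, rfl⟩ := hx
      exact key i y hy ih
    | inv_mul_cancel x hx y hy ih =>
      obtain ⟨i, rfl⟩ := hx
      rw [inv_eq_of_mul_eq_one_left (D.simpleReflection_mul_self (some i))]
      exact key i y hy ih
  -- Since `s_0` is translation by `ϑ` times `s_ϑ`, the translation parts in the affine Weyl group
  -- are sums of elements of the orbit of `ϑ`. The statement carries the whole `W`-orbit of `a` so
  -- that `u_r⁻¹` can be applied at the end.
  have haff : ∀ y ∈ D.affineWeyl, ∃ a : V, (∀ w ∈ D.weyl, (w (a, 0)).1 ∈ S) ∧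
      ∃ w ∈ D.weyl, y = D.translation a * w := by
    intro y hy
    have key : ∀ (y : (V × ℝ) ≃ₗ[ℝ] (V × ℝ)) (i : D.Node),
        (∃ a : V, (∀ w ∈ D.weyl, (w (a, 0)).1 ∈ S) ∧ ∃ w ∈ D.weyl, y = D.translation a * w) →
        ∃ a : V, (∀ w ∈ D.weyl, (w (a, 0)).1 ∈ S) ∧
          ∃ w ∈ D.weyl, y * D.simpleReflection i = D.translation a * w := by
      rintro y i ⟨a, ha, w, hw, rfl⟩
      cases i with
      | none =>
        refine ⟨a + (w (R.root D.theta, 0)).1, fun v hv => ?_, w * D.thetaReflection,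
          mul_mem hw D.thetaReflection_mem, ?_⟩
        · have h1 : v (a + (w (R.root D.theta, 0)).1, 0) =
              v (a, 0) + (v * w) (R.root D.theta, 0) := by
            rw [LinearEquiv.mul_apply, ← map_add, D.weyl_apply_mk hw (R.root D.theta) 0]
            simp
          rw [h1]
          exact S.add_mem (ha v hv) (horbit _ (mul_mem hv hw))
        · rw [simpleReflection_none, translation_add, ← mul_assoc, mul_assoc _ w,
            D.weyl_mul_translation hw]
          simp only [mul_assoc]
      | some i =>
        exact ⟨a, ha, w * D.simpleReflection (some i),
          mul_mem hw (Subgroup.subset_closure ⟨i, rfl⟩), mul_assoc _ _ _⟩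
    unfold affineWeyl at hy
    induction hy using Subgroup.closure_induction_right with
    | one =>
      exact ⟨0, fun w _ => by rw [show ((0 : V), (0 : ℝ)) = 0 from rfl, map_zero]; exact S.zero_mem,
        1, one_mem _, by rw [translation_zero, one_mul]⟩
    | mul_right x hx y hy ih =>
      obtain ⟨i, rfl⟩ := hy
      exact key x i ih
    | mul_inv_cancel x hx y hy ih =>
      obtain ⟨i, rfl⟩ := hy
      rw [inv_eq_of_mul_eq_one_left (D.simpleReflection_mul_self i)]
      exact key x i ih
  intro b hb
  -- The translation by `b` lies in `π_r` times the affine Weyl group, so `b = ω_r + u_r⁻¹(a)` for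
  -- the translation part `a` of the second factor.
  obtain ⟨r, hr⟩ := D.exists_piElt_mul_mem (D.translation_mem hb)
  obtain ⟨a, ha, w, hw, h⟩ := haff _ hr
  have hu := inv_mem (D.u_mem r)
  rw [inv_mul_eq_iff_eq_mul, piElt, mul_assoc, ← mul_assoc _ _ w, D.weyl_mul_translation hu,
    ← mul_assoc, ← mul_assoc, ← translation_add, mul_assoc, ← mul_one (D.translation b)] at h
  rw [D.translation_mul_weyl_inj (one_mem _) (mul_mem hu hw) h]
  exact S.add_mem (hω r) (ha _ hu)

section Rep

variable {G H : Type*} [Group G] [Group H]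

variable {D} {X : D.weights → G} {T : D.Node → G} {p : D.orbitO → G} {c : G}

/-- The weights at which the two sides agree form a subgroup. The relation `T_i⁻¹ Y_b T_i⁻¹ = Y_b
Y_{α_i}⁻¹`, valid on both sides, makes it stable under `b ↦ b - α_i` when `(b, α_i^∨) = 1`. -/
theorem IsLatticeRep.map_semiY (hX : D.IsLatticeRep X T p c) (hA : D.IsAffineRep T p) (φ : G →* H)
    (Z : D.weights → H) (hZ : ∀ a b, Z (a + b) = Z a * Z b)
    (hs : ∀ (i : D.Simple) (b : D.weights), R.coroot' i (b : V) = 1 →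
      (φ (T (some i)))⁻¹ * Z b * (φ (T (some i)))⁻¹ = Z b * (Z (D.simpleWeight (some i)))⁻¹)
    (hθ : φ (D.semiY T p D.thetaWeight) = Z D.thetaWeight)
    (hω : ∀ r : D.orbitO, φ (D.semiY T p (D.fundWeight r)) = Z (D.fundWeight r))
    (b : D.weights) : φ (D.semiY T p b) = Z b := by
  have hZ0 : Z 0 = 1 := by simpa using hZ 0 0
  have hZn : ∀ a, Z (-a) = (Z a)⁻¹ := fun a => by
    rw [eq_inv_iff_mul_eq_one, ← hZ, neg_add_cancel, hZ0]
  let S : AddSubgroup D.weights :=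
    { carrier := {b | φ (D.semiY T p b) = Z b}
      add_mem' := fun {a b} ha hb => by
        change φ _ = _
        rw [hA.semiY_add, map_mul, hZ, ha, hb]
      zero_mem' := by
        change φ _ = _
        rw [hA.semiY_zero, map_one, hZ0]
      neg_mem' := fun {a} ha => by
        change φ _ = _
        rw [hA.semiY_neg, map_inv, hZn, ha] }
  have h := D.weights_le_of_stable (S.map D.weights.subtype) ⟨D.thetaWeight, hθ, rfl⟩
    (fun r => ⟨D.fundWeight r, hω r, rfl⟩) ?_ b.2
  · obtain ⟨b', hb', h⟩ := h
    exact Subtype.ext h ▸ hb'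
  · rintro i _ ⟨v, hv, rfl⟩ h1
    refine ⟨v - D.simpleWeight (some i), ?_, rfl⟩
    change φ _ = _
    rw [sub_eq_add_neg, hA.semiY_add, hA.semiY_neg, ← hX.inv_T_semiY_inv_T hA i v h1, map_mul,
      map_mul, map_inv, show φ (D.semiY T p v) = Z v from hv, hs i v h1, hZ, hZn]

end Rep

end AffineData

end

/-! ### Universal properties of the two presented groups. -/

set_option linter.unusedSectionVars false

noncomputable section

namespace AffineData

variable {ι V N : Type*} [AddCommGroup V] [Module ℝ V] [AddCommGroup N] [Module ℝ N]
  {R : RootPairing ι ℝ V N} (D : AffineData R)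

variable [R.IsRootSystem] [Finite ι] [R.IsCrystallographic] [R.IsReduced]

/-! ### Homomorphisms from the two double affine braid groups -/

section Maps

variable {G H : Type*} [Group G] [Group H]

variable {D} {X Y : D.weights → G} {T T' : D.Node → G} {p : D.orbitO → G} {c : G}

theorem map_braidWord (φ : G →* H) (i j : D.Node) :
    φ (D.braidWord T i j) = D.braidWord (fun i => φ (T i)) i j := by
  rw [braidWord, braidWord, map_list_prod, List.map_map]
  rfl

theorem map_weylT (φ : G →* H) (w : (V × ℝ) ≃ₗ[ℝ] (V × ℝ)) :
    φ (D.weylT T w) = D.weylT (fun i => φ (T i)) w := by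
  rw [weylT, weylT, map_list_prod, List.map_map]
  rfl

theorem weylT_congr (h : ∀ i : D.Simple, T (some i) = T' (some i))
    (w : (V × ℝ) ≃ₗ[ℝ] (V × ℝ)) : D.weylT T w = D.weylT T' w := by
  rw [weylT, weylT]
  simp_rw [h]

theorem map_hatT0 (φ : G →* H) : φ (D.hatT0 X Y T c) =
    D.hatT0 (fun b => φ (X b)) (fun b => φ (Y b)) (fun i => φ (T i)) (φ c) := by
  simp only [hatT0, map_mul, map_inv, map_qpow, map_weylT]

theorem map_hatPi (φ : G →* H) (r : D.orbitO) : φ (D.hatPi X Y T c r) =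
    D.hatPi (fun b => φ (X b)) (fun b => φ (Y b)) (fun i => φ (T i)) (φ c) r := by
  simp only [hatPi, map_mul, map_inv, map_qpow, map_weylT]

theorem hatT0_congr (h : ∀ i : D.Simple, T (some i) = T' (some i)) :
    D.hatT0 X Y T c = D.hatT0 X Y T' c := by
  rw [hatT0, hatT0, weylT_congr h]

theorem hatPi_congr (h : ∀ i : D.Simple, T (some i) = T' (some i)) (r : D.orbitO) :
    D.hatPi X Y T c r = D.hatPi X Y T' c r := by
  rw [hatPi, hatPi, weylT_congr h]

theorem AffineRel.map (φ : G →* H) {a b : G} (h : D.AffineRel T p c a b) :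
    D.AffineRel (fun i => φ (T i)) (fun r => φ (p r)) (φ c) (φ a) (φ b) := by
  cases h with
  | braid i j => rw [map_braidWord, map_braidWord]; exact .braid i j
  | mul r s t h => rw [map_mul]; exact .mul r s t h
  | conj r i j h => rw [map_mul, map_mul, map_inv]; exact .conj r i j h
  | centralT i => rw [map_mul, map_mul]; exact .centralT i
  | centralPi r => rw [map_mul, map_mul]; exact .centralPi r

theorem AffineRel.of_map (φ : G →* H) {a b : H}
    (h : D.AffineRel (fun i => φ (T i)) (fun r => φ (p r)) (φ c) a b) :
    ∃ a' b', D.AffineRel T p c a' b' ∧ φ a' = a ∧ φ b' = b := by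
  cases h with
  | braid i j => exact ⟨_, _, .braid i j, map_braidWord φ i j, map_braidWord φ j i⟩
  | mul r s t h => exact ⟨_, _, .mul r s t h, map_mul .., rfl⟩
  | conj r i j h => exact ⟨_, _, .conj r i j h, by simp, rfl⟩
  | centralT i => exact ⟨_, _, .centralT i, map_mul .., map_mul ..⟩
  | centralPi r => exact ⟨_, _, .centralPi r, map_mul .., map_mul ..⟩

theorem LatticeRel.map (φ : G →* H) {a b : G} (h : D.LatticeRel X T p c a b) :
    D.LatticeRel (fun b => φ (X b)) (fun i => φ (T i)) (fun r => φ (p r)) (φ c) (φ a) (φ b) := by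
  cases h with
  | add a b => rw [map_mul]; exact .add a b
  | central b => rw [map_mul, map_mul]; exact .central b
  | cross i b h =>
    rw [map_mul, map_mul, map_mul, map_inv, map_mul, map_qpow]
    exact .cross i b h
  | comm i b h => rw [map_mul, map_mul]; exact .comm i b h
  | pi r b b' j h => rw [map_mul, map_mul, map_mul, map_inv, map_qpow]; exact .pi r b b' j h

theorem LatticeRel.of_map (φ : G →* H) {a b : H}
    (h : D.LatticeRel (fun b => φ (X b)) (fun i => φ (T i)) (fun r => φ (p r)) (φ c) a b) :
    ∃ a' b', D.LatticeRel X T p c a' b' ∧ φ a' = a ∧ φ b' = b := by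
  cases h with
  | add a b => exact ⟨_, _, .add a b, rfl, map_mul ..⟩
  | central b => exact ⟨_, _, .central b, map_mul .., map_mul ..⟩
  | cross i b h => exact ⟨_, _, .cross i b h, by simp, by simp [map_qpow]⟩
  | comm i b h => exact ⟨_, _, .comm i b h, map_mul .., map_mul ..⟩
  | pi r b b' j h => exact ⟨_, _, .pi r b b' j h, by simp, by simp [map_qpow]⟩

theorem isAffineRep_of_rel (h : ∀ a b, D.AffineRel T p c a b → a = b) : D.IsAffineRep T p where
  braid i j := h _ _ (.braid i j)
  mul r s t hr := h _ _ (.mul r s t hr)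
  conj r i j hr := h _ _ (.conj r i j hr)

theorem IsAffineRep.rel (hA : D.IsAffineRep T p) (hX : D.IsLatticeRep X T p c) {a b : G}
    (h : D.AffineRel T p c a b) : a = b := by
  cases h with
  | braid i j => exact hA.braid i j
  | mul r s t h => exact hA.mul r s t h
  | conj r i j h => exact hA.conj r i j h
  | centralT i => exact hX.centralT i
  | centralPi r => exact hX.centralPi r

end Maps

theorem bRel_affine {a b : D.BGroup} (h : D.AffineRel D.bT D.bPi D.bq a b) : a = b := by
  obtain ⟨a', b', h', rfl, rfl⟩ := AffineRel.of_map (PresentedGroup.mk D.bRels) h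
  exact PresentedGroup.mk_eq_mk_of_mul_inv_mem ⟨a', b', rfl, Or.inl h'⟩

theorem bRel_lattice {a b : D.BGroup} (h : D.LatticeRel D.bX D.bT D.bPi D.bq a b) : a = b := by
  obtain ⟨a', b', h', rfl, rfl⟩ := LatticeRel.of_map (PresentedGroup.mk D.bRels) h
  exact PresentedGroup.mk_eq_mk_of_mul_inv_mem ⟨a', b', rfl, Or.inr h'⟩

theorem isAffineRep_b : D.IsAffineRep D.bT D.bPi := isAffineRep_of_rel fun _ _ => D.bRel_affine

theorem isLatticeRep_b : D.IsLatticeRep D.bX D.bT D.bPi D.bq where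
  centralT i := D.bRel_affine (.centralT i)
  centralPi r := D.bRel_affine (.centralPi r)
  rel _ _ := D.bRel_lattice

theorem uRel_affine {a b : D.UGroup} (h : D.AffineRel D.uT D.uPi D.uq a b) : a = b := by
  obtain ⟨a', b', h', rfl, rfl⟩ := AffineRel.of_map (PresentedGroup.mk D.uRels) h
  exact PresentedGroup.mk_eq_mk_of_mul_inv_mem ⟨a', b', rfl, Or.inl h'⟩

theorem isAffineRep_u : D.IsAffineRep D.uT D.uPi := isAffineRep_of_rel fun _ _ => D.uRel_affine

theorem isLatticeRep_uX : D.IsLatticeRep D.uX D.uT D.uPi D.uq where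
  centralT i := D.uRel_affine (.centralT i)
  centralPi r := D.uRel_affine (.centralPi r)
  rel _ _ h := by
    obtain ⟨a', b', h', rfl, rfl⟩ := LatticeRel.of_map (PresentedGroup.mk D.uRels) h
    exact PresentedGroup.mk_eq_mk_of_mul_inv_mem ⟨a', b', rfl, Or.inr (Or.inl h')⟩

theorem isLatticeRep_uY : D.IsLatticeRep D.uY (fun i => (D.uT i)⁻¹) D.uPi D.uq⁻¹ where
  centralT i :=
    ((show Commute _ _ from D.isLatticeRep_uX.centralT i).inv_left.inv_right).eq
  centralPi r := (show Commute _ _ from D.isLatticeRep_uX.centralPi r).inv_left.eq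
  rel _ _ h := by
    obtain ⟨a', b', h', rfl, rfl⟩ := LatticeRel.of_map (PresentedGroup.mk D.uRels)
      (X := fun b => FreeGroup.of (UGen.Y b)) (T := fun i => (FreeGroup.of (UGen.T i))⁻¹)
      (p := fun r => FreeGroup.of (UGen.pi r)) (c := (FreeGroup.of UGen.q)⁻¹) h
    exact PresentedGroup.mk_eq_mk_of_mul_inv_mem ⟨a', b', rfl, Or.inr (Or.inr h')⟩

section Lift

variable {G : Type*} [Group G]

variable {D} {X Y : D.weights → G} {T : D.Node → G} {p : D.orbitO → G} {c : G}

/-- The function on the generators of `𝔅` with given values. -/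
def BGen.values (X : D.weights → G) (T : D.Node → G) (p : D.orbitO → G) (c : G) : D.BGen → G
  | .X b => X b
  | .T i => T i
  | .pi r => p r
  | .q => c

/-- The function on the generators of the universal group with given values. -/
def UGen.values (X Y : D.weights → G) (T : D.Node → G) (p : D.orbitO → G) (c : G) : D.UGen → G
  | .X b => X b
  | .Y b => Y b
  | .T i => T i
  | .pi r => p r
  | .q => c

/-- The homomorphism from `𝔅` with given values on the generators. -/
def bLift (hA : D.IsAffineRep T p) (hX : D.IsLatticeRep X T p c) : D.BGroup →* G :=
  PresentedGroup.toGroup (rels := D.bRels) (f := BGen.values X T p c) <| by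
    rintro _ ⟨a, b, rfl, h⟩
    rw [map_mul, map_inv, mul_inv_eq_one]
    rcases h with h | h
    all_goals
      have := h.map (FreeGroup.lift (BGen.values X T p c))
      simp only [FreeGroup.lift_apply_of] at this
    · exact hA.rel hX this
    · exact hX.rel _ _ this

/-- The homomorphism from the universal group with given values on the generators. -/
def uLift (hA : D.IsAffineRep T p) (hX : D.IsLatticeRep X T p c)
    (hY : D.IsLatticeRep Y (fun i => (T i)⁻¹) p c⁻¹) : D.UGroup →* G :=
  PresentedGroup.toGroup (rels := D.uRels) (f := UGen.values X Y T p c) <| by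
    rintro _ ⟨a, b, rfl, h⟩
    rw [map_mul, map_inv, mul_inv_eq_one]
    rcases h with h | h | h
    all_goals
      have := h.map (FreeGroup.lift (UGen.values X Y T p c))
      simp only [FreeGroup.lift_apply_of, map_inv] at this
    · exact hA.rel hX this
    · exact hX.rel _ _ this
    · exact hY.rel _ _ this

section

variable (hA : D.IsAffineRep T p) (hX : D.IsLatticeRep X T p c)

theorem bLift_X (b : D.weights) : bLift hA hX (D.bX b) = X b := PresentedGroup.toGroup.of _

theorem bLift_T (i : D.Node) : bLift hA hX (D.bT i) = T i := PresentedGroup.toGroup.of _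

theorem bLift_pi (r : D.orbitO) : bLift hA hX (D.bPi r) = p r := PresentedGroup.toGroup.of _

theorem bLift_q : bLift hA hX D.bq = c := PresentedGroup.toGroup.of _

variable (hY : D.IsLatticeRep Y (fun i => (T i)⁻¹) p c⁻¹)

theorem uLift_X (b : D.weights) : uLift hA hX hY (D.uX b) = X b := PresentedGroup.toGroup.of _

theorem uLift_Y (b : D.weights) : uLift hA hX hY (D.uY b) = Y b := PresentedGroup.toGroup.of _

theorem uLift_T (i : D.Node) : uLift hA hX hY (D.uT i) = T i := PresentedGroup.toGroup.of _

theorem uLift_pi (r : D.orbitO) : uLift hA hX hY (D.uPi r) = p r := PresentedGroup.toGroup.of _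

theorem uLift_q : uLift hA hX hY D.uq = c := PresentedGroup.toGroup.of _

end

theorem bGroup_hom_ext {φ ψ : D.BGroup →* G} (hX : ∀ b, φ (D.bX b) = ψ (D.bX b))
    (hT : ∀ i, φ (D.bT i) = ψ (D.bT i)) (hp : ∀ r, φ (D.bPi r) = ψ (D.bPi r))
    (hq : φ D.bq = ψ D.bq) : φ = ψ := by
  refine PresentedGroup.ext fun x => ?_
  cases x with
  | X b => exact hX b
  | T i => exact hT i
  | pi r => exact hp r
  | q => exact hq

theorem uGroup_hom_ext {φ ψ : D.UGroup →* G} (hX : ∀ b, φ (D.uX b) = ψ (D.uX b))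
    (hY : ∀ b, φ (D.uY b) = ψ (D.uY b))
    (hT : ∀ i, φ (D.uT i) = ψ (D.uT i)) (hp : ∀ r, φ (D.uPi r) = ψ (D.uPi r))
    (hq : φ D.uq = ψ D.uq) : φ = ψ := by
  refine PresentedGroup.ext fun x => ?_
  cases x with
  | X b => exact hX b
  | Y b => exact hY b
  | T i => exact hT i
  | pi r => exact hp r
  | q => exact hq

end Lift

end AffineData

end

/-! ### Construction of `τ_+`, `𝔭𝔯` and the involutions. -/

set_option linter.unusedSectionVars false

noncomputable section

namespace AffineData

variable {ι V N : Type*} [AddCommGroup V] [Module ℝ V] [AddCommGroup N] [Module ℝ N]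
  {R : RootPairing ι ℝ V N} (D : AffineData R)

variable [R.IsRootSystem] [Finite ι] [R.IsCrystallographic] [R.IsReduced]

/-! ### The duality on the images of the generators -/

section Rep

variable {G : Type*} [Group G]

variable {D} {X : D.weights → G} {T : D.Node → G} {p : D.orbitO → G} {c : G}

/-- The first relation of `(*)` is self-dual: with `Y_ϑ = T_0 T_{s_ϑ}`, both the inverse of `q⁻¹ X_ϑ
T_0⁻¹` and the dual expression `q Y_ϑ T_{s_ϑ}⁻¹ X_ϑ⁻¹` are equal to `q T_0 X_ϑ⁻¹`. -/
theorem IsLatticeRep.dual_hatT0 (hX : D.IsLatticeRep X T p c) (hA : D.IsAffineRep T p) :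
    (D.tauT X T c none)⁻¹ = D.hatT0 (D.semiY T p) X (fun i => (D.tauT X T c i)⁻¹) c⁻¹ := by
  have h : D.weylT (fun i => (D.tauT X T c i)⁻¹) D.thetaReflection =
      D.weylT (fun i => (T i)⁻¹) D.thetaReflection := weylT_congr (fun _ => rfl) _
  have h1 := D.qpow_commute ((show Commute c _ from hX.centralT none).mul_right
    (show Commute c _ from hX.centralX D.thetaWeight).inv_right).eq (-1)
  rw [hatT0, h, hA.weylT_inv D.thetaReflection_mem, hA.semiY_theta,
    inv_eq_of_mul_eq_one_left D.thetaReflection_mul_self, tauT,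
    D.qpow_inv c (neg_mem D.one_mem_qLattice), D.qpow_neg c (neg_mem D.one_mem_qLattice)]
  generalize D.qpow c (-1) = Q at *
  have h2 : Commute Q _ := h1
  simp only [mul_assoc, mul_inv_rev, inv_inv, mul_inv_cancel_left]
  rw [← mul_assoc, h2.inv_left.eq]

/-- The second relation is self-dual as well: `Y_{r*} = π_r⁻¹ T_{u_r⁻¹}` turns `q^{-(ω_r, ω_r)/2}
X_r T_{u_r⁻¹} Y_{r*}⁻¹` into `q^{-(ω_r, ω_r)/2} X_r π_r`. -/
theorem IsAffineRep.dual_hatPi (hA : D.IsAffineRep T p) (r : D.orbitO) :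
    D.tauPi X p c r =
      D.hatPi (D.semiY T p) X (fun i => (D.tauT X T c i)⁻¹) c⁻¹ r := by
  have h : D.weylT (fun i => (D.tauT X T c i)⁻¹) (D.u r) =
      D.weylT (fun i => (T i)⁻¹) (D.u r) := weylT_congr (fun _ => rfl) _
  have hq := D.half_form_mem_qLattice (D.omega_mem r) (D.omega_mem r)
  rw [hatPi, h, hA.weylT_inv (D.u_mem r), inv_inv, hA.semiY_fundWeight, u_star, hA.pi_star,
    D.qpow_inv c hq, tauPi]
  group

end Rep

/-! ### The automorphism `τ_+` -/

theorem qpow_bq_commute_bX (j : ℝ) (b : D.weights) : Commute (D.qpow D.bq j) (D.bX b) :=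
  D.qpow_commute (D.isLatticeRep_b.centralX b) j

/-- The endomorphism `τ_+` of `𝔅`. -/
def tauHom : D.BGroup →* D.BGroup :=
  bLift (isAffineRep_tau D.isLatticeRep_b D.isAffineRep_b) (isLatticeRep_tau D.isLatticeRep_b)

/-- The involution `X_b ↦ X_b⁻¹`, `T_i ↦ T_i⁻¹`, `π_r ↦ π_r`, `q ↦ q⁻¹` of `𝔅`. -/
def barHom : D.BGroup →* D.BGroup := bLift D.isAffineRep_b.inv D.isLatticeRep_b.neg_inv

theorem barHom_comp_barHom : D.barHom.comp D.barHom = MonoidHom.id _ := by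
  refine bGroup_hom_ext (fun b => ?_) (fun i => ?_) (fun r => ?_) ?_
  all_goals simp only [MonoidHom.comp_apply, MonoidHom.id_apply, barHom]
  · rw [bLift_X, bLift_X, neg_neg]
  · rw [bLift_T, map_inv, bLift_T, inv_inv]
  · rw [bLift_pi, bLift_pi]
  · rw [bLift_q, map_inv, bLift_q, inv_inv]

/-- Two involutions, `barHom` and this composite, make `τ_+` invertible, with inverse its conjugate
by `barHom`. -/
theorem tauHom_barHom_involutive :
    (D.tauHom.comp D.barHom).comp (D.tauHom.comp D.barHom) = MonoidHom.id _ := by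
  have hX : ∀ b, D.tauHom.comp D.barHom (D.bX b) = (D.bX b)⁻¹ := fun b => by
    rw [MonoidHom.comp_apply, barHom, bLift_X, tauHom, bLift_X, D.isLatticeRep_b.neg]
  have hT : ∀ i, D.tauHom.comp D.barHom (D.bT i) = (D.tauT D.bX D.bT D.bq i)⁻¹ := fun i => by
    rw [MonoidHom.comp_apply, barHom, bLift_T, map_inv, tauHom, bLift_T]
  have hp : ∀ r, D.tauHom.comp D.barHom (D.bPi r) = D.tauPi D.bX D.bPi D.bq r := fun r => by
    rw [MonoidHom.comp_apply, barHom, bLift_pi, tauHom, bLift_pi]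
  have hq : D.tauHom.comp D.barHom D.bq = D.bq⁻¹ := by
    rw [MonoidHom.comp_apply, barHom, bLift_q, map_inv, tauHom, bLift_q]
  generalize D.tauHom.comp D.barHom = φ at *
  refine bGroup_hom_ext (fun b => ?_) (fun i => ?_) (fun r => ?_) ?_
  all_goals rw [MonoidHom.comp_apply, MonoidHom.id_apply]
  · rw [hX, map_inv, hX, inv_inv]
  · rw [hT]
    cases i with
    | none =>
      have h1 := D.qpow_bq_commute_bX (-1) D.thetaWeight
      rw [tauT, map_inv, map_mul, map_mul, map_inv, map_qpow, hX, hT, hq, tauT,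
        D.qpow_inv _ (neg_mem D.one_mem_qLattice), D.qpow_neg _ (neg_mem D.one_mem_qLattice)]
      generalize D.qpow D.bq (-1) = Q at *
      rw [h1.eq]
      group
    | some i => rw [tauT, map_inv, hT, tauT, inv_inv]
  · have hj := D.half_form_mem_qLattice (D.omega_mem r) (D.omega_mem r)
    have h1 := D.qpow_bq_commute_bX (-(D.form.form (D.omega r) (D.omega r) / 2)) (D.fundWeight r)
    rw [hp, tauPi, map_mul, map_mul, map_qpow, hX, hp, hq, tauPi, D.qpow_inv _ (neg_mem hj),
      D.qpow_neg _ (neg_mem hj)]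
    generalize D.qpow D.bq (-(D.form.form (D.omega r) (D.omega r) / 2)) = Q at *
    rw [← mul_assoc Q, h1.eq]
    group
  · rw [hq, map_inv, hq, inv_inv]

/-- The automorphism `τ_+` of `𝔅`. -/
def tauEquiv : D.BGroup ≃* D.BGroup :=
  D.tauHom.toMulEquiv (D.barHom.comp (D.tauHom.comp D.barHom))
    (by
      have h : D.tauHom = (D.tauHom.comp D.barHom).comp D.barHom := by
        rw [MonoidHom.comp_assoc, barHom_comp_barHom, MonoidHom.comp_id]
      conv_lhs => arg 2; rw [h]
      rw [MonoidHom.comp_assoc, ← MonoidHom.comp_assoc D.barHom, tauHom_barHom_involutive,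
        MonoidHom.id_comp, barHom_comp_barHom])
    (by rw [← MonoidHom.comp_assoc, tauHom_barHom_involutive])

theorem tauEquiv_X (b : D.weights) : D.tauEquiv (D.bX b) = D.bX b :=
  bLift_X (isAffineRep_tau D.isLatticeRep_b D.isAffineRep_b)
    (isLatticeRep_tau D.isLatticeRep_b) b

theorem tauEquiv_T (i : D.Node) : D.tauEquiv (D.bT i) = D.tauT D.bX D.bT D.bq i :=
  bLift_T (isAffineRep_tau D.isLatticeRep_b D.isAffineRep_b)
    (isLatticeRep_tau D.isLatticeRep_b) i

theorem tauEquiv_pi (r : D.orbitO) : D.tauEquiv (D.bPi r) = D.tauPi D.bX D.bPi D.bq r :=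
  bLift_pi (isAffineRep_tau D.isLatticeRep_b D.isAffineRep_b)
    (isLatticeRep_tau D.isLatticeRep_b) r

theorem tauEquiv_q : D.tauEquiv D.bq = D.bq :=
  bLift_q (isAffineRep_tau D.isLatticeRep_b D.isAffineRep_b)
    (isLatticeRep_tau D.isLatticeRep_b)

theorem bY_eq : D.bY = D.semiY D.bT D.bPi := funext fun b => D.isAffineRep_b.prodY_eq b

theorem isTauPlus : D.IsTauPlus D.tauEquiv where
  map_X := D.tauEquiv_X
  map_Y r _ := by
    rw [bY_eq, D.isAffineRep_b.semiY_fundWeight, map_mul, tauEquiv_pi]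
    change _ * D.tauEquiv.toMonoidHom _ = _
    rw [map_weylT, weylT_congr (T' := D.bT) fun i => D.tauEquiv_T (some i), tauPi]
    have h1 := D.qpow_bq_commute_bX (-(D.form.form (D.omega r) (D.omega r) / 2)) (D.fundWeight r)
    have h2 : Commute (D.qpow D.bq (-(D.form.form (D.omega r) (D.omega r) / 2)))
        (D.bPi r * D.weylT D.bT (D.u r)) :=
      D.qpow_commute ((show Commute _ _ from D.isLatticeRep_b.centralPi r).mul_right
        (show Commute _ _ from D.isLatticeRep_b.central_weylT _)).eq _
    rw [← (h1.mul_right h2).eq]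
    simp only [mul_assoc]
  map_T i := D.tauEquiv_T (some i)
  map_Ytheta := by
    rw [bY_eq, D.isAffineRep_b.semiY_theta, map_mul, tauEquiv_T]
    change _ * D.tauEquiv.toMonoidHom _ = _
    rw [map_weylT, weylT_congr (T' := D.bT) fun i => D.tauEquiv_T (some i), tauT]
  map_T0 := D.tauEquiv_T none
  map_q := D.tauEquiv_q

/-! ### The homomorphism `𝔭𝔯` and the involutions -/

/-- The homomorphism `𝔭𝔯`. -/
def prHom : D.UGroup →* D.BGroup :=
  uLift (isAffineRep_tau D.isLatticeRep_b D.isAffineRep_b) (isLatticeRep_tau D.isLatticeRep_b)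
    (isLatticeRep_semiY D.isLatticeRep_b D.isAffineRep_b)

theorem prHom_X (b : D.weights) : D.prHom (D.uX b) = D.bX b := uLift_X _ _ _ _

theorem prHom_Y (b : D.weights) : D.prHom (D.uY b) = D.semiY D.bT D.bPi b := uLift_Y _ _ _ _

theorem prHom_T (i : D.Node) : D.prHom (D.uT i) = D.tauT D.bX D.bT D.bq i := uLift_T _ _ _ _

theorem prHom_pi (r : D.orbitO) : D.prHom (D.uPi r) = D.tauPi D.bX D.bPi D.bq r := uLift_pi _ _ _ _

theorem prHom_q : D.prHom D.uq = D.bq := uLift_q _ _ _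

theorem isPr : D.IsPr D.prHom where
  map_X := D.prHom_X
  map_Y b := by rw [bY_eq, prHom_Y]
  map_T i := D.prHom_T (some i)
  map_T0 := by rw [prHom_T, bY_eq, D.isAffineRep_b.tauT_none_eq]
  map_pi r _ := by rw [prHom_pi, bY_eq, D.isLatticeRep_b.tauPi_eq D.isAffineRep_b]
  map_q := D.prHom_q

/-- The homomorphism `𝔅 → hat 𝔅` that is the identity on the common generators. -/
def inclHom : D.BGroup →* D.UGroup := bLift D.isAffineRep_u D.isLatticeRep_uX

/-- Since `τ_+` is bijective, this gives surjectivity of `𝔭𝔯`, and it dictates the candidate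
`sectionHom` for the inverse. -/
theorem prHom_inclHom (x : D.BGroup) : D.prHom (D.inclHom x) = D.tauEquiv x := by
  have : D.prHom.comp D.inclHom = D.tauEquiv.toMonoidHom := by
    refine bGroup_hom_ext (fun b => ?_) (fun i => ?_) (fun r => ?_) ?_
    all_goals
      rw [MonoidHom.comp_apply, inclHom]
      change _ = D.tauEquiv _
    · rw [bLift_X, prHom_X, tauEquiv_X]
    · rw [bLift_T, prHom_T, tauEquiv_T]
    · rw [bLift_pi, prHom_pi, tauEquiv_pi]
    · rw [bLift_q, prHom_q, tauEquiv_q]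
  exact DFunLike.congr_fun this x

theorem prHom_surjective : Function.Surjective D.prHom := fun x =>
  ⟨D.inclHom (D.tauEquiv.symm x), by rw [prHom_inclHom, MulEquiv.apply_symm_apply]⟩

theorem extraRels_le_ker {G : Type*} [Group G] (φ : D.UGroup →* G)
    (h0 : φ (D.uT none) = D.hatT0 (fun b => φ (D.uX b)) (fun b => φ (D.uY b))
      (fun i => φ (D.uT i)) (φ D.uq))
    (h : ∀ r, φ (D.uPi r) = D.hatPi (fun b => φ (D.uX b)) (fun b => φ (D.uY b))
      (fun i => φ (D.uT i)) (φ D.uq) r) : D.extraRels ≤ φ.ker := by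
  refine Subgroup.normalClosure_le_normal ?_
  rintro _ (rfl | ⟨r, -, rfl⟩)
  · rw [SetLike.mem_coe, MonoidHom.mem_ker, map_mul, map_inv, map_hatT0, ← h0, mul_inv_cancel]
  · rw [SetLike.mem_coe, MonoidHom.mem_ker, map_mul, map_inv, map_hatPi, ← h, mul_inv_cancel]

theorem extraRels_le_ker_prHom : D.extraRels ≤ D.prHom.ker := by
  refine D.extraRels_le_ker _ ?_ fun r => ?_
  · simp only [prHom_X, prHom_Y, prHom_T, prHom_q]
    exact D.isAffineRep_b.tauT_none_eq.trans (hatT0_congr fun _ => rfl)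
  · simp only [prHom_X, prHom_Y, prHom_T, prHom_q, prHom_pi]
    exact (D.isLatticeRep_b.tauPi_eq D.isAffineRep_b r).trans (hatPi_congr (fun _ => rfl) r)

/-- The homomorphism from `𝔅` to the quotient of `hat 𝔅` that is inverse to `𝔭𝔯`. -/
def sectionHom : D.BGroup →* D.UGroup ⧸ D.extraRels :=
  ((QuotientGroup.mk' D.extraRels).comp D.inclHom).comp D.tauEquiv.symm.toMonoidHom

theorem sectionHom_tauEquiv (x : D.BGroup) :
    D.sectionHom (D.tauEquiv x) = (D.inclHom x : D.UGroup ⧸ D.extraRels) := by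
  rw [sectionHom, MonoidHom.comp_apply]
  change QuotientGroup.mk' _ (D.inclHom (D.tauEquiv.symm (D.tauEquiv x))) = _
  rw [MulEquiv.symm_apply_apply]
  rfl

theorem sectionHom_X (b : D.weights) :
    D.sectionHom (D.bX b) = (D.uX b : D.UGroup ⧸ D.extraRels) := by
  rw [← tauEquiv_X, sectionHom_tauEquiv, inclHom, bLift_X]

theorem sectionHom_tauT (i : D.Node) :
    D.sectionHom (D.tauT D.bX D.bT D.bq i) = (D.uT i : D.UGroup ⧸ D.extraRels) := by
  rw [← tauEquiv_T, sectionHom_tauEquiv, inclHom, bLift_T]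

theorem sectionHom_T (i : D.Simple) :
    D.sectionHom (D.bT (some i)) = (D.uT (some i) : D.UGroup ⧸ D.extraRels) :=
  D.sectionHom_tauT (some i)

theorem sectionHom_tauPi (r : D.orbitO) :
    D.sectionHom (D.tauPi D.bX D.bPi D.bq r) = (D.uPi r : D.UGroup ⧸ D.extraRels) := by
  rw [← tauEquiv_pi, sectionHom_tauEquiv, inclHom, bLift_pi]

theorem sectionHom_q : D.sectionHom D.bq = (D.uq : D.UGroup ⧸ D.extraRels) := by
  rw [← tauEquiv_q, sectionHom_tauEquiv, inclHom, bLift_q]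

/-- The `Y_b` are the only generators on which `sectionHom` is not known from its construction. By
`map_semiY` it suffices to treat `Y_ϑ` and `Y_r`. -/
theorem sectionHom_Y (b : D.weights) :
    D.sectionHom (D.semiY D.bT D.bPi b) = (D.uY b : D.UGroup ⧸ D.extraRels) := by
  have hmk : ∀ x y : D.UGroup, x * y⁻¹ ∈ D.extraRels →
      QuotientGroup.mk' D.extraRels x = QuotientGroup.mk' D.extraRels y := fun x y h => by
    rw [← mul_inv_eq_one, ← map_inv, ← map_mul]
    exact (QuotientGroup.eq_one_iff _).2 h
  refine D.isLatticeRep_b.map_semiY D.isAffineRep_b D.sectionHom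
    (fun b => QuotientGroup.mk' D.extraRels (D.uY b)) (fun a b => ?_) (fun i b h => ?_) ?_
    (fun r => ?_) b
  · rw [D.isLatticeRep_uY.add, map_mul]
  · rw [sectionHom_T]
    have h1 := D.isLatticeRep_uY.rel _ _ (.cross (some i) b h)
    have h2 : (D.simpleRoot (some i)).2 = 0 := rfl
    rw [h2, qpow_zero, mul_one] at h1
    have h3 := congrArg (QuotientGroup.mk' D.extraRels) h1
    rw [map_mul, map_mul, map_mul, map_inv, map_inv] at h3
    exact h3
  · have h1 := hmk _ _ (Subgroup.subset_normalClosure (Set.mem_insert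
      (D.uT none * (D.hatT0 D.uX D.uY D.uT D.uq)⁻¹) _))
    have h2 := D.sectionHom_tauT none
    rw [D.isAffineRep_b.tauT_none_eq, map_hatT0] at h2
    have h3 := h2.trans h1
    rw [map_hatT0] at h3
    simp only [sectionHom_X, sectionHom_q] at h3
    rw [hatT0_congr (T' := fun i => QuotientGroup.mk' D.extraRels (D.uT i))
      fun i => D.sectionHom_T i] at h3
    -- Two expressions `q⁻¹ X_ϑ T_{s_ϑ} Y_ϑ⁻¹` for the class of `hat T_0` agree in every factor but
    -- the last, so they agree there too; the case of `Y_r` is similar.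
    exact inv_injective (mul_left_cancel h3)
  · by_cases hr : (r : D.Node) = none
    · have h0 : D.fundWeight r = 0 := by rw [hr]; rfl
      rw [h0, D.isAffineRep_b.semiY_zero, map_one, D.isLatticeRep_uY.zero, map_one]
    · have h1 := hmk _ _ (Subgroup.subset_normalClosure (Set.mem_insert_of_mem
        (D.uT none * (D.hatT0 D.uX D.uY D.uT D.uq)⁻¹) ⟨r, hr, rfl⟩))
      have h2 := D.sectionHom_tauPi r
      rw [D.isLatticeRep_b.tauPi_eq D.isAffineRep_b, map_hatPi] at h2
      have h3 := h2.trans h1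
      rw [map_hatPi] at h3
      simp only [sectionHom_X, sectionHom_q] at h3
      rw [hatPi_congr (T' := fun i => QuotientGroup.mk' D.extraRels (D.uT i))
        fun i => D.sectionHom_T i] at h3
      exact mul_left_cancel (mul_right_cancel (mul_right_cancel h3))

theorem sectionHom_prHom (x : D.UGroup) :
    D.sectionHom (D.prHom x) = (x : D.UGroup ⧸ D.extraRels) := by
  have : D.sectionHom.comp D.prHom = QuotientGroup.mk' D.extraRels := by
    refine uGroup_hom_ext (fun b => ?_) (fun b => ?_) (fun i => ?_) (fun r => ?_) ?_
    all_goals rw [MonoidHom.comp_apply]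
    · rw [prHom_X, sectionHom_X]; rfl
    · rw [prHom_Y, sectionHom_Y]; rfl
    · rw [prHom_T, sectionHom_tauT]; rfl
    · rw [prHom_pi, sectionHom_tauPi]; rfl
    · rw [prHom_q, sectionHom_q]; rfl
  exact DFunLike.congr_fun this x

theorem ker_prHom : D.prHom.ker = D.extraRels := by
  refine le_antisymm (fun x hx => ?_) D.extraRels_le_ker_prHom
  rw [← QuotientGroup.eq_one_iff, ← sectionHom_prHom, MonoidHom.mem_ker.1 hx, map_one]

/-- The isomorphism of the quotient of `hat 𝔅` with `𝔅`. -/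
def quotientEquiv : (D.UGroup ⧸ D.extraRels) ≃* D.BGroup :=
  (QuotientGroup.quotientMulEquivOfEq D.ker_prHom.symm).trans
    (QuotientGroup.quotientKerEquivOfSurjective D.prHom D.prHom_surjective)

theorem quotientEquiv_mk (x : D.UGroup) :
    D.quotientEquiv (x : D.UGroup ⧸ D.extraRels) = D.prHom x := rfl

/-- The endomorphism `hat ε` of the universal group. -/
def epsilonHatHom : D.UGroup →* D.UGroup :=
  uLift D.isAffineRep_u.inv D.isLatticeRep_uY
    (Y := D.uX) (by simpa only [inv_inv] using D.isLatticeRep_uX)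

theorem epsilonHatHom_X (b : D.weights) : D.epsilonHatHom (D.uX b) = D.uY b := uLift_X _ _ _ _

theorem epsilonHatHom_Y (b : D.weights) : D.epsilonHatHom (D.uY b) = D.uX b := uLift_Y _ _ _ _

theorem epsilonHatHom_T (i : D.Node) : D.epsilonHatHom (D.uT i) = (D.uT i)⁻¹ := uLift_T _ _ _ _

theorem epsilonHatHom_pi (r : D.orbitO) : D.epsilonHatHom (D.uPi r) = D.uPi r := uLift_pi _ _ _ _

theorem epsilonHatHom_q : D.epsilonHatHom D.uq = D.uq⁻¹ := uLift_q _ _ _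

theorem epsilonHatHom_involutive : D.epsilonHatHom.comp D.epsilonHatHom = MonoidHom.id _ := by
  refine uGroup_hom_ext (fun b => ?_) (fun b => ?_) (fun i => ?_) (fun r => ?_) ?_
  all_goals rw [MonoidHom.comp_apply, MonoidHom.id_apply]
  · rw [epsilonHatHom_X, epsilonHatHom_Y]
  · rw [epsilonHatHom_Y, epsilonHatHom_X]
  · rw [epsilonHatHom_T, map_inv, epsilonHatHom_T, inv_inv]
  · rw [epsilonHatHom_pi, epsilonHatHom_pi]
  · rw [epsilonHatHom_q, map_inv, epsilonHatHom_q, inv_inv]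

/-- The involution `hat ε` of the universal group. -/
def epsilonHatEquiv : D.UGroup ≃* D.UGroup :=
  D.epsilonHatHom.toMulEquiv D.epsilonHatHom D.epsilonHatHom_involutive D.epsilonHatHom_involutive

theorem epsilonHatEquiv_involutive : Function.Involutive D.epsilonHatEquiv :=
  DFunLike.congr_fun D.epsilonHatHom_involutive

theorem isEpsilonHat : D.IsEpsilonHat D.epsilonHatEquiv where
  map_X := D.epsilonHatHom_X
  map_Y := D.epsilonHatHom_Y
  map_T := D.epsilonHatHom_T
  map_pi := D.epsilonHatHom_pi
  map_q := D.epsilonHatHom_q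
  involutive := D.epsilonHatEquiv_involutive

theorem extraRels_le_ker_prHom_epsilonHat : D.extraRels ≤ (D.prHom.comp D.epsilonHatHom).ker := by
  refine D.extraRels_le_ker _ ?_ fun r => ?_
  all_goals simp only [MonoidHom.comp_apply, epsilonHatHom_X, epsilonHatHom_Y, epsilonHatHom_T,
    epsilonHatHom_pi, epsilonHatHom_q, map_inv, prHom_X, prHom_Y, prHom_T, prHom_q, prHom_pi]
  · exact D.isLatticeRep_b.dual_hatT0 D.isAffineRep_b
  · exact D.isAffineRep_b.dual_hatPi r

/-- The endomorphism `ε` of `𝔅`. -/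
def epsilonHom : D.BGroup →* D.BGroup :=
  (QuotientGroup.lift D.extraRels (D.prHom.comp D.epsilonHatHom)
    D.extraRels_le_ker_prHom_epsilonHat).comp D.quotientEquiv.symm.toMonoidHom

theorem epsilonHom_prHom (x : D.UGroup) :
    D.epsilonHom (D.prHom x) = D.prHom (D.epsilonHatEquiv x) := by
  rw [← quotientEquiv_mk, epsilonHom, MonoidHom.comp_apply]
  change QuotientGroup.lift _ _ _ (D.quotientEquiv.symm (D.quotientEquiv x)) = _
  rw [MulEquiv.symm_apply_apply]
  rfl

theorem epsilonHom_involutive : D.epsilonHom.comp D.epsilonHom = MonoidHom.id _ := by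
  refine MonoidHom.ext fun x => ?_
  obtain ⟨x, rfl⟩ := D.prHom_surjective x
  rw [MonoidHom.comp_apply, epsilonHom_prHom, epsilonHom_prHom, epsilonHatEquiv_involutive]
  rfl

/-- The involution `ε` of `𝔅`. -/
def epsilonEquiv : D.BGroup ≃* D.BGroup :=
  D.epsilonHom.toMulEquiv D.epsilonHom D.epsilonHom_involutive D.epsilonHom_involutive

theorem prHom_epsilonHatEquiv (x : D.UGroup) :
    D.prHom (D.epsilonHatEquiv x) = D.epsilonEquiv (D.prHom x) := (D.epsilonHom_prHom x).symm

theorem isEpsilon : D.IsEpsilon D.epsilonEquiv where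
  map_X b := by
    rw [← prHom_X, ← prHom_epsilonHatEquiv, D.isEpsilonHat.map_X, D.isPr.map_Y]
  map_Y b := by
    rw [← D.isPr.map_Y, ← prHom_epsilonHatEquiv, D.isEpsilonHat.map_Y, D.isPr.map_X]
  map_T i := by
    rw [← D.isPr.map_T, ← prHom_epsilonHatEquiv, D.isEpsilonHat.map_T, map_inv]
  map_q := by
    rw [← prHom_q, ← prHom_epsilonHatEquiv, D.isEpsilonHat.map_q, map_inv]
  involutive := DFunLike.congr_fun D.epsilonHom_involutive

theorem map_extraRels : D.extraRels.map D.epsilonHatEquiv.toMonoidHom = D.extraRels := by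
  have h : ∀ x ∈ D.extraRels, D.epsilonHatEquiv x ∈ D.extraRels := fun x hx => by
    rw [← ker_prHom, MonoidHom.mem_ker] at hx ⊢
    rw [prHom_epsilonHatEquiv, hx, map_one]
  refine le_antisymm (Subgroup.map_le_iff_le_comap.2 h) fun x hx => ?_
  exact ⟨D.epsilonHatEquiv x, h x hx, D.epsilonHatEquiv_involutive x⟩

end AffineData

end

theorem mainTheorem3 {ι V N : Type*} [Finite ι] [AddCommGroup V] [Module ℝ V]
    [AddCommGroup N] [Module ℝ N] (R : RootPairing ι ℝ V N) [R.IsRootSystem]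
    [R.IsCrystallographic] [R.IsReduced] [R.IsIrreducible] (D : AffineData R) :
    ∃ (pr : D.UGroup →* D.BGroup) (τ : D.BGroup ≃* D.BGroup)
      (εhat : D.UGroup ≃* D.UGroup) (ε : D.BGroup ≃* D.BGroup),
      D.IsPr pr ∧ D.IsTauPlus τ ∧ D.IsEpsilonHat εhat ∧ D.IsEpsilon ε ∧
      (∃ e : (D.UGroup ⧸ D.extraRels) ≃* D.BGroup,
        ∀ x : D.UGroup, e (x : D.UGroup ⧸ D.extraRels) = pr x) ∧
      (∀ i : D.Node, pr (D.uT i) = τ (D.bT i)) ∧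
      (∀ r : D.orbitO, pr (D.uPi r) = τ (D.bPi r)) ∧
      D.extraRels.map εhat.toMonoidHom = D.extraRels ∧
      (∀ x : D.UGroup, pr (εhat x) = ε (pr x)) :=
  ⟨D.prHom, D.tauEquiv, D.epsilonHatEquiv, D.epsilonEquiv, D.isPr, D.isTauPlus, D.isEpsilonHat,
    D.isEpsilon, ⟨D.quotientEquiv, D.quotientEquiv_mk⟩,
    fun i => (D.prHom_T i).trans (D.tauEquiv_T i).symm,
    fun r => (D.prHom_pi r).trans (D.tauEquiv_pi r).symm, D.map_extraRels,
    D.prHom_epsilonHatEquiv⟩
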